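/- Let $\mathbb L^3$ be $\mathbb R^3$ with the metric $dx^2+dy^2-dt^2$. For a straight line $l\subset\mathbb L^3$ let $G(l)$ be the identity component of the group of isometries of $\mathbb L^3$ that fix $l$ pointwise. A *circle* in $\mathbb L^3$ is a $G(l)$-orbit of a point, for some line $l$, that is not contained in a straight line. A *ZMC surface of Riemann type* is a smooth immersion $X:\Sigma\to\mathbb L^3$ of a connected smooth $2$-manifold such that * the mean curvature of $X$ vanishes wherever the induced metric is positive definite ($X$ is spacelike there) or non-degenerate of index $1$ ($X$ is timelike there); $X$ is called lightlike where the induced metric is degenerate; * $X$ is foliated by circles and at most countably many straight lines in parallel planes, i.e. $X$ is transverse to a family of parallel planes, each of which meets $X(\Sigma)$, if at all, in a circle or, for at most countably many of the planes, in a straight line; * $X$ is non-rotational, i.e. $X(\Sigma)$ is not invariant under $G(l)$ for any straight line $l$. Suppose that a ZMC surface of Riemann type $X$ has exactly two causal characters, that is, either it has spacelike points and lightlike points but no timelike points, or it has timelike points and lightlike points but no spacelike points. Then the lightlike part of the surface (the image under $X$ of the set of lightlike points) is part of a straight line, except in the following case: up to an isometry of $\mathbb L^3$, $$X(\Sigma)=\{(u+\rho\cos\theta,\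 \rho\sin\theta,\ u)\;:\;u\in J,\ \theta\in\mathbb R\}$$ for some $\rho>0$ and some open interval $J$; in this case the lightlike part consists of the two parts $\{(u+\rho,0,u):u\in J\}$ and $\{(u-\rho,0,u):u\in J\}$ of two parallel straight lines. -/

import Mathlib

open scoped Manifold ContDiff Matrix

noncomputable section

namespace LorentzMinkowski

/-- The real vector space `ℝ³` underlying the Lorentz-Minkowski `3`-space, with coordinates
`(x, y, t) = (p 0, p 1, p 2)`. -/
abbrev L3 : Type := Fin 3 → ℝ

/-- The coordinate plane on which surfaces are modelled. -/
abbrev E2 : Type := EuclideanSpace ℝ (Fin 2)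

/-- The Lorentzian metric `dx² + dy² - dt²`. -/
def lorentz (v w : L3) : ℝ := v 0 * w 0 + v 1 * w 1 - v 2 * w 2

/-- The Lorentzian vector product, characterised by `⟨v × w, z⟩ = det (v, w, z)`. -/
def lorentzCross (v w : L3) : L3 :=
  ![v 1 * w 2 - v 2 * w 1, v 2 * w 0 - v 0 * w 2, -(v 0 * w 1 - v 1 * w 0)]

/-- Linear isometries of the Lorentz-Minkowski space, as matrices. -/
def IsLorentz (A : Matrix (Fin 3) (Fin 3) ℝ) : Prop :=
  ∀ v w : L3, lorentz (A *ᵥ v) (A *ᵥ w) = lorentz v w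

/-- Straight lines. -/
def lineThrough (c d : L3) : Set L3 := {p | ∃ s : ℝ, p = c + s • d}

def IsLine (C : Set L3) : Prop := ∃ c d : L3, d ≠ 0 ∧ C = lineThrough c d

/-- The linear parts of the elements of `G(l)`, where `l` is a straight line with direction `d`
and `G(l)` is the identity component of the group of isometries fixing `l` pointwise. -/
def axisGroup (d : L3) : Set (Matrix (Fin 3) (Fin 3) ℝ) :=
  connectedComponentIn {A | IsLorentz A ∧ A *ᵥ d = d} 1

/-- The affine map with linear part `A` which fixes the point `c`. For `A ∈ axisGroup d`
these are exactly the elements of `G(l)` with `l = lineThrough c d`. -/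
def isometryAt (c : L3) (A : Matrix (Fin 3) (Fin 3) ℝ) (p : L3) : L3 := c + A *ᵥ (p - c)

/-- A circle is a nonlinear `G(l)`-orbit of a point. (The orbit of a point of `l` is a single point,
hence collinear.) -/
def IsCircle (C : Set L3) : Prop :=
  ∃ c d p : L3, d ≠ 0 ∧ C = (fun A => isometryAt c A p) '' axisGroup d ∧ ¬ Collinear ℝ C

/-- A subset `S` is rotational with axis `l = lineThrough c d` if it is invariant
under `G(l)`. -/
def IsRotationalAbout (c d : L3) (S : Set L3) : Prop :=
  ∀ A ∈ axisGroup d, ∀ p ∈ S, isometryAt c A p ∈ S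

/-! ### First and second fundamental forms of a parametrized surface `Y : E2 → L3` -/

/-- First partial derivative of `Y` in the `i`-th coordinate. -/
def partialD (i : Fin 2) (Y : E2 → L3) (z : E2) : L3 :=
  fderiv ℝ Y z (EuclideanSpace.single i 1)

/-- The coefficients `E`, `F`, `G` of the induced metric:
`E = firstForm Y 0 0 z`, `F = firstForm Y 0 1 z`, `G = firstForm Y 1 1 z`. -/
def firstForm (Y : E2 → L3) (i j : Fin 2) (z : E2) : ℝ :=
  lorentz (partialD i Y z) (partialD j Y z)

/-- `EG - F²`. -/
def metricDet (Y : E2 → L3) (z : E2) : ℝ :=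
  firstForm Y 0 0 z * firstForm Y 1 1 z - firstForm Y 0 1 z ^ 2

/-- The sign `ε`, equal to `1` on the spacelike part and to `-1` on the timelike part. -/
def causalSign (Y : E2 → L3) (z : E2) : ℝ := ((SignType.sign (metricDet Y z) : SignType) : ℝ)

/-- The unit normal `ν = (Y_u × Y_v) / √(ε (EG - F²))`. -/
def unitNormal (Y : E2 → L3) (z : E2) : L3 :=
  (Real.sqrt (causalSign Y z * metricDet Y z))⁻¹ •
    lorentzCross (partialD 0 Y z) (partialD 1 Y z)

/-- The coefficients `L`, `M`, `N` of the second fundamental form. -/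
def secondForm (Y : E2 → L3) (i j : Fin 2) (z : E2) : ℝ :=
  lorentz (partialD i (partialD j Y) z) (unitNormal Y z)

/-- The mean curvature `H = -(ε/2) (EN - 2FM + GL)/(EG - F²)`; it is used only where
`EG - F² ≠ 0`. -/
def meanCurvature (Y : E2 → L3) (z : E2) : ℝ :=
  -(causalSign Y z / 2) *
    ((firstForm Y 0 0 z * secondForm Y 1 1 z - 2 * firstForm Y 0 1 z * secondForm Y 0 1 z
      + firstForm Y 1 1 z * secondForm Y 0 0 z) / metricDet Y z)

/-! ### Surfaces `X : S → L3`, where `S` is a `2`-dimensional manifold -/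

section Surface

variable {S : Type*} [TopologicalSpace S] [ChartedSpace E2 S]

/-- The induced metric `X^*⟨ , ⟩` on the tangent space at `p`. -/
def inducedMetric (X : S → L3) (p : S) (v w : TangentSpace (𝓡 2) p) : ℝ :=
  lorentz (mfderiv (𝓡 2) 𝓘(ℝ, L3) X p v) (mfderiv (𝓡 2) 𝓘(ℝ, L3) X p w)

/-- The induced metric is positive definite at `p`. -/
def SpacelikeAt (X : S → L3) (p : S) : Prop :=
  ∀ v : TangentSpace (𝓡 2) p, v ≠ 0 → 0 < inducedMetric X p v v

/-- The induced metric is degenerate at `p`. -/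
def LightlikeAt (X : S → L3) (p : S) : Prop :=
  ∃ v : TangentSpace (𝓡 2) p, v ≠ 0 ∧ ∀ w : TangentSpace (𝓡 2) p, inducedMetric X p v w = 0

/-- The induced metric is non-degenerate of index `1` at `p` (on a plane: non-degenerate, with
both negative and positive values). -/
def TimelikeAt (X : S → L3) (p : S) : Prop :=
  ¬ LightlikeAt X p ∧ (∃ v : TangentSpace (𝓡 2) p, inducedMetric X p v v < 0) ∧
    ∃ w : TangentSpace (𝓡 2) p, 0 < inducedMetric X p w w

/-- The image in the Lorentz-Minkowski space of the lightlike part of `X`. -/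
def lightlikePart (X : S → L3) : Set L3 := X '' {p | LightlikeAt X p}

/-- The mean curvature vanishes on the spacelike part and on the timelike part. It is computed
at each point `p` in the preferred local coordinate system around `p`; its vanishing does not
depend on the coordinate system. -/
def HasZeroMeanCurvature (X : S → L3) : Prop :=
  ∀ p : S, SpacelikeAt X p ∨ TimelikeAt X p →
    meanCurvature (X ∘ (extChartAt (𝓡 2) p).symm) (extChartAt (𝓡 2) p p) = 0

/-- The part of the surface `X` in the plane `ℓ = u`. -/
def leaf (X : S → L3) (ℓ : L3 →ₗ[ℝ] ℝ) (u : ℝ) : Set L3 := X '' {q | ℓ (X q) = u}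

/-- `X` is foliated by circles and at most countably many straight lines in parallel planes:
for some linear form `ℓ`, the surface is transverse to the parallel planes `ℓ = u`, and each of
these planes that meets the surface meets it in a circle or, for at most countably many
values `u`, in a straight line. -/
def FoliatedByCirclesAndLines (X : S → L3) : Prop :=
  ∃ ℓ : L3 →ₗ[ℝ] ℝ,
    (∀ p : S, ∃ v : TangentSpace (𝓡 2) p, ℓ (mfderiv (𝓡 2) 𝓘(ℝ, L3) X p v) ≠ 0) ∧
    (∀ p : S, IsCircle (leaf X ℓ (ℓ (X p))) ∨ IsLine (leaf X ℓ (ℓ (X p)))) ∧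
    {u : ℝ | IsLine (leaf X ℓ u)}.Countable

/-- Zero mean curvature surfaces of Riemann type. -/
structure IsZMCOfRiemannType (X : S → L3) : Prop where
  smooth : ContMDiff (𝓡 2) 𝓘(ℝ, L3) ∞ X
  immersion : ∀ p : S, Function.Injective (mfderiv (𝓡 2) 𝓘(ℝ, L3) X p)
  zeroMeanCurvature : HasZeroMeanCurvature X
  foliated : FoliatedByCirclesAndLines X
  nonRotational : ¬ ∃ c d : L3, d ≠ 0 ∧ IsRotationalAbout c d (Set.range X)

/-- `X` has exactly two causal characters: only spacelike and lightlike parts, or only timelike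
and lightlike parts. -/
def HasExactlyTwoCausalCharacters (X : S → L3) : Prop :=
  ((∃ p, SpacelikeAt X p) ∧ (∃ p, LightlikeAt X p) ∧ ¬ ∃ p, TimelikeAt X p) ∨
  ((∃ p, TimelikeAt X p) ∧ (∃ p, LightlikeAt X p) ∧ ¬ ∃ p, SpacelikeAt X p)

/-- The exceptional case: up to an isometry of the Lorentz-Minkowski space, `X` is the part
`t ∈ J` (for an open interval `J`) of the circular cylinder
`(u + ρ cos θ, ρ sin θ, u)` of radius `ρ > 0` with lightlike rulings, and its lightlike part
consists of the parts `u ∈ J` of the two parallel lines `(u ± ρ, 0, u)`. -/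
def IsLightlikeCylinder (X : S → L3) : Prop :=
  ∃ (A : Matrix (Fin 3) (Fin 3) ℝ) (c : L3) (ρ : ℝ) (J : Set ℝ),
    IsLorentz A ∧ 0 < ρ ∧ IsOpen J ∧ J.OrdConnected ∧
    Set.range X = {p | ∃ u ∈ J, ∃ θ : ℝ,
      p = c + A *ᵥ ![u + ρ * Real.cos θ, ρ * Real.sin θ, u]} ∧
    lightlikePart X = {p | ∃ u ∈ J,
      p = c + A *ᵥ ![u + ρ, 0, u] ∨ p = c + A *ᵥ ![u - ρ, 0, u]}

end Surface

end LorentzMinkowski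

end

/-!
The surface has one causal sign, so a lightlike point is an extremum, with value zero, of the
determinant of the induced metric. Write `n` for the null normal there. Near the point the surface
is a graph `q = ψ(x, p + e q)` in coordinates with metric `dx² + dp dq`, where `∂/∂p = n`, and the
function `graphDet`, whose sign decides the causal character, vanishes at the point together with
its first derivatives. Along the null line in the direction `n` the zero mean curvature equation and
its `x`-derivative form a linear homogeneous system of ordinary differential equations for the
derivatives `∂ψ/∂x`, `∂ψ/∂u` and `∂²ψ/∂x∂u` with respect to `x` and `u = p + e q`. Hence these
vanish, and a segment of that null line lies in the surface, with constant tangent plane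
(`graph_contains_null_line`).

The null line is transverse to the planes of the foliation (`IsOneSidedFoliated.height_ne_zero`).
Otherwise the planes would be timelike and the leaves lines and hyperbolas with null asymptotes,
that is `q = B + κ p / (1 + g p)` with coefficients depending on `x`, or null lines. On an interval
with `κ ≠ 0`, which exists because only countably many leaves are lines, the zero mean curvature
equation becomes a linear system of ordinary differential equations for `(κ, g)`. At an end of such
an interval where `κ = 0` the leaf is a full null line, so `g` tends to zero as well, and
uniqueness of solutions gives `κ = 0` on the whole interval (`D2_ne_zero_of_leaves`).

Hence the coordinate `u = p + e q` can be chosen to be the height of the planes. Each leaf touches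
the null line and lies on a quadric of the form `x² - e q²` plus linear terms, so it is the conic
`q = a(u) (x² - e q²)`, and the zero mean curvature equation says precisely that `a'' = 2 a a'`,
that is `a' = a² + k` for a constant `k` (`IsOneSidedFoliated.exists_normal_form`). The heights of
the points of the null line in the surface form an open set, and a closed one in the set of all
heights, because the conics converge (`IsOneSidedFoliated.mem_axisHeights_of_mem_closure`). As the
surface is connected, all its leaves are conics of this form (`HasConicLeaves`).

With `N = x² - e q²` a normal vector has square a constant multiple of `k N (1 - e k N)`. If `k`
were zero, all points would be lightlike. So a lightlike point has `N = 0`, which gives the null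
line itself, or `e k N = 1`. Since `1 - e k N` does not change sign across such a point, `x = 0`
there, and then `e < 0` and `a² = -k` at its height. In the latter case the Riccati equation makes
`a` constant, and the leaves are congruent ellipses, translates of each other along `n`: this is the
cylinder with lightlike rulings, whose points with `x = 0` form two parallel lines.
-/

noncomputable section

namespace LorentzMinkowski

/-! ### Algebra of the Lorentzian scalar product -/

section

theorem lorentz_comm (v w : L3) : lorentz v w = lorentz w v := by
  unfold lorentz; ring

theorem lorentz_add_left (u v w : L3) : lorentz (u + v) w = lorentz u w + lorentz v w := by
  simp only [lorentz, Pi.add_apply]; ring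

theorem lorentz_sub_left (u v w : L3) : lorentz (u - v) w = lorentz u w - lorentz v w := by
  simp only [lorentz, Pi.sub_apply]; ring

theorem lorentz_smul_left (a : ℝ) (v w : L3) : lorentz (a • v) w = a * lorentz v w := by
  simp only [lorentz, Pi.smul_apply, smul_eq_mul]; ring

theorem lorentz_add_right (u v w : L3) : lorentz u (v + w) = lorentz u v + lorentz u w := by
  simp only [lorentz, Pi.add_apply]; ring

theorem lorentz_sub_right (u v w : L3) : lorentz u (v - w) = lorentz u v - lorentz u w := by
  simp only [lorentz, Pi.sub_apply]; ring

theorem lorentz_smul_right (a : ℝ) (v w : L3) : lorentz v (a • w) = a * lorentz v w := by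
  simp only [lorentz, Pi.smul_apply, smul_eq_mul]; ring

theorem lorentz_zero_left (w : L3) : lorentz 0 w = 0 := by simp [lorentz]

theorem lorentz_zero_right (w : L3) : lorentz w 0 = 0 := by simp [lorentz]

/-- The linear form `⟨·, a⟩`. -/
def pairing (a : L3) : L3 →L[ℝ] ℝ :=
  LinearMap.toContinuousLinearMap
    { toFun := fun w => lorentz w a
      map_add' := fun u v => lorentz_add_left u v a
      map_smul' := fun r v => lorentz_smul_left r v a }

@[simp] theorem pairing_apply (a w : L3) : pairing a w = lorentz w a := rfl

theorem lorentz_nondegenerate {a : L3} (h : ∀ w, lorentz a w = 0) : a = 0 := by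
  have h0 := h ![1, 0, 0]
  have h1 := h ![0, 1, 0]
  have h2 := h ![0, 0, 1]
  simp [lorentz] at h0 h1 h2
  ext i; fin_cases i <;> simp [h0, h1, h2]

/-- Every linear form is `⟨·, a⟩` for some vector `a`. -/
theorem exists_dual (l : L3 →ₗ[ℝ] ℝ) : ∃ a : L3, ∀ w, l w = lorentz w a := by
  refine ⟨![l ![1, 0, 0], l ![0, 1, 0], -l ![0, 0, 1]], fun w => ?_⟩
  have hw : w = w 0 • (![1, 0, 0] : L3) + w 1 • (![0, 1, 0] : L3) + w 2 • (![0, 0, 1] : L3) := by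
    ext i; fin_cases i <;> simp
  conv_lhs => rw [hw, map_add, map_add, map_smul, map_smul, map_smul]
  simp [lorentz]

/-- A non-zero vector orthogonal to a timelike vector is spacelike. -/
theorem lorentz_self_pos_of_orthogonal {a w : L3} (ha : lorentz a a < 0) (h : lorentz a w = 0)
    (hw : w ≠ 0) : 0 < lorentz w w := by
  simp only [lorentz] at *
  have ha2 : 0 < a 2 ^ 2 := by nlinarith [sq_nonneg (a 0), sq_nonneg (a 1)]
  have key : a 2 ^ 2 * (w 0 * w 0 + w 1 * w 1 - w 2 * w 2)
      = (w 0 ^ 2 + w 1 ^ 2) * (a 2 ^ 2 - a 0 ^ 2 - a 1 ^ 2) + (a 0 * w 1 - a 1 * w 0) ^ 2 := by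
    have : a 2 * w 2 = a 0 * w 0 + a 1 * w 1 := by linarith
    have h2 : a 2 ^ 2 * (w 2 * w 2) = (a 0 * w 0 + a 1 * w 1) ^ 2 := by rw [← this]; ring
    linear_combination -h2
  have hpos : 0 < w 0 ^ 2 + w 1 ^ 2 := by
    by_contra hcon
    have h0 : w 0 = 0 := by nlinarith [sq_nonneg (w 0), sq_nonneg (w 1)]
    have h1 : w 1 = 0 := by nlinarith [sq_nonneg (w 0), sq_nonneg (w 1)]
    have h2 : w 2 = 0 := by
      have : a 2 * w 2 = 0 := by rw [h0, h1] at h; linarith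
      rcases mul_eq_zero.1 this with h' | h'
      · rw [h'] at ha2; norm_num at ha2
      · exact h'
    exact hw (by ext i; fin_cases i <;> simp [h0, h1, h2])
  have : 0 < a 2 ^ 2 * (w 0 * w 0 + w 1 * w 1 - w 2 * w 2) := by
    rw [key]
    have : 0 < a 2 ^ 2 - a 0 ^ 2 - a 1 ^ 2 := by nlinarith
    positivity
  exact pos_of_mul_pos_right this ha2.le

/-- The orthogonal complement of a null vector `n` is positive semidefinite, and its null vectors
are multiples of `n`. -/
theorem lorentz_self_pos_of_orthogonal_null {n w : L3} (hn0 : n ≠ 0) (hn : lorentz n n = 0)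
    (h : lorentz w n = 0) (hw : ∀ s : ℝ, w ≠ s • n) : 0 < lorentz w w := by
  simp only [lorentz] at *
  have hn2 : n 2 ≠ 0 := by
    intro h2
    rw [h2] at hn
    have h0 : n 0 = 0 := by nlinarith [sq_nonneg (n 0), sq_nonneg (n 1)]
    have h1 : n 1 = 0 := by nlinarith [sq_nonneg (n 0), sq_nonneg (n 1)]
    exact hn0 (by ext i; fin_cases i <;> simp [h0, h1, h2])
  have key : n 2 ^ 2 * (w 0 * w 0 + w 1 * w 1 - w 2 * w 2) = (n 0 * w 1 - n 1 * w 0) ^ 2 := by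
    have : n 2 * w 2 = n 0 * w 0 + n 1 * w 1 := by linarith
    have h2 : n 2 ^ 2 * (w 2 * w 2) = (n 0 * w 0 + n 1 * w 1) ^ 2 := by rw [← this]; ring
    have h3 : n 2 ^ 2 = n 0 ^ 2 + n 1 ^ 2 := by linarith
    rw [mul_sub, h2, h3]; ring
  have hne : n 0 * w 1 - n 1 * w 0 ≠ 0 := by
    intro h0
    apply hw (w 2 / n 2)
    have h3 : n 2 ^ 2 = n 0 ^ 2 + n 1 ^ 2 := by linarith
    have e0 : w 0 * n 2 = w 2 * n 0 := by
      have : n 2 * (w 0 * n 2 - w 2 * n 0) = 0 := by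
        linear_combination w 0 * h3 + n 0 * h - n 1 * h0
      rcases mul_eq_zero.1 this with h' | h'
      · exact absurd h' hn2
      · linarith
    have e1 : w 1 * n 2 = w 2 * n 1 := by
      have : n 2 * (w 1 * n 2 - w 2 * n 1) = 0 := by
        linear_combination w 1 * h3 + n 1 * h + n 0 * h0
      rcases mul_eq_zero.1 this with h' | h'
      · exact absurd h' hn2
      · linarith
    ext i; fin_cases i <;> simp <;> field_simp <;> linarith
  have hsq : 0 < n 2 ^ 2 := by positivity
  have : 0 < n 2 ^ 2 * (w 0 * w 0 + w 1 * w 1 - w 2 * w 2) := by rw [key]; positivity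
  exact pos_of_mul_pos_right this hsq.le

/-- A basis `v, n, m` with `v` a unit spacelike vector orthogonal to the two null vectors `n` and
`m`, which are normalised by `⟨n, m⟩ = 1/2`. In the corresponding coordinates `(x, p, q)`, that is
for `w = x v + p n + q m`, the metric is `dx² + dp dq`. -/
structure NullFrame (v n m : L3) : Prop where
  vv : lorentz v v = 1
  nn : lorentz n n = 0
  mm : lorentz m m = 0
  vn : lorentz v n = 0
  vm : lorentz v m = 0
  nm : lorentz n m = 1 / 2

namespace NullFrame

variable {v n m : L3}

theorem nv (h : NullFrame v n m) : lorentz n v = 0 := by rw [lorentz_comm, h.vn]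
theorem mv (h : NullFrame v n m) : lorentz m v = 0 := by rw [lorentz_comm, h.vm]
theorem mn (h : NullFrame v n m) : lorentz m n = 1 / 2 := by rw [lorentz_comm, h.nm]

theorem cross_ne (h : NullFrame v n m) : lorentz m (lorentzCross v n) ≠ 0 := by
  have key : lorentz m (lorentzCross v n) ^ 2 =
      -(lorentz v v * (lorentz n n * lorentz m m - lorentz n m ^ 2)
        - lorentz v n * (lorentz v n * lorentz m m - lorentz n m * lorentz v m)
        + lorentz v m * (lorentz v n * lorentz n m - lorentz n n * lorentz v m)) := by
    simp [lorentz, lorentzCross]; ring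
  rw [h.vv, h.nn, h.mm, h.vn, h.vm, h.nm] at key
  intro h0
  rw [h0] at key
  norm_num at key

theorem eq_zero_of_orthogonal (h : NullFrame v n m) {w : L3} (h1 : lorentz w v = 0)
    (h2 : lorentz w n = 0) (h3 : lorentz w m = 0) : w = 0 := by
  have hd := h.cross_ne
  apply lorentz_nondegenerate
  have e0 : lorentz m (lorentzCross v n) * w 0 = 0 := by
    simp only [lorentz, lorentzCross, Matrix.cons_val] at *
    linear_combination (n 1 * m 2 - n 2 * m 1) * h1 + (m 1 * v 2 - m 2 * v 1) * h2 +
      (v 1 * n 2 - v 2 * n 1) * h3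
  have e1 : lorentz m (lorentzCross v n) * w 1 = 0 := by
    simp only [lorentz, lorentzCross, Matrix.cons_val] at *
    linear_combination (n 2 * m 0 - n 0 * m 2) * h1 + (m 2 * v 0 - m 0 * v 2) * h2 +
      (v 2 * n 0 - v 0 * n 2) * h3
  have e2 : lorentz m (lorentzCross v n) * w 2 = 0 := by
    simp only [lorentz, lorentzCross, Matrix.cons_val] at *
    linear_combination -(n 0 * m 1 - n 1 * m 0) * h1 - (m 0 * v 1 - m 1 * v 0) * h2 -
      (v 0 * n 1 - v 1 * n 0) * h3
  have f0 := (mul_eq_zero.1 e0).resolve_left hd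
  have f1 := (mul_eq_zero.1 e1).resolve_left hd
  have f2 := (mul_eq_zero.1 e2).resolve_left hd
  intro u
  simp [lorentz, f0, f1, f2]

theorem expand (h : NullFrame v n m) (w : L3) :
    w = lorentz w v • v + (2 * lorentz w m) • n + (2 * lorentz w n) • m := by
  rw [← sub_eq_zero]
  apply h.eq_zero_of_orthogonal <;>
  simp only [lorentz_sub_left, lorentz_add_left, lorentz_smul_left, h.vv, h.nn, h.mm, h.vn, h.vm,
    h.nm, h.nv, h.mv, h.mn] <;> ring

theorem lorentz_eq (h : NullFrame v n m) (w w' : L3) :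
    lorentz w w' = lorentz w v * lorentz w' v +
      2 * (lorentz w m * lorentz w' n + lorentz w n * lorentz w' m) := by
  conv_lhs => rw [h.expand w]
  rw [lorentz_add_left, lorentz_add_left, lorentz_smul_left, lorentz_smul_left, lorentz_smul_left,
    lorentz_comm v w', lorentz_comm n w', lorentz_comm m w']
  ring

theorem n_ne (h : NullFrame v n m) : n ≠ 0 := by
  rintro rfl; have := h.nm; rw [lorentz_zero_left] at this; norm_num at this

/-- The triple product in the coordinates of a null frame. -/
theorem triple (h : NullFrame v n m) (a b c : L3) :
    lorentz c (lorentzCross a b) = lorentz m (lorentzCross v n) *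
      (lorentz a v * ((2 * lorentz b m) * (2 * lorentz c n) - (2 * lorentz b n) * (2 * lorentz c m))
      - 2 * lorentz a m * (lorentz b v * (2 * lorentz c n) - (2 * lorentz b n) * lorentz c v)
      + 2 * lorentz a n * (lorentz b v * (2 * lorentz c m) - (2 * lorentz b m) * lorentz c v)) := by
  have key : ∀ x p q x' p' q' x'' p'' q'' : ℝ,
      lorentz (x'' • v + p'' • n + q'' • m)
        (lorentzCross (x • v + p • n + q • m) (x' • v + p' • n + q' • m)) =
      lorentz m (lorentzCross v n) * (x * (p' * q'' - q' * p'') - p * (x' * q'' - q' * x'')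
        + q * (x' * p'' - p' * x'')) := by
    intro x p q x' p' q' x'' p'' q''
    simp [lorentz, lorentzCross]; ring
  conv_lhs => rw [h.expand a, h.expand b, h.expand c]
  rw [key]

end NullFrame

theorem exists_nullFrame {v n : L3} (hv : lorentz v v = 1) (hn : lorentz n n = 0) (hn0 : n ≠ 0)
    (hvn : lorentz v n = 0) : ∃ m, NullFrame v n m := by
  obtain ⟨y, hy⟩ : ∃ y : L3, lorentz y n = 1 / 2 := by
    by_contra hcon
    push Not at hcon
    apply hn0
    apply lorentz_nondegenerate
    intro w
    by_contra hw
    apply hcon ((1 / (2 * lorentz n w)) • w)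
    rw [lorentz_smul_left, lorentz_comm w n]
    field_simp
  set y' : L3 := y - lorentz y v • v with hy'
  have h1 : lorentz y' v = 0 := by rw [hy', lorentz_sub_left, lorentz_smul_left, hv]; ring
  have h2 : lorentz y' n = 1 / 2 := by rw [hy', lorentz_sub_left, lorentz_smul_left, hvn, hy]; ring
  refine ⟨y' - lorentz y' y' • n, ⟨hv, hn, ?_, hvn, ?_, ?_⟩⟩
  · simp only [lorentz_sub_left, lorentz_sub_right, lorentz_smul_left, lorentz_smul_right, hn, h2,
      lorentz_comm n y']
    ring
  · rw [lorentz_sub_right, lorentz_smul_right, hvn, lorentz_comm v y', h1]; ring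
  · rw [lorentz_sub_right, lorentz_smul_right, hn, lorentz_comm n y', h2]; ring

end

/-! ### The causal character in terms of a normal vector -/

section

theorem finrank_ker_pairing {a : L3} (ha : a ≠ 0) :
    Module.finrank ℝ (LinearMap.ker (pairing a : L3 →ₗ[ℝ] ℝ)) = 2 := by
  have h1 := LinearMap.finrank_range_add_finrank_ker (pairing a : L3 →ₗ[ℝ] ℝ)
  have h2 : LinearMap.range (pairing a : L3 →ₗ[ℝ] ℝ) = ⊤ := by
    apply LinearMap.range_eq_top.2
    apply LinearMap.surjective
    intro h0
    apply ha
    apply lorentz_nondegenerate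
    intro w
    rw [lorentz_comm]
    exact congrArg (fun f : L3 →ₗ[ℝ] ℝ => f w) h0
  rw [h2, finrank_top] at h1
  simp at h1
  omega

/-- The image of an injective linear map of a plane which is orthogonal to `a ≠ 0` is the whole
orthogonal complement of `a`. -/
theorem exists_preimage_of_orthogonal {D : E2 →L[ℝ] L3} (hD : Function.Injective D) {a : L3}
    (ha : a ≠ 0) (h : ∀ w, lorentz (D w) a = 0) {y : L3} (hy : lorentz y a = 0) :
    ∃ w, D w = y := by
  have hle : LinearMap.range (D : E2 →ₗ[ℝ] L3) ≤ LinearMap.ker (pairing a : L3 →ₗ[ℝ] ℝ) := by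
    rintro _ ⟨w, rfl⟩
    exact h w
  have hr : Module.finrank ℝ (LinearMap.range (D : E2 →ₗ[ℝ] L3)) = 2 := by
    rw [LinearMap.finrank_range_of_inj (f := (D : E2 →ₗ[ℝ] L3)) hD]
    simp
  have := Submodule.eq_of_le_of_finrank_eq hle (by rw [hr, finrank_ker_pairing ha])
  have hy' : y ∈ LinearMap.range (D : E2 →ₗ[ℝ] L3) := by rw [this]; exact hy
  exact hy'

variable {S : Type*} [TopologicalSpace S] [ChartedSpace E2 S]

/-- The differential of `X` at `z`, as a linear map on the model plane. -/
def dX (X : S → L3) (z : S) : E2 →L[ℝ] L3 := mfderiv (𝓡 2) 𝓘(ℝ, L3) X z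

theorem lightlikeAt_iff {X : S → L3} {z : S} : LightlikeAt X z ↔
    ∃ v : E2, v ≠ 0 ∧ ∀ w : E2, lorentz (dX X z v) (dX X z w) = 0 := Iff.rfl

theorem spacelikeAt_iff {X : S → L3} {z : S} : SpacelikeAt X z ↔
    ∀ v : E2, v ≠ 0 → 0 < lorentz (dX X z v) (dX X z v) := Iff.rfl

theorem timelikeAt_iff {X : S → L3} {z : S} : TimelikeAt X z ↔ ¬ LightlikeAt X z ∧
    (∃ v : E2, lorentz (dX X z v) (dX X z v) < 0) ∧
    ∃ v : E2, 0 < lorentz (dX X z v) (dX X z v) := Iff.rfl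

theorem SpacelikeAt.not_lightlikeAt {X : S → L3} {z : S} (h : SpacelikeAt X z) :
    ¬ LightlikeAt X z := by
  rintro ⟨v, hv, hw⟩
  have := h v hv
  rw [hw v] at this
  exact lt_irrefl _ this

theorem SpacelikeAt.not_timelikeAt {X : S → L3} {z : S} (h : SpacelikeAt X z) :
    ¬ TimelikeAt X z := by
  rw [spacelikeAt_iff] at h
  rw [timelikeAt_iff]
  rintro ⟨_, ⟨v, hv⟩, _⟩
  by_cases h0 : v = 0
  · rw [h0, map_zero, lorentz_zero_left] at hv; exact lt_irrefl _ hv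
  · exact lt_asymm hv (h v h0)

/-- `a` is a non-zero normal vector of `X` at `z`. -/
structure IsNormalAt (X : S → L3) (z : S) (a : L3) : Prop where
  inj : Function.Injective (dX X z)
  ne : a ≠ 0
  orth : ∀ w, lorentz (dX X z w) a = 0

namespace IsNormalAt

variable {X : S → L3} {z : S} {a : L3}

theorem exists_preimage (h : IsNormalAt X z a) {y : L3} (hy : lorentz y a = 0) :
    ∃ w, dX X z w = y := exists_preimage_of_orthogonal h.inj h.ne h.orth hy

theorem lightlike_of (h : IsNormalAt X z a) (ha : lorentz a a = 0) : LightlikeAt X z := by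
  obtain ⟨v, hv⟩ := h.exists_preimage ha
  refine lightlikeAt_iff.2 ⟨v, ?_, fun w => ?_⟩
  · rintro rfl
    rw [map_zero] at hv
    exact h.ne hv.symm
  · rw [hv, lorentz_comm, h.orth]

theorem spacelike_of (h : IsNormalAt X z a) (ha : lorentz a a < 0) : SpacelikeAt X z := by
  rw [spacelikeAt_iff]
  intro v hv
  apply lorentz_self_pos_of_orthogonal ha
  · rw [lorentz_comm, h.orth]
  · intro h0
    exact hv (h.inj (by rw [h0, map_zero]))

theorem timelike_of (h : IsNormalAt X z a) (ha : 0 < lorentz a a) : TimelikeAt X z := by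
  refine timelikeAt_iff.2 ⟨?_, ?_, ?_⟩
  · rw [lightlikeAt_iff]
    rintro ⟨v, hv, hw⟩
    set t := dX X z v with ht
    -- `⟨a,a⟩ y - ⟨y,a⟩ a` is orthogonal to `a`, hence tangent, for every `y`.
    apply hv
    apply h.inj
    rw [map_zero, ← ht]
    apply lorentz_nondegenerate
    intro y
    obtain ⟨w, hw'⟩ := h.exists_preimage (y := lorentz a a • y - lorentz y a • a) (by
      rw [lorentz_sub_left, lorentz_smul_left, lorentz_smul_left]; ring)
    have h1 := hw w
    rw [hw', lorentz_sub_right, lorentz_smul_right, lorentz_smul_right, ht, h.orth v, mul_zero,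
      sub_zero] at h1
    exact (mul_eq_zero.1 h1).resolve_left ha.ne'
  · obtain ⟨w, hw⟩ := h.exists_preimage (y := lorentz a a • ![0, 0, 1] - lorentz ![0, 0, 1] a • a)
      (by rw [lorentz_sub_left, lorentz_smul_left, lorentz_smul_left]; ring)
    refine ⟨w, ?_⟩
    rw [hw]
    have e : lorentz (lorentz a a • ![0, 0, 1] - lorentz ![0, 0, 1] a • a)
        (lorentz a a • ![0, 0, 1] - lorentz ![0, 0, 1] a • a) =
        -(lorentz a a * lorentz a a) - lorentz a a * (lorentz ![0, 0, 1] a) ^ 2 := by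
      have e1 : lorentz (![0, 0, 1] : L3) ![0, 0, 1] = -1 := by simp [lorentz]
      simp only [lorentz_sub_left, lorentz_sub_right, lorentz_smul_left, lorentz_smul_right, e1,
        lorentz_comm a ![0, 0, 1]]
      ring
    rw [e]
    have := mul_pos ha ha
    have := mul_nonneg ha.le (sq_nonneg (lorentz ![0, 0, 1] a))
    linarith
  · obtain ⟨w, hw⟩ := h.exists_preimage (y := ![-a 1, a 0, 0]) (by simp [lorentz]; ring)
    refine ⟨w, ?_⟩
    rw [hw]
    simp only [lorentz] at *
    simp
    nlinarith [sq_nonneg (a 2)]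

theorem lightlike_iff (h : IsNormalAt X z a) : LightlikeAt X z ↔ lorentz a a = 0 := by
  refine ⟨fun hl => ?_, h.lightlike_of⟩
  by_contra hne
  rcases lt_or_gt_of_ne hne with hlt | hgt
  · exact (h.spacelike_of hlt).not_lightlikeAt hl
  · exact (h.timelike_of hgt).1 hl

theorem spacelike_iff (h : IsNormalAt X z a) : SpacelikeAt X z ↔ lorentz a a < 0 := by
  refine ⟨fun hs => ?_, h.spacelike_of⟩
  rcases lt_trichotomy (lorentz a a) 0 with hlt | heq | hgt
  · exact hlt
  · exact absurd (h.lightlike_of heq) hs.not_lightlikeAt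
  · exact absurd (h.timelike_of hgt) hs.not_timelikeAt

theorem timelike_iff (h : IsNormalAt X z a) : TimelikeAt X z ↔ 0 < lorentz a a := by
  refine ⟨fun hs => ?_, h.timelike_of⟩
  rcases lt_trichotomy (lorentz a a) 0 with hlt | heq | hgt
  · exact absurd hs (h.spacelike_of hlt).not_timelikeAt
  · exact absurd (h.lightlike_of heq) hs.1
  · exact hgt

end IsNormalAt

/-- At a lightlike point the kernel of the induced metric is spanned by a null vector which is
normal to the surface. -/
theorem LightlikeAt.exists_normal {X : S → L3} {z : S} (hinj : Function.Injective (dX X z))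
    (h : LightlikeAt X z) : ∃ n, lorentz n n = 0 ∧ IsNormalAt X z n := by
  obtain ⟨v, hv, hw⟩ := lightlikeAt_iff.1 h
  refine ⟨dX X z v, hw v, hinj, ?_, fun w => ?_⟩
  · intro h0
    exact hv (hinj (by rw [h0, map_zero]))
  · rw [lorentz_comm, hw]

/-! ### Surfaces in local coordinates -/

/-- The surface `X` in the preferred chart around `z`. -/
def localRep (X : S → L3) (z : S) : E2 → L3 := X ∘ (extChartAt (𝓡 2) z).symm

/-- The coordinates of `z` in the preferred chart around `z`. -/
def localPt (z : S) : E2 := extChartAt (𝓡 2) z z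

theorem localRep_localPt (X : S → L3) (z : S) : localRep X z (localPt z) = X z := by
  simp [localRep, localPt]

theorem tendsto_extChartAt_symm (z : S) :
    Filter.Tendsto (extChartAt (𝓡 2) z).symm (nhds (localPt z)) (nhds z) := by
  have := (continuousAt_extChartAt_symm (I := 𝓡 2) z).tendsto
  rwa [extChartAt_to_inv] at this

theorem map_extChartAt_symm_nhds (z : S) :
    Filter.map (extChartAt (𝓡 2) z).symm (nhds (localPt z)) = nhds z := by
  have := map_extChartAt_symm_nhdsWithin_range (I := 𝓡 2) z
  simpa [localPt] using this

theorem dX_eq_fderiv {X : S → L3} {z : S} (h : MDifferentiableAt (𝓡 2) 𝓘(ℝ, L3) X z) :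
    dX X z = fderiv ℝ (localRep X z) (localPt z) := by
  have h1 : dX X z = fderivWithin ℝ (localRep X z) (Set.range (𝓡 2)) (localPt z) := h.mfderiv
  rw [h1]
  simp

theorem contDiffAt_localRep [IsManifold (𝓡 2) ∞ S] {X : S → L3}
    (h : ContMDiff (𝓡 2) 𝓘(ℝ, L3) ∞ X) (z : S) :
    ContDiffAt ℝ ∞ (localRep X z) (localPt z) := by
  have h1 : ContMDiffOn 𝓘(ℝ, E2) 𝓘(ℝ, L3) ∞ (localRep X z) (extChartAt (𝓡 2) z).target :=
    h.comp_contMDiffOn (contMDiffOn_extChartAt_symm z)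
  have h2 := contMDiffOn_iff_contDiffOn.1 h1
  exact h2.contDiffAt (extChartAt_target_mem_nhds z)

end

/-! ### Partial derivatives of functions of two real variables -/

section

/-- Partial derivative with respect to the first variable. -/
def D1 (f : ℝ × ℝ → ℝ) (y : ℝ × ℝ) : ℝ := fderiv ℝ f y (1, 0)

/-- Partial derivative with respect to the second variable. -/
def D2 (f : ℝ × ℝ → ℝ) (y : ℝ × ℝ) : ℝ := fderiv ℝ f y (0, 1)

section Partial

variable {f : ℝ × ℝ → ℝ} {y : ℝ × ℝ}

theorem contDiffAt_D1 (h : ContDiffAt ℝ ∞ f y) : ContDiffAt ℝ ∞ (D1 f) y :=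
  (h.fderiv_right (m := ∞) (by simp)).clm_apply contDiffAt_const

theorem contDiffAt_D2 (h : ContDiffAt ℝ ∞ f y) : ContDiffAt ℝ ∞ (D2 f) y :=
  (h.fderiv_right (m := ∞) (by simp)).clm_apply contDiffAt_const

theorem fderiv_apply_eq (f : ℝ × ℝ → ℝ) (y w : ℝ × ℝ) :
    fderiv ℝ f y w = D1 f y * w.1 + D2 f y * w.2 := by
  have : w = w.1 • ((1, 0) : ℝ × ℝ) + w.2 • ((0, 1) : ℝ × ℝ) := by ext <;> simp
  conv_lhs => rw [this, map_add, map_smul, map_smul]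
  simp only [D1, D2, smul_eq_mul]; ring

theorem D1_D2_comm (h : ContDiffAt ℝ ∞ f y) :
    D1 (D2 f) y = D2 (D1 f) y := by
  have hs : IsSymmSndFDerivAt ℝ f y := h.isSymmSndFDerivAt (by
    rw [minSmoothness_of_isRCLikeNormedField]
    exact WithTop.coe_le_coe.2 (le_top (a := (2 : ℕ∞))))
  have hd : DifferentiableAt ℝ (fderiv ℝ f) y :=
    (h.fderiv_right (m := ∞) (by simp)).differentiableAt (by simp)
  have e1 : D1 (D2 f) y
      = fderiv ℝ (fderiv ℝ f) y (1, 0) (0, 1) := by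
    unfold D1 D2
    rw [fderiv_clm_apply hd (by fun_prop)]; simp
  have e2 : D2 (D1 f) y
      = fderiv ℝ (fderiv ℝ f) y (0, 1) (1, 0) := by
    unfold D1 D2
    rw [fderiv_clm_apply hd (by fun_prop)]; simp
  rw [e1, e2]
  exact hs _ _

theorem hasDerivAt_comp_pair {a b : ℝ → ℝ} {a' b' t : ℝ}
    (h : ContDiffAt ℝ ∞ f (a t, b t)) (ha : HasDerivAt a a' t) (hb : HasDerivAt b b' t) :
    HasDerivAt (fun s => f (a s, b s)) (D1 f (a t, b t) * a' +
      D2 f (a t, b t) * b') t := by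
  have h1 : HasFDerivAt f (fderiv ℝ f (a t, b t)) (a t, b t) :=
    (h.differentiableAt (by simp)).hasFDerivAt
  have h2 := HasFDerivAt.comp_hasDerivAt t h1 (ha.prodMk hb)
  rw [fderiv_apply_eq] at h2
  exact h2

theorem hasDerivAt_D1 {x u : ℝ} (h : ContDiffAt ℝ ∞ f (x, u)) :
    HasDerivAt (fun s => f (s, u)) (D1 f (x, u)) x := by
  simpa using hasDerivAt_comp_pair (a := fun s => s) (b := fun _ => u) h (hasDerivAt_id x)
    (hasDerivAt_const x u)

theorem hasDerivAt_D2 {x u : ℝ} (h : ContDiffAt ℝ ∞ f (x, u)) :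
    HasDerivAt (fun s => f (x, s)) (D2 f (x, u)) u := by
  simpa using hasDerivAt_comp_pair (a := fun _ => x) (b := fun s => s) h (hasDerivAt_const u x)
    (hasDerivAt_id u)

end Partial

/-! ### The surface as a graph near a point whose tangent plane is null -/

/-- The coordinate `x` of a point with respect to a null frame based at `c`. -/
def coordX (v c P : L3) : ℝ := lorentz (P - c) v

/-- The null coordinate `q` of a point with respect to a null frame based at `c`. -/
def coordQ (n c P : L3) : ℝ := 2 * lorentz (P - c) n

/-- The coordinate `u = p + e q` of a point with respect to a null frame based at `c`. -/
def coordU (n m : L3) (e : ℝ) (c P : L3) : ℝ :=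
  2 * lorentz (P - c) m + e * (2 * lorentz (P - c) n)

theorem contDiff_coordX (v c : L3) : ContDiff ℝ ∞ (coordX v c) :=
  (pairing v).contDiff.comp (contDiff_id.sub contDiff_const)

theorem contDiff_coordQ (n c : L3) : ContDiff ℝ ∞ (coordQ n c) :=
  contDiff_const.mul ((pairing n).contDiff.comp (contDiff_id.sub contDiff_const))

theorem contDiff_coordU (n m : L3) (e : ℝ) (c : L3) : ContDiff ℝ ∞ (coordU n m e c) :=
  (contDiff_const.mul ((pairing m).contDiff.comp (contDiff_id.sub contDiff_const))).add
    (contDiff_const.mul (contDiff_coordQ n c))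

theorem hasFDerivAt_coordX (v c P : L3) : HasFDerivAt (coordX v c) (pairing v) P := by
  have := (pairing v).hasFDerivAt.comp P ((hasFDerivAt_id (𝕜 := ℝ) P).sub_const c)
  simpa using! this

theorem hasFDerivAt_coordQ (n c P : L3) : HasFDerivAt (coordQ n c) ((2 : ℝ) • pairing n) P := by
  have := ((pairing n).hasFDerivAt.comp P ((hasFDerivAt_id (𝕜 := ℝ) P).sub_const c)).const_mul 2
  simpa using! this

theorem hasFDerivAt_coordU (n m : L3) (e : ℝ) (c P : L3) :
    HasFDerivAt (coordU n m e c) ((2 : ℝ) • pairing m + e • ((2 : ℝ) • pairing n)) P := by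
  have := ((pairing m).hasFDerivAt.comp P ((hasFDerivAt_id (𝕜 := ℝ) P).sub_const c)).const_mul 2
  have h2 := this.add ((hasFDerivAt_coordQ n c P).const_mul e)
  simpa using! h2

variable {S : Type*} [TopologicalSpace S] [ChartedSpace E2 S]

/-- `X` is, on the open set `Ω`, the graph `q = ψ(x, u)` over the square of radius `r`. -/
structure IsGraphOn (X : S → L3) (v n m c : L3) (e : ℝ) (Ω : Set S) (r : ℝ) (ψ : ℝ × ℝ → ℝ) :
    Prop where
  isOpen : IsOpen Ω
  pos : 0 < r
  smooth : ∀ y ∈ Metric.ball (0 : ℝ × ℝ) r, ContDiffAt ℝ ∞ ψ y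
  mem_ball : ∀ z ∈ Ω, (coordX v c (X z), coordU n m e c (X z)) ∈ Metric.ball (0 : ℝ × ℝ) r
  eq : ∀ z ∈ Ω, coordQ n c (X z) = ψ (coordX v c (X z), coordU n m e c (X z))
  surj : ∀ y ∈ Metric.ball (0 : ℝ × ℝ) r,
    ∃ z ∈ Ω, (coordX v c (X z), coordU n m e c (X z)) = y

/-- A surface is a graph near every point at which `x` and `u` restrict to coordinates of the
tangent plane. -/
theorem exists_isGraphOn_of_injective [IsManifold (𝓡 2) ∞ S] {X : S → L3}
    (hX : ContMDiff (𝓡 2) 𝓘(ℝ, L3) ∞ X) {z : S} {v n m : L3} {e : ℝ}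
    (hinj : ∀ w, lorentz (dX X z w) v = 0 →
      2 * lorentz (dX X z w) m + e * (2 * lorentz (dX X z w) n) = 0 → w = 0) :
    ∃ Ω r ψ, z ∈ Ω ∧ IsGraphOn X v n m (X z) e Ω r ψ := by
  set Y := localRep X z with hY
  set ζ := localPt z with hζ
  have hYζ : Y ζ = X z := localRep_localPt X z
  have hYs : ∀ ξ ∈ (extChartAt (𝓡 2) z).target, ContDiffAt ℝ ∞ Y ξ := fun ξ hξ => by
    have h1 : ContMDiffOn 𝓘(ℝ, E2) 𝓘(ℝ, L3) ∞ Y (extChartAt (𝓡 2) z).target :=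
      hX.comp_contMDiffOn (contMDiffOn_extChartAt_symm z)
    exact (contMDiffOn_iff_contDiffOn.1 h1).contDiffAt ((isOpen_extChartAt_target z).mem_nhds hξ)
  have hζt : ζ ∈ (extChartAt (𝓡 2) z).target := mem_extChartAt_target z
  set τ : E2 → ℝ × ℝ := fun ξ => (coordX v (X z) (Y ξ), coordU n m e (X z) (Y ξ)) with hτ
  have hτs : ∀ ξ ∈ (extChartAt (𝓡 2) z).target, ContDiffAt ℝ ∞ τ ξ := fun ξ hξ =>
    ((contDiff_coordX v (X z)).contDiffAt.comp ξ (hYs ξ hξ)).prodMk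
      ((contDiff_coordU n m e (X z)).contDiffAt.comp ξ (hYs ξ hξ))
  have hYd : HasFDerivAt Y (dX X z) ζ := by
    rw [dX_eq_fderiv (hX.mdifferentiable (by simp) z)]
    exact ((hYs ζ hζt).differentiableAt (by simp)).hasFDerivAt
  set L : L3 →L[ℝ] ℝ × ℝ :=
    (pairing v).prod ((2 : ℝ) • pairing m + e • ((2 : ℝ) • pairing n)) with hL
  have hτd : HasFDerivAt τ (L.comp (dX X z)) ζ := by
    have h1 := ((hasFDerivAt_coordX v (X z) (Y ζ)).comp ζ hYd).prodMk
      ((hasFDerivAt_coordU n m e (X z) (Y ζ)).comp ζ hYd)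
    exact h1
  have hLinj : Function.Injective (L.comp (dX X z)) := by
    rw [injective_iff_map_eq_zero]
    intro w hw
    exact hinj w (congrArg Prod.fst hw) (congrArg Prod.snd hw)
  set τ' : E2 ≃L[ℝ] ℝ × ℝ := (LinearMap.linearEquivOfInjective
    ((L.comp (dX X z) : E2 →L[ℝ] ℝ × ℝ) : E2 →ₗ[ℝ] ℝ × ℝ) hLinj (by simp)).toContinuousLinearEquiv
    with hτ'
  have hτ'e : (τ' : E2 →L[ℝ] ℝ × ℝ) = L.comp (dX X z) := by
    ext w <;> simp [hτ']
  have hτd' : HasFDerivAt τ (τ' : E2 →L[ℝ] ℝ × ℝ) ζ := by rw [hτ'e]; exact hτd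
  set h := (hτs ζ hζt).toOpenPartialHomeomorph τ hτd' (by simp) with hh
  have hcoe : (h : E2 → ℝ × ℝ) = τ := ContDiffAt.toOpenPartialHomeomorph_coe _ _ _
  have hsrc : ζ ∈ h.source := ContDiffAt.mem_toOpenPartialHomeomorph_source _ _ _
  have hτ0 : τ ζ = 0 := by
    simp only [hτ, hYζ, coordX, coordU, sub_self, lorentz_zero_left]
    ext <;> simp
  have h0t : (0 : ℝ × ℝ) ∈ h.target := by
    rw [← hτ0, ← hcoe]; exact h.map_source hsrc
  have hs0 : h.symm 0 = ζ := by
    rw [← hτ0, ← hcoe]; exact h.left_inv hsrc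
  -- the inverse stays in the chart, where the differential of `τ` is invertible
  have hgood : ∀ᶠ ξ in nhds ζ, ξ ∈ (extChartAt (𝓡 2) z).target ∧
      fderiv ℝ τ ξ ∈ Set.range ((↑) : (E2 ≃L[ℝ] ℝ × ℝ) → E2 →L[ℝ] ℝ × ℝ) := by
    refine Filter.Eventually.and ((isOpen_extChartAt_target z).mem_nhds hζt) ?_
    have hc : ContinuousAt (fderiv ℝ τ) ζ :=
      ((hτs ζ hζt).fderiv_right (m := ∞) (by simp)).continuousAt
    apply hc
    apply IsOpen.mem_nhds ContinuousLinearEquiv.isOpen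
    exact ⟨τ', by rw [hτd'.fderiv]⟩
  have hev : ∀ᶠ y in nhds (0 : ℝ × ℝ), y ∈ h.target ∧ h.symm y ∈ (extChartAt (𝓡 2) z).target ∧
      fderiv ℝ τ (h.symm y) ∈ Set.range ((↑) : (E2 ≃L[ℝ] ℝ × ℝ) → E2 →L[ℝ] ℝ × ℝ) := by
    refine Filter.Eventually.and (h.open_target.mem_nhds h0t) ?_
    have hc : ContinuousAt h.symm (0 : ℝ × ℝ) := h.continuousAt_symm h0t
    have := hc.tendsto
    rw [hs0] at this
    exact this.eventually hgood
  obtain ⟨r, hr, hball⟩ := Metric.eventually_nhds_iff_ball.1 hev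
  refine ⟨(extChartAt (𝓡 2) z).source ∩
    (extChartAt (𝓡 2) z) ⁻¹' (h.source ∩ h ⁻¹' Metric.ball 0 r), r,
    fun y => coordQ n (X z) (Y (h.symm y)), ?_, ?_⟩
  · refine ⟨mem_extChartAt_source z, hsrc, ?_⟩
    change h ζ ∈ Metric.ball 0 r
    rw [hcoe, hτ0]
    exact Metric.mem_ball_self hr
  · have hXY : ∀ z' ∈ (extChartAt (𝓡 2) z).source, X z' = Y (extChartAt (𝓡 2) z z') := by
      intro z' hz'
      simp only [hY, localRep, Function.comp_apply]
      rw [(extChartAt (𝓡 2) z).left_inv hz']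
    constructor
    · exact isOpen_extChartAt_preimage' z (h.isOpen_inter_preimage Metric.isOpen_ball)
    · exact hr
    · intro y hy
      obtain ⟨hy1, hy2, τ'', hy3⟩ := hball y hy
      have h1 : ContDiffAt ℝ ∞ h.symm y := by
        refine h.contDiffAt_symm hy1 (f₀' := τ'') ?_ ?_
        · rw [hcoe, hy3]
          exact ((hτs _ hy2).differentiableAt (by simp)).hasFDerivAt
        · rw [hcoe]; exact hτs _ hy2
      exact (contDiff_coordQ n (X z)).contDiffAt.comp y ((hYs _ hy2).comp y h1)
    · rintro z' ⟨hz1, hz2, hz3⟩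
      rw [hXY z' hz1]
      rw [hcoe] at hz3
      exact hz3
    · rintro z' ⟨hz1, hz2, hz3⟩
      rw [hXY z' hz1]
      change _ = coordQ n (X z) (Y (h.symm (τ (extChartAt (𝓡 2) z z'))))
      rw [← hcoe, h.left_inv hz2]
    · intro y hy
      obtain ⟨hy1, hy2, -⟩ := hball y hy
      have e1 : τ (h.symm y) = y := by rw [← hcoe]; exact h.right_inv hy1
      refine ⟨(extChartAt (𝓡 2) z).symm (h.symm y), ⟨?_, ?_, ?_⟩, ?_⟩
      · exact (extChartAt (𝓡 2) z).map_target hy2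
      · rw [(extChartAt (𝓡 2) z).right_inv hy2]
        exact h.map_target hy1
      · change h (extChartAt (𝓡 2) z ((extChartAt (𝓡 2) z).symm (h.symm y))) ∈ Metric.ball 0 r
        rw [(extChartAt (𝓡 2) z).right_inv hy2, hcoe, e1]
        exact hy
      · exact e1

theorem exists_isGraphOn [IsManifold (𝓡 2) ∞ S] {X : S → L3}
    (hX : ContMDiff (𝓡 2) 𝓘(ℝ, L3) ∞ X) {z : S} (hinj : Function.Injective (dX X z))
    {v n m : L3} (hf : NullFrame v n m) (e : ℝ) (ht : ∀ w, lorentz (dX X z w) n = 0) :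
    ∃ Ω r ψ, z ∈ Ω ∧ IsGraphOn X v n m (X z) e Ω r ψ := by
  refine exists_isGraphOn_of_injective hX fun w h1 h2 => hinj ?_
  rw [ht w] at h2
  rw [map_zero]
  exact hf.eq_zero_of_orthogonal h1 (ht w) (by linarith)

end

/-! ### The zero mean curvature equation of a graph -/

section

variable {S : Type*} [TopologicalSpace S] [ChartedSpace E2 S]

theorem hasStrictFDerivAt_localRep [IsManifold (𝓡 2) ∞ S] {X : S → L3}
    (hX : ContMDiff (𝓡 2) 𝓘(ℝ, L3) ∞ X) (z : S) :
    HasStrictFDerivAt (localRep X z) (dX X z) (localPt z) := by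
  rw [dX_eq_fderiv (hX.mdifferentiable (by simp) z)]
  exact (contDiffAt_localRep hX z).hasStrictFDerivAt (by simp)

/-- If the restriction of `F` to the surface has a local extremum at `z`, then the differential of
`F` vanishes on the tangent plane. -/
theorem hasFDerivAt_apply_dX_eq_zero_of_isLocalExtr [IsManifold (𝓡 2) ∞ S] {X : S → L3}
    (hX : ContMDiff (𝓡 2) 𝓘(ℝ, L3) ∞ X) {z : S} {F : L3 → ℝ} {F' : L3 →L[ℝ] ℝ}
    (hF : HasFDerivAt F F' (X z)) (h : IsLocalExtr (fun z' => F (X z')) z) (w : E2) :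
    F' (dX X z w) = 0 := by
  rw [← localRep_localPt X z] at hF
  have h1 := hF.comp (localPt z) (hasStrictFDerivAt_localRep hX z).hasFDerivAt
  have h2 : IsLocalExtr (F ∘ localRep X z) (localPt z) := by
    refine IsExtrFilter.comp_tendsto (f := fun z' => F (X z')) (g := (extChartAt (𝓡 2) z).symm)
      (l := nhds z) ?_ (tendsto_extChartAt_symm z)
    rw [localPt, extChartAt_to_inv]
    exact h
  exact congrArg (fun f : E2 →L[ℝ] ℝ => f w) (h2.hasFDerivAt_eq_zero h1)

/-- If `F` vanishes on the surface near `z`, then its differential vanishes on the tangent plane. -/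
theorem hasFDerivAt_apply_dX_eq_zero [IsManifold (𝓡 2) ∞ S] {X : S → L3}
    (hX : ContMDiff (𝓡 2) 𝓘(ℝ, L3) ∞ X) {z : S} {F : L3 → ℝ} {F' : L3 →L[ℝ] ℝ}
    (hF : HasFDerivAt F F' (X z)) (h : ∀ᶠ z' in nhds z, F (X z') = 0) (w : E2) :
    F' (dX X z w) = 0 := by
  refine hasFDerivAt_apply_dX_eq_zero_of_isLocalExtr hX hF (Or.inl ?_) w
  filter_upwards [h] with z' hz'
  rw [hz', h.self_of_nhds]

/-- A linear map which is onto on the tangent plane at `z` is open at `z` on the surface. -/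
theorem map_comp_nhds [IsManifold (𝓡 2) ∞ S] {X : S → L3}
    (hX : ContMDiff (𝓡 2) 𝓘(ℝ, L3) ∞ X) {E : Type*} [NormedAddCommGroup E] [NormedSpace ℝ E]
    [CompleteSpace E] (L : L3 →L[ℝ] E) {z : S} (hL : Function.Surjective fun w => L (dX X z w)) :
    Filter.map (fun z' => L (X z')) (nhds z) = nhds (L (X z)) := by
  have h1 := L.hasStrictFDerivAt.comp (localPt z) (hasStrictFDerivAt_localRep hX z)
  have h2 := h1.map_nhds_eq_of_surj (LinearMap.range_eq_top.2 hL)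
  rw [← map_extChartAt_symm_nhds z, Filter.map_map]
  simp only [localRep_localPt] at h2
  exact h2

/-- The determinant of the induced metric of a graph `q = ψ(x, u)` in the coordinates `(x, u)`. -/
def graphDet (e : ℝ) (ψ : ℝ × ℝ → ℝ) (y : ℝ × ℝ) : ℝ :=
  D2 ψ y - e * D2 ψ y ^ 2 - D1 ψ y ^ 2 / 4

/-- The left hand side of the zero mean curvature equation of a graph `q = ψ(x, u)`. -/
def graphZMC (e : ℝ) (ψ : ℝ × ℝ → ℝ) (y : ℝ × ℝ) : ℝ :=
  (1 - e * D1 ψ y ^ 2) * D2 (D2 ψ) y - D1 ψ y * (1 - 2 * e * D2 ψ y) * D2 (D1 ψ) y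
    + D2 ψ y * (1 - e * D2 ψ y) * D1 (D1 ψ) y

/-- The normal vector of the graph `q = ψ(x, u)`. -/
def graphNormal (v n m : L3) (e : ℝ) (ψ : ℝ × ℝ → ℝ) (y : ℝ × ℝ) : L3 :=
  D1 ψ y • v + (2 * D2 ψ y) • m + (2 * e * D2 ψ y - 2) • n

theorem graphNormal_self {v n m : L3} (hf : NullFrame v n m) (e : ℝ) (ψ : ℝ × ℝ → ℝ) (y : ℝ × ℝ) :
    lorentz (graphNormal v n m e ψ y) (graphNormal v n m e ψ y) = -4 * graphDet e ψ y := by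
  simp only [graphNormal, graphDet, lorentz_add_left, lorentz_add_right, lorentz_smul_left,
    lorentz_smul_right, hf.vv, hf.nn, hf.mm, hf.vn, hf.vm, hf.nm, hf.nv, hf.mv, hf.mn]
  ring

namespace IsGraphOn

variable {X : S → L3} {v n m c : L3} {e r : ℝ} {Ω : Set S} {ψ : ℝ × ℝ → ℝ}

/-- The point of the parameter square over which `X z` lies. -/
abbrev _root_.LorentzMinkowski.base (X : S → L3) (v n m c : L3) (e : ℝ) (z : S) : ℝ × ℝ :=
  (coordX v c (X z), coordU n m e c (X z))

theorem isNormalAt [IsManifold (𝓡 2) ∞ S] (h : IsGraphOn X v n m c e Ω r ψ)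
    (hf : NullFrame v n m) (hX : ContMDiff (𝓡 2) 𝓘(ℝ, L3) ∞ X) {z : S}
    (hinj : Function.Injective (dX X z)) (hz : z ∈ Ω) :
    IsNormalAt X z (graphNormal v n m e ψ (base X v n m c e z)) := by
  refine ⟨hinj, ?_, fun w => ?_⟩
  · intro h0
    have h1 : lorentz (graphNormal v n m e ψ (base X v n m c e z)) n = 0 := by
      rw [h0, lorentz_zero_left]
    have h2 : lorentz (graphNormal v n m e ψ (base X v n m c e z)) m = 0 := by
      rw [h0, lorentz_zero_left]
    simp only [graphNormal, lorentz_add_left, lorentz_smul_left, hf.nn, hf.mm, hf.vn, hf.vm,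
      hf.nm, hf.mn] at h1 h2
    have h3 : D2 ψ (base X v n m c e z) = 0 := by linarith
    rw [h3] at h2
    linarith
  · have hψ := (h.smooth _ (h.mem_ball z hz)).differentiableAt (by simp)
    have hF := (hψ.hasFDerivAt.comp (X z) ((hasFDerivAt_coordX v c (X z)).prodMk
      (hasFDerivAt_coordU n m e c (X z)))).sub (hasFDerivAt_coordQ n c (X z))
    have h0 := hasFDerivAt_apply_dX_eq_zero hX hF (by
      filter_upwards [h.isOpen.mem_nhds hz] with z' hz'
      have := h.eq z' hz'
      simp only [Pi.sub_apply, Function.comp_apply]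
      rw [this, sub_self]) w
    simp only [sub_apply, ContinuousLinearMap.comp_apply,
      ContinuousLinearMap.prod_apply, fderiv_apply_eq, add_apply,
      smul_apply, pairing_apply, smul_eq_mul] at h0
    simp only [graphNormal, lorentz_add_right, lorentz_smul_right]
    linarith

theorem spacelikeAt_iff [IsManifold (𝓡 2) ∞ S] (h : IsGraphOn X v n m c e Ω r ψ)
    (hf : NullFrame v n m) (hX : ContMDiff (𝓡 2) 𝓘(ℝ, L3) ∞ X) {z : S}
    (hinj : Function.Injective (dX X z)) (hz : z ∈ Ω) :
    SpacelikeAt X z ↔ 0 < graphDet e ψ (base X v n m c e z) := by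
  rw [(h.isNormalAt hf hX hinj hz).spacelike_iff, graphNormal_self hf]
  constructor <;> intro h' <;> linarith

theorem timelikeAt_iff [IsManifold (𝓡 2) ∞ S] (h : IsGraphOn X v n m c e Ω r ψ)
    (hf : NullFrame v n m) (hX : ContMDiff (𝓡 2) 𝓘(ℝ, L3) ∞ X) {z : S}
    (hinj : Function.Injective (dX X z)) (hz : z ∈ Ω) :
    TimelikeAt X z ↔ graphDet e ψ (base X v n m c e z) < 0 := by
  rw [(h.isNormalAt hf hX hinj hz).timelike_iff, graphNormal_self hf]
  constructor <;> intro h' <;> linarith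

end IsGraphOn

/-- Partial derivatives of a real function on the coordinate plane. -/
def pd (i : Fin 2) (f : E2 → ℝ) (ξ : E2) : ℝ := fderiv ℝ f ξ (EuclideanSpace.single i 1)

theorem pd_comp {g : ℝ × ℝ → ℝ} {a b : E2 → ℝ} {ξ : E2} (hg : ContDiffAt ℝ ∞ g (a ξ, b ξ))
    (ha : DifferentiableAt ℝ a ξ) (hb : DifferentiableAt ℝ b ξ) (i : Fin 2) :
    pd i (fun ξ => g (a ξ, b ξ)) ξ = D1 g (a ξ, b ξ) * pd i a ξ + D2 g (a ξ, b ξ) * pd i b ξ := by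
  have h1 := HasFDerivAt.comp ξ (g := g) (f := fun ξ => (a ξ, b ξ))
    (hg.differentiableAt (by simp)).hasFDerivAt (ha.hasFDerivAt.prodMk hb.hasFDerivAt)
  have h2 : fderiv ℝ (fun ξ => g (a ξ, b ξ)) ξ = _ := h1.fderiv
  unfold pd
  rw [h2, ContinuousLinearMap.comp_apply, fderiv_apply_eq]
  rfl

theorem pd_mul {a b : E2 → ℝ} {ξ : E2} (ha : DifferentiableAt ℝ a ξ) (hb : DifferentiableAt ℝ b ξ)
    (i : Fin 2) : pd i (fun ξ => a ξ * b ξ) ξ = a ξ * pd i b ξ + b ξ * pd i a ξ := by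
  unfold pd
  rw [fderiv_fun_mul ha hb]
  simp

theorem pd_add {a b : E2 → ℝ} {ξ : E2} (ha : DifferentiableAt ℝ a ξ) (hb : DifferentiableAt ℝ b ξ)
    (i : Fin 2) : pd i (fun ξ => a ξ + b ξ) ξ = pd i a ξ + pd i b ξ := by
  unfold pd
  rw [fderiv_fun_add ha hb]
  simp

theorem contDiffAt_pd {a : E2 → ℝ} {ξ : E2} (ha : ContDiffAt ℝ ∞ a ξ) (i : Fin 2) :
    ContDiffAt ℝ ∞ (pd i a) ξ :=
  (ha.fderiv_right (m := ∞) (by simp)).clm_apply contDiffAt_const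

theorem pd_congr {a b : E2 → ℝ} {ξ : E2} (h : a =ᶠ[nhds ξ] b) (i : Fin 2) :
    pd i a ξ = pd i b ξ := by
  unfold pd; rw [h.fderiv_eq]

/-- Second derivatives of a composite function. -/
theorem pd_pd_comp {g : ℝ × ℝ → ℝ} {a b : E2 → ℝ} {ξ : E2}
    (hg : ∀ᶠ y in nhds (a ξ, b ξ), ContDiffAt ℝ ∞ g y)
    (ha : ContDiffAt ℝ ∞ a ξ) (hb : ContDiffAt ℝ ∞ b ξ) (i j : Fin 2) :
    pd i (pd j fun ξ => g (a ξ, b ξ)) ξ =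
      D1 (D1 g) (a ξ, b ξ) * pd i a ξ * pd j a ξ
      + D2 (D1 g) (a ξ, b ξ) * (pd i a ξ * pd j b ξ + pd i b ξ * pd j a ξ)
      + D2 (D2 g) (a ξ, b ξ) * pd i b ξ * pd j b ξ
      + D1 g (a ξ, b ξ) * pd i (pd j a) ξ + D2 g (a ξ, b ξ) * pd i (pd j b) ξ := by
  have hgξ := hg.self_of_nhds
  have hda := ha.differentiableAt (by simp)
  have hdb := hb.differentiableAt (by simp)
  have hae : ∀ᶠ ξ' in nhds ξ, DifferentiableAt ℝ a ξ' :=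
    ((ha.of_le (m := 1) (by simp)).eventually (by simp)).mono fun ξ' h =>
      h.differentiableAt (by simp)
  have hbe : ∀ᶠ ξ' in nhds ξ, DifferentiableAt ℝ b ξ' :=
    ((hb.of_le (m := 1) (by simp)).eventually (by simp)).mono fun ξ' h =>
      h.differentiableAt (by simp)
  have hge : ∀ᶠ ξ' in nhds ξ, ContDiffAt ℝ ∞ g (a ξ', b ξ') :=
    (hda.continuousAt.prodMk hdb.continuousAt).eventually hg
  have h1 : (pd j fun ξ => g (a ξ, b ξ)) =ᶠ[nhds ξ] fun ξ' =>
      D1 g (a ξ', b ξ') * pd j a ξ' + D2 g (a ξ', b ξ') * pd j b ξ' := by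
    filter_upwards [hae, hbe, hge] with ξ' h1 h2 h3
    exact pd_comp h3 h1 h2 j
  have d1 : DifferentiableAt ℝ (fun ξ' => D1 g (a ξ', b ξ')) ξ :=
    DifferentiableAt.comp (g := D1 g) (f := fun ξ' => (a ξ', b ξ')) ξ
      ((contDiffAt_D1 hgξ).differentiableAt (by simp)) (hda.prodMk hdb)
  have d2 : DifferentiableAt ℝ (fun ξ' => D2 g (a ξ', b ξ')) ξ :=
    DifferentiableAt.comp (g := D2 g) (f := fun ξ' => (a ξ', b ξ')) ξ
      ((contDiffAt_D2 hgξ).differentiableAt (by simp)) (hda.prodMk hdb)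
  have d3 : DifferentiableAt ℝ (pd j a) ξ := (contDiffAt_pd ha j).differentiableAt (by simp)
  have d4 : DifferentiableAt ℝ (pd j b) ξ := (contDiffAt_pd hb j).differentiableAt (by simp)
  rw [pd_congr h1 i, pd_add (d1.fun_mul d3) (d2.fun_mul d4), pd_mul d1 d3, pd_mul d2 d4,
    pd_comp (contDiffAt_D1 hgξ) hda hdb, pd_comp (contDiffAt_D2 hgξ) hda hdb, D1_D2_comm hgξ]
  ring

theorem lorentz_partialD {Y : E2 → L3} {ξ : E2} (hY : DifferentiableAt ℝ Y ξ) (a c : L3)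
    (i : Fin 2) : lorentz (partialD i Y ξ) a = pd i (fun ξ => lorentz (Y ξ - c) a) ξ := by
  have h1 := (pairing a).hasFDerivAt.comp ξ (hY.hasFDerivAt.sub_const c)
  have h2 : fderiv ℝ (fun ξ => lorentz (Y ξ - c) a) ξ = _ := h1.fderiv
  unfold pd partialD
  rw [h2]; rfl

theorem lorentz_partialD_partialD {Y : E2 → L3} {ξ : E2} (hY : ContDiffAt ℝ ∞ Y ξ) (a c : L3)
    (i j : Fin 2) : lorentz (partialD i (partialD j Y) ξ) a =
      pd i (pd j fun ξ => lorentz (Y ξ - c) a) ξ := by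
  have h1 : DifferentiableAt ℝ (partialD j Y) ξ :=
    ((hY.fderiv_right (m := ∞) (by simp)).clm_apply contDiffAt_const).differentiableAt (by simp)
  rw [lorentz_partialD h1 a 0 i]
  apply pd_congr
  have hYe : ∀ᶠ ξ' in nhds ξ, DifferentiableAt ℝ Y ξ' :=
    ((hY.of_le (m := 1) (by simp)).eventually (by simp)).mono fun ξ' h =>
      h.differentiableAt (by simp)
  filter_upwards [hYe] with ξ' h
  rw [sub_zero, lorentz_partialD h a c]

/-- Where the induced metric is non-degenerate, vanishing of the mean curvature is vanishing of the
trace of the second fundamental form with respect to a normal vector of any length. -/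
theorem trace_eq_zero_of_meanCurvature {Y : E2 → L3} {ξ : E2} (hd : metricDet Y ξ ≠ 0)
    (h : meanCurvature Y ξ = 0) :
    firstForm Y 0 0 ξ *
        lorentz (partialD 1 (partialD 1 Y) ξ) (lorentzCross (partialD 0 Y ξ) (partialD 1 Y ξ))
      - 2 * firstForm Y 0 1 ξ *
        lorentz (partialD 0 (partialD 1 Y) ξ) (lorentzCross (partialD 0 Y ξ) (partialD 1 Y ξ))
      + firstForm Y 1 1 ξ *
        lorentz (partialD 0 (partialD 0 Y) ξ) (lorentzCross (partialD 0 Y ξ) (partialD 1 Y ξ))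
      = 0 := by
  have hs : causalSign Y ξ ≠ 0 := by
    unfold causalSign
    rcases lt_or_gt_of_ne hd with h1 | h1
    · rw [sign_neg h1]; simp
    · rw [sign_pos h1]; simp
  have hpos : 0 < causalSign Y ξ * metricDet Y ξ := by
    unfold causalSign
    rcases lt_or_gt_of_ne hd with h1 | h1
    · rw [sign_neg h1]; simp [h1]
    · rw [sign_pos h1]; simp [h1]
  have hsq : (Real.sqrt (causalSign Y ξ * metricDet Y ξ))⁻¹ ≠ 0 :=
    inv_ne_zero (Real.sqrt_pos.2 hpos).ne'
  unfold meanCurvature at h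
  rw [mul_eq_zero, div_eq_zero_iff] at h
  have h1 := (h.resolve_left (by simpa using hs)).resolve_right hd
  simp only [secondForm, unitNormal, lorentz_smul_right] at h1
  apply mul_left_cancel₀ hsq
  linear_combination h1

namespace IsGraphOn

variable {X : S → L3} {v n m c : L3} {e r : ℝ} {Ω : Set S} {ψ : ℝ × ℝ → ℝ}

/-- The zero mean curvature equation at the points where the metric is non-degenerate. -/
theorem graphZMC_eq_zero_of_ne [IsManifold (𝓡 2) ∞ S] (h : IsGraphOn X v n m c e Ω r ψ)
    (hf : NullFrame v n m) (hX : ContMDiff (𝓡 2) 𝓘(ℝ, L3) ∞ X)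
    (hinj : ∀ z, Function.Injective (dX X z)) (hH : HasZeroMeanCurvature X) {z : S} (hz : z ∈ Ω)
    (hd : graphDet e ψ (base X v n m c e z) ≠ 0) :
    graphZMC e ψ (base X v n m c e z) = 0 := by
  set Y := localRep X z with hY
  set ζ := localPt z with hζ
  have hYζ : Y ζ = X z := localRep_localPt X z
  have hYs : ContDiffAt ℝ ∞ Y ζ := contDiffAt_localRep hX z
  have hYd : DifferentiableAt ℝ Y ζ := hYs.differentiableAt (by simp)
  have hmean : meanCurvature Y ζ = 0 := by
    apply hH z
    rcases lt_or_gt_of_ne hd with h1 | h1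
    · exact Or.inr ((h.timelikeAt_iff hf hX (hinj z) hz).2 h1)
    · exact Or.inl ((h.spacelikeAt_iff hf hX (hinj z) hz).2 h1)
  set ax : E2 → ℝ := fun ξ => coordX v c (Y ξ) with hax
  set au : E2 → ℝ := fun ξ => coordU n m e c (Y ξ) with hau
  have haxs : ContDiffAt ℝ ∞ ax ζ := (contDiff_coordX v c).contDiffAt.comp ζ hYs
  have haus : ContDiffAt ℝ ∞ au ζ := (contDiff_coordU n m e c).contDiffAt.comp ζ hYs
  have hbase : (ax ζ, au ζ) = base X v n m c e z := by simp only [hax, hau, hYζ, base]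
  have hball := h.mem_ball z hz
  have hψe : ∀ᶠ y in nhds (ax ζ, au ζ), ContDiffAt ℝ ∞ ψ y := by
    rw [hbase]
    filter_upwards [Metric.isOpen_ball.mem_nhds hball] with y hy using h.smooth y hy
  have hq : (fun ξ => coordQ n c (Y ξ)) =ᶠ[nhds ζ] fun ξ => ψ (ax ξ, au ξ) := by
    have := (tendsto_extChartAt_symm z).eventually (h.isOpen.mem_nhds hz)
    filter_upwards [this] with ξ hξ
    exact h.eq _ hξ
  -- first derivatives of the coordinates
  have fv : ∀ i, lorentz (partialD i Y ζ) v = pd i ax ζ := fun i => lorentz_partialD hYd v c i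
  have hn0 : ContDiffAt ℝ ∞ (fun ξ => lorentz (Y ξ - c) n) ζ :=
    ((pairing n).contDiff.comp (contDiff_id.sub contDiff_const)).contDiffAt.comp ζ hYs
  have hm0 : ContDiffAt ℝ ∞ (fun ξ => lorentz (Y ξ - c) m) ζ :=
    ((pairing m).contDiff.comp (contDiff_id.sub contDiff_const)).contDiffAt.comp ζ hYs
  have pd2 : ∀ (f : E2 → ℝ) (ξ : E2) (i : Fin 2), DifferentiableAt ℝ f ξ →
      pd i (fun ξ => 2 * f ξ) ξ = 2 * pd i f ξ := by
    intro f ξ i hfξ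
    unfold pd
    rw [fderiv_const_mul hfξ]; rfl
  have pde : ∀ (f g : E2 → ℝ) (ξ : E2) (i : Fin 2), DifferentiableAt ℝ f ξ →
      DifferentiableAt ℝ g ξ →
      pd i (fun ξ => 2 * f ξ + e * (2 * g ξ)) ξ = 2 * pd i f ξ + e * (2 * pd i g ξ) := by
    intro f g ξ i hfξ hgξ
    have h1 := (hfξ.hasFDerivAt.const_mul 2).add ((hgξ.hasFDerivAt.const_mul 2).const_mul e)
    have h2 : fderiv ℝ (fun ξ => 2 * f ξ + e * (2 * g ξ)) ξ = _ := h1.fderiv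
    unfold pd
    rw [h2]; rfl
  have ev : ∀ {f : E2 → ℝ}, ContDiffAt ℝ ∞ f ζ → ∀ᶠ ξ in nhds ζ, DifferentiableAt ℝ f ξ :=
    fun hfs => ((hfs.of_le (m := 1) (by simp)).eventually (by simp)).mono fun ξ' h =>
      h.differentiableAt (by simp)
  have fn : ∀ i, 2 * lorentz (partialD i Y ζ) n = pd i (fun ξ => ψ (ax ξ, au ξ)) ζ := by
    intro i
    rw [← pd_congr hq i, lorentz_partialD hYd n c i, ← pd2 _ _ _ (hn0.differentiableAt (by simp))]
    rfl
  have fu : ∀ i, 2 * lorentz (partialD i Y ζ) m + e * (2 * lorentz (partialD i Y ζ) n)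
      = pd i au ζ := by
    intro i
    rw [lorentz_partialD hYd n c i, lorentz_partialD hYd m c i,
      ← pde _ _ _ _ (hm0.differentiableAt (by simp)) (hn0.differentiableAt (by simp))]
    rfl
  -- second derivatives of the coordinates
  have sv : ∀ i j, lorentz (partialD i (partialD j Y) ζ) v = pd i (pd j ax) ζ :=
    fun i j => lorentz_partialD_partialD hYs v c i j
  have sn : ∀ i j, 2 * lorentz (partialD i (partialD j Y) ζ) n =
      pd i (pd j fun ξ => ψ (ax ξ, au ξ)) ζ := by
    intro i j
    have e1 : (pd j fun ξ => ψ (ax ξ, au ξ)) =ᶠ[nhds ζ]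
        fun ξ => 2 * pd j (fun ξ => lorentz (Y ξ - c) n) ξ := by
      filter_upwards [hq.eventuallyEq_nhds, ev hn0] with ξ h1 h2
      rw [← pd_congr h1 j, ← pd2 _ _ _ h2]; rfl
    rw [pd_congr e1 i, pd2 _ _ _ ((contDiffAt_pd hn0 j).differentiableAt (by simp)),
      lorentz_partialD_partialD hYs n c i j]
  have su : ∀ i j, 2 * lorentz (partialD i (partialD j Y) ζ) m +
      e * (2 * lorentz (partialD i (partialD j Y) ζ) n) = pd i (pd j au) ζ := by
    intro i j
    have e1 : (pd j au) =ᶠ[nhds ζ] fun ξ => 2 * pd j (fun ξ => lorentz (Y ξ - c) m) ξ +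
        e * (2 * pd j (fun ξ => lorentz (Y ξ - c) n) ξ) := by
      filter_upwards [ev hm0, ev hn0] with ξ h1 h2
      rw [← pde _ _ _ _ h1 h2]; rfl
    rw [pd_congr e1 i, pde _ _ _ _ ((contDiffAt_pd hm0 j).differentiableAt (by simp))
      ((contDiffAt_pd hn0 j).differentiableAt (by simp)),
      lorentz_partialD_partialD hYs n c i j, lorentz_partialD_partialD hYs m c i j]
  simp only [pd_comp hψe.self_of_nhds (haxs.differentiableAt (by simp))
    (haus.differentiableAt (by simp)), pd_pd_comp hψe haxs haus, hbase] at fn sn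
  set b := base X v n m c e z with hb
  -- the Jacobian of the coordinates `(x, u)` of the surface
  set J := pd 0 ax ζ * pd 1 au ζ - pd 1 ax ζ * pd 0 au ζ with hJ
  have gn : ∀ i, lorentz (partialD i Y ζ) n = (D1 ψ b * pd i ax ζ + D2 ψ b * pd i au ζ) / 2 :=
    fun i => by linarith [fn i]
  have gm : ∀ i, lorentz (partialD i Y ζ) m =
      (pd i au ζ - e * (D1 ψ b * pd i ax ζ + D2 ψ b * pd i au ζ)) / 2 := by
    intro i
    have := fu i
    rw [fn i] at this
    linarith
  have hmd : metricDet Y ζ = J ^ 2 * graphDet e ψ b := by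
    simp only [metricDet, firstForm, hf.lorentz_eq (partialD _ Y ζ) (partialD _ Y ζ), fv, gn, gm,
      graphDet, hJ]
    ring
  have hJ0 : J ≠ 0 := by
    intro hJ0
    -- a linear dependence between the partial derivatives of `X`
    have key : ∀ α β : ℝ, α * pd 0 ax ζ + β * pd 1 ax ζ = 0 → α * pd 0 au ζ + β * pd 1 au ζ = 0 →
        α = 0 ∧ β = 0 := by
      intro α β h1 h2
      have h3 : dX X z (α • EuclideanSpace.single 0 1 + β • EuclideanSpace.single 1 1) = 0 := by
        rw [dX_eq_fderiv (hX.mdifferentiable (by simp) z), map_add, map_smul, map_smul]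
        change α • partialD 0 Y ζ + β • partialD 1 Y ζ = 0
        apply hf.eq_zero_of_orthogonal <;>
        simp only [lorentz_add_left, lorentz_smul_left, fv, gn, gm]
        · exact h1
        · linear_combination D1 ψ b / 2 * h1 + D2 ψ b / 2 * h2
        · linear_combination (1 - e * D2 ψ b) / 2 * h2 - e * D1 ψ b / 2 * h1
      have h4 := (hinj z) (h3.trans (map_zero (dX X z)).symm)
      have h5 := congrArg (fun w : E2 => w 0) h4
      have h6 := congrArg (fun w : E2 => w 1) h4
      simp at h5 h6
      exact ⟨h5, h6⟩
    have k1 := key (pd 1 ax ζ) (-pd 0 ax ζ) (by ring) (by rw [hJ] at hJ0; linarith)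
    have k2 := key (pd 1 au ζ) (-pd 0 au ζ) (by rw [hJ] at hJ0; linarith) (by ring)
    have k3 := key 1 0 (by linarith [k1.2]) (by linarith [k2.2])
    exact one_ne_zero k3.1
  have hmd0 : metricDet Y ζ ≠ 0 := by
    rw [hmd]; exact mul_ne_zero (pow_ne_zero 2 hJ0) hd
  have htr := trace_eq_zero_of_meanCurvature hmd0 hmean
  have hm2 : ∀ i j, lorentz (partialD i (partialD j Y) ζ) m =
      (pd i (pd j au) ζ - e * (2 * lorentz (partialD i (partialD j Y) ζ) n)) / 2 := fun i j => by
    linarith [su i j]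
  have htri : ∀ i j, lorentz (partialD i (partialD j Y) ζ)
      (lorentzCross (partialD 0 Y ζ) (partialD 1 Y ζ)) = _ := fun i j => hf.triple _ _ _
  simp only [firstForm, htri, hf.lorentz_eq (partialD _ Y ζ) (partialD _ Y ζ), fv, gn, gm,
    sv, hm2, sn] at htr
  have hfin : lorentz m (lorentzCross v n) * (J ^ 3 * graphZMC e ψ b) = 0 := by
    rw [← htr, hJ]
    unfold graphZMC
    ring
  exact ((mul_eq_zero.1 ((mul_eq_zero.1 hfin).resolve_left hf.cross_ne)).resolve_left
    (pow_ne_zero 3 hJ0))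

end IsGraphOn

end

section

theorem D2_congr {f g : ℝ × ℝ → ℝ} {y : ℝ × ℝ} (h : f =ᶠ[nhds y] g) : D2 f y = D2 g y := by
  unfold D2; rw [h.fderiv_eq]

/-- `a` is smooth near `y`. -/
def SmoothNear (a : ℝ × ℝ → ℝ) (y : ℝ × ℝ) : Prop := ∀ᶠ y' in nhds y, ContDiffAt ℝ ∞ a y'

theorem SmoothNear.d1 {a : ℝ × ℝ → ℝ} {y : ℝ × ℝ} (h : SmoothNear a y) : SmoothNear (D1 a) y :=
  Filter.Eventually.mono h fun _ h' => contDiffAt_D1 h'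

theorem SmoothNear.d2 {a : ℝ × ℝ → ℝ} {y : ℝ × ℝ} (h : SmoothNear a y) : SmoothNear (D2 a) y :=
  Filter.Eventually.mono h fun _ h' => contDiffAt_D2 h'

theorem SmoothNear.at {a : ℝ × ℝ → ℝ} {y : ℝ × ℝ} (h : SmoothNear a y) : ContDiffAt ℝ ∞ a y :=
  Filter.Eventually.self_of_nhds h

theorem smoothNear_of_ball {ψ : ℝ × ℝ → ℝ} {r : ℝ}
    (h : ∀ y ∈ Metric.ball (0 : ℝ × ℝ) r, ContDiffAt ℝ ∞ ψ y) {y : ℝ × ℝ}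
    (hy : y ∈ Metric.ball (0 : ℝ × ℝ) r) : SmoothNear ψ y := by
  filter_upwards [Metric.isOpen_ball.mem_nhds hy] with y hy using h y hy

theorem contDiffAt_graphZMC {e : ℝ} {ψ : ℝ × ℝ → ℝ} {y : ℝ × ℝ} (h : ContDiffAt ℝ ∞ ψ y) :
    ContDiffAt ℝ ∞ (graphZMC e ψ) y := by
  have h1 := contDiffAt_D1 h
  have h2 := contDiffAt_D2 h
  have h11 := contDiffAt_D1 h1
  have h12 := contDiffAt_D2 h1
  have h22 := contDiffAt_D2 h2
  unfold graphZMC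
  fun_prop

theorem hasDerivAt_graphDet_fst {e : ℝ} {ψ : ℝ × ℝ → ℝ} {x u : ℝ} (h : ContDiffAt ℝ ∞ ψ (x, u)) :
    HasDerivAt (fun s => graphDet e ψ (s, u)) ((1 - 2 * e * D2 ψ (x, u)) * D2 (D1 ψ) (x, u)
      - D1 ψ (x, u) * D1 (D1 ψ) (x, u) / 2) x := by
  have h1 := hasDerivAt_D1 (contDiffAt_D1 h)
  have h2 := hasDerivAt_D1 (contDiffAt_D2 h)
  rw [D1_D2_comm h] at h2
  have := (h2.sub ((h2.pow 2).const_mul e)).sub ((h1.pow 2).div_const 4)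
  refine this.congr_deriv ?_
  simp only [Nat.cast_ofNat, Nat.add_one_sub_one, pow_one]
  ring

theorem hasDerivAt_graphDet_snd {e : ℝ} {ψ : ℝ × ℝ → ℝ} {x u : ℝ} (h : ContDiffAt ℝ ∞ ψ (x, u)) :
    HasDerivAt (fun s => graphDet e ψ (x, s)) ((1 - 2 * e * D2 ψ (x, u)) * D2 (D2 ψ) (x, u)
      - D1 ψ (x, u) * D2 (D1 ψ) (x, u) / 2) u := by
  have h1 := hasDerivAt_D2 (contDiffAt_D1 h)
  have h2 := hasDerivAt_D2 (contDiffAt_D2 h)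
  have := (h2.sub ((h2.pow 2).const_mul e)).sub ((h1.pow 2).div_const 4)
  refine this.congr_deriv ?_
  simp only [Nat.cast_ofNat, Nat.add_one_sub_one, pow_one]
  ring

/-- A lightlike graph satisfies the zero mean curvature equation. -/
theorem graphZMC_eq_zero_of_graphDet {e : ℝ} {ψ : ℝ × ℝ → ℝ} {y : ℝ × ℝ}
    (h : ContDiffAt ℝ ∞ ψ y) (h0 : ∀ᶠ y' in nhds y, graphDet e ψ y' = 0) :
    graphZMC e ψ y = 0 := by
  obtain ⟨x, u⟩ := y
  have c1 : ContinuousAt (fun s : ℝ => (s, u)) x := by fun_prop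
  have c2 : ContinuousAt (fun s : ℝ => (x, s)) u := by fun_prop
  have e1 := (hasDerivAt_graphDet_fst (e := e) h).unique
    ((hasDerivAt_const x (0 : ℝ)).congr_of_eventuallyEq (c1.eventually h0))
  have e2 := (hasDerivAt_graphDet_snd (e := e) h).unique
    ((hasDerivAt_const u (0 : ℝ)).congr_of_eventuallyEq (c2.eventually h0))
  have e0 := h0.self_of_nhds
  unfold graphDet at e0
  unfold graphZMC
  linear_combination (4 * e * D2 (D2 ψ) (x, u) + D1 (D1 ψ) (x, u)) * e0 +
    (1 - 2 * e * D2 ψ (x, u)) * e2 - D1 ψ (x, u) / 2 * e1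

namespace IsGraphOn

variable {S : Type*} [TopologicalSpace S] [ChartedSpace E2 S]
variable {X : S → L3} {v n m c : L3} {e r : ℝ} {Ω : Set S} {ψ : ℝ × ℝ → ℝ}

/-- By continuity, and since the equation holds trivially on open sets of lightlike points, the zero
mean curvature equation holds at every point. -/
theorem graphZMC_eq_zero [IsManifold (𝓡 2) ∞ S] (h : IsGraphOn X v n m c e Ω r ψ)
    (hf : NullFrame v n m) (hX : ContMDiff (𝓡 2) 𝓘(ℝ, L3) ∞ X)
    (hinj : ∀ z, Function.Injective (dX X z)) (hH : HasZeroMeanCurvature X) {y : ℝ × ℝ}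
    (hy : y ∈ Metric.ball (0 : ℝ × ℝ) r) : graphZMC e ψ y = 0 := by
  have key : ∀ y ∈ Metric.ball (0 : ℝ × ℝ) r, graphDet e ψ y ≠ 0 → graphZMC e ψ y = 0 := by
    intro y hy hd
    obtain ⟨z, hz, rfl⟩ := h.surj y hy
    exact h.graphZMC_eq_zero_of_ne hf hX hinj hH hz hd
  by_contra hne
  apply hne
  apply graphZMC_eq_zero_of_graphDet (h.smooth y hy)
  filter_upwards [Metric.isOpen_ball.mem_nhds hy,
    (contDiffAt_graphZMC (h.smooth y hy)).continuousAt.eventually_ne hne] with y' h1 h2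
  by_contra h3
  exact h2 (key y' h1 h3)

end IsGraphOn

/-! ### Null lines through degenerate lightlike points -/

/-- Uniqueness for linear differential inequalities, on both sides of the initial point. -/
theorem eq_zero_of_norm_deriv_le {E : Type*} [NormedAddCommGroup E] [NormedSpace ℝ E]
    {f f' : ℝ → E} {K r : ℝ} (hd : ∀ u ∈ Set.Icc (-r) r, HasDerivAt f (f' u) u)
    (hb : ∀ u ∈ Set.Icc (-r) r, ‖f' u‖ ≤ K * ‖f u‖) (h0 : f 0 = 0) :
    ∀ u ∈ Set.Icc (-r) r, f u = 0 := by
  intro u hu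
  rcases le_total 0 u with h | h
  · apply eq_zero_of_abs_deriv_le_mul_abs_self_of_eq_zero_right (f := f) (f' := f') (K := K)
      (a := 0) (b := u) _ _ h0 _ u ⟨h, le_rfl⟩
    · intro t ht
      exact (hd t ⟨by linarith [ht.1, hu.2], ht.2.trans hu.2⟩).continuousAt.continuousWithinAt
    · intro t ht
      exact (hd t ⟨by linarith [ht.1, hu.2], ht.2.le.trans hu.2⟩).hasDerivWithinAt
    · intro t ht
      exact hb t ⟨by linarith [ht.1, hu.2], ht.2.le.trans hu.2⟩
  · have hd' : ∀ t ∈ Set.Icc 0 (-u), HasDerivAt (fun s => f (-s)) (-f' (-t)) t := by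
      intro t ht
      have := (hd (-t) ⟨by linarith [ht.2, hu.1], by linarith [ht.1, hu.1]⟩).scomp t
        (hasDerivAt_neg t)
      simpa using! this
    have := eq_zero_of_abs_deriv_le_mul_abs_self_of_eq_zero_right (f := fun s => f (-s))
      (f' := fun t => -f' (-t)) (K := K)
      (a := 0) (b := -u) (fun t ht => (hd' t ht).continuousAt.continuousWithinAt)
      (fun t ht => (hd' t ⟨ht.1, ht.2.le⟩).hasDerivWithinAt) (by simpa using h0)
      (fun t ht => by
        rw [norm_neg]
        exact hb (-t) ⟨by linarith [ht.2, hu.1], by linarith [ht.1, hu.1]⟩) (-u)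
      ⟨by linarith, le_rfl⟩
    simpa using this

/-- The `x`-derivative of the zero mean curvature equation; the terms with `D1 (D1 ψ) * D2 (D1 ψ)`
cancel, so that the equation is linear and homogeneous in `D1 ψ` and `D2 ψ`. -/
theorem graphZMC_deriv {e : ℝ} {ψ : ℝ × ℝ → ℝ} {y : ℝ × ℝ} (h : SmoothNear ψ y)
    (h0 : ∀ᶠ y' in nhds y, graphZMC e ψ y' = 0) :
    (1 - e * D1 ψ y ^ 2) * D2 (D2 (D1 ψ)) y =
      D1 ψ y * (2 * e * D1 (D1 ψ) y * D2 (D2 ψ) y - 2 * e * D2 (D1 ψ) y ^ 2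
        + (1 - 2 * e * D2 ψ y) * D1 (D2 (D1 ψ)) y)
      - D2 ψ y * ((1 - e * D2 ψ y) * D1 (D1 (D1 ψ)) y) := by
  obtain ⟨x, u⟩ := y
  have c1 : ContinuousAt (fun s : ℝ => (s, u)) x := by fun_prop
  have h1 := hasDerivAt_D1 h.d1.at
  have h2 := hasDerivAt_D1 h.d2.at
  rw [D1_D2_comm h.at] at h2
  have h11 := hasDerivAt_D1 h.d1.d1.at
  have h12 := hasDerivAt_D1 h.d1.d2.at
  have h22 := hasDerivAt_D1 h.d2.d2.at
  have ecomm : D1 (D2 (D2 ψ)) (x, u) = D2 (D2 (D1 ψ)) (x, u) := by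
    rw [D1_D2_comm h.d2.at]
    apply D2_congr
    exact Filter.Eventually.mono h fun y hy => D1_D2_comm hy
  rw [ecomm] at h22
  have hfull := (((((h1.pow 2).const_mul e).const_sub 1).mul h22).sub
    ((h1.mul ((h2.const_mul (2 * e)).const_sub 1)).mul h12)).add
    ((h2.mul ((h2.const_mul e).const_sub 1)).mul h11)
  have hz := hfull.unique ((hasDerivAt_const x (0 : ℝ)).congr_of_eventuallyEq (c1.eventually h0))
  simp only [Nat.cast_ofNat, Nat.add_one_sub_one, pow_one, Pi.mul_apply, Pi.pow_apply] at hz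
  linear_combination hz

/-- Through a degenerate lightlike point of a graph of zero mean curvature there passes a null
segment along which the tangent plane is constant: the derivatives `D2 ψ`, `D1 ψ`, `D2 (D1 ψ)`
satisfy a linear homogeneous system of ordinary differential equations along `x = 0`. -/
theorem graph_contains_null_line {e r : ℝ} {ψ : ℝ × ℝ → ℝ} (hr : 0 < r)
    (hs : ∀ y ∈ Metric.ball (0 : ℝ × ℝ) r, ContDiffAt ℝ ∞ ψ y)
    (hz : ∀ y ∈ Metric.ball (0 : ℝ × ℝ) r, graphZMC e ψ y = 0)
    (h1 : D1 ψ 0 = 0) (h2 : D2 ψ 0 = 0) (h12 : D2 (D1 ψ) 0 = 0) :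
    ∃ ρ > 0, ρ < r ∧ ∀ u ∈ Set.Icc (-ρ) ρ, D1 ψ (0, u) = 0 ∧ D2 ψ (0, u) = 0 := by
  have h0b : (0 : ℝ × ℝ) ∈ Metric.ball (0 : ℝ × ℝ) r := Metric.mem_ball_self hr
  have hsn : ∀ y ∈ Metric.ball (0 : ℝ × ℝ) r, SmoothNear ψ y := fun y hy =>
    smoothNear_of_ball hs hy
  -- the coefficient of the highest derivatives does not vanish near the point
  have hco : ∀ᶠ y in nhds (0 : ℝ × ℝ), 1 - e * D1 ψ y ^ 2 ≠ 0 := by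
    have hc : ContinuousAt (fun y => 1 - e * D1 ψ y ^ 2) 0 := by
      have := (hsn 0 h0b).d1.at.continuousAt
      fun_prop
    apply hc.eventually_ne
    simp [h1]
  obtain ⟨ρ', hρ', hball⟩ := Metric.eventually_nhds_iff_ball.1 hco
  set ρ := min ρ' r / 2 with hρ
  have hρ0 : 0 < ρ := by positivity
  have hρr : ρ < r := by
    have := min_le_right ρ' r; rw [hρ]; linarith [lt_min hρ' hr]
  have hρρ : ρ < ρ' := by
    have := min_le_left ρ' r; rw [hρ]; linarith [lt_min hρ' hr]
  have hin : ∀ u ∈ Set.Icc (-ρ) ρ, ((0, u) : ℝ × ℝ) ∈ Metric.ball (0 : ℝ × ℝ) r := by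
    intro u hu
    rw [mem_ball_zero_iff, Prod.norm_mk, norm_zero, max_lt_iff, Real.norm_eq_abs]
    exact ⟨hr, (abs_le.2 hu).trans_lt hρr⟩
  have hne : ∀ u ∈ Set.Icc (-ρ) ρ, 1 - e * D1 ψ (0, u) ^ 2 ≠ 0 := by
    intro u hu
    apply hball
    rw [mem_ball_zero_iff, Prod.norm_mk, norm_zero, max_lt_iff, Real.norm_eq_abs]
    exact ⟨hρ', (abs_le.2 hu).trans_lt hρρ⟩
  -- the coefficients of the linear system
  set c1 : ℝ × ℝ → ℝ := fun y => (2 * e * D1 (D1 ψ) y * D2 (D2 ψ) y - 2 * e * D2 (D1 ψ) y ^ 2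
        + (1 - 2 * e * D2 ψ y) * D1 (D2 (D1 ψ)) y) / (1 - e * D1 ψ y ^ 2) with hc1
  set c2 : ℝ × ℝ → ℝ := fun y =>
    -((1 - e * D2 ψ y) * D1 (D1 (D1 ψ)) y) / (1 - e * D1 ψ y ^ 2) with hc2
  set c3 : ℝ × ℝ → ℝ := fun y =>
    (1 - 2 * e * D2 ψ y) * D2 (D1 ψ) y / (1 - e * D1 ψ y ^ 2) with hc3
  set c4 : ℝ × ℝ → ℝ := fun y =>
    -((1 - e * D2 ψ y) * D1 (D1 ψ) y) / (1 - e * D1 ψ y ^ 2) with hc4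
  have hbound : ∀ g : ℝ × ℝ → ℝ, (∀ u ∈ Set.Icc (-ρ) ρ, ContinuousAt g (0, u)) →
      ∃ K, ∀ u ∈ Set.Icc (-ρ) ρ, |g (0, u)| ≤ K := by
    intro g hg
    obtain ⟨K, hK⟩ := isCompact_Icc.exists_bound_of_continuousOn (s := Set.Icc (-ρ) ρ)
      (f := fun u => g (0, u)) (fun u hu => ContinuousAt.continuousWithinAt
        (ContinuousAt.comp (f := fun u : ℝ => ((0 : ℝ), u)) (hg u hu) (by fun_prop)))
    exact ⟨K, hK⟩
  have hcont : ∀ u ∈ Set.Icc (-ρ) ρ, ContinuousAt c1 (0, u) ∧ ContinuousAt c2 (0, u) ∧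
      ContinuousAt c3 (0, u) ∧ ContinuousAt c4 (0, u) := by
    intro u hu
    have s := hsn _ (hin u hu)
    have a1 := s.d1.at.continuousAt
    have a2 := s.d2.at.continuousAt
    have a11 := s.d1.d1.at.continuousAt
    have a12 := s.d1.d2.at.continuousAt
    have a22 := s.d2.d2.at.continuousAt
    have a111 := s.d1.d1.d1.at.continuousAt
    have a112 := s.d1.d2.d1.at.continuousAt
    have hden : ContinuousAt (fun y => 1 - e * D1 ψ y ^ 2) (0, u) := by fun_prop
    refine ⟨?_, ?_, ?_, ?_⟩
    · exact ContinuousAt.div₀ (by fun_prop) hden (hne u hu)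
    · exact ContinuousAt.div₀ (by fun_prop) hden (hne u hu)
    · exact ContinuousAt.div₀ (by fun_prop) hden (hne u hu)
    · exact ContinuousAt.div₀ (by fun_prop) hden (hne u hu)
  obtain ⟨K1, hK1⟩ := hbound c1 fun u hu => (hcont u hu).1
  obtain ⟨K2, hK2⟩ := hbound c2 fun u hu => (hcont u hu).2.1
  obtain ⟨K3, hK3⟩ := hbound c3 fun u hu => (hcont u hu).2.2.1
  obtain ⟨K4, hK4⟩ := hbound c4 fun u hu => (hcont u hu).2.2.2
  set f : ℝ → ℝ × ℝ × ℝ := fun u => (D2 ψ (0, u), D1 ψ (0, u), D2 (D1 ψ) (0, u)) with hf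
  set f' : ℝ → ℝ × ℝ × ℝ := fun u =>
    (D2 (D2 ψ) (0, u), D2 (D1 ψ) (0, u), D2 (D2 (D1 ψ)) (0, u)) with hf'
  have hres := eq_zero_of_norm_deriv_le (f := f) (f' := f') (r := ρ)
    (K := |K1| + |K2| + |K3| + |K4| + 1) (fun u hu => by
      have s := hsn _ (hin u hu)
      exact (hasDerivAt_D2 s.d2.at).prodMk
        ((hasDerivAt_D2 s.d1.at).prodMk (hasDerivAt_D2 s.d1.d2.at))) (fun u hu => by
      have s := hsn _ (hin u hu)
      have n1 : |D2 ψ (0, u)| ≤ ‖f u‖ := norm_fst_le (f u)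
      have n2 : |D1 ψ (0, u)| ≤ ‖f u‖ := (norm_fst_le (f u).2).trans (norm_snd_le (f u))
      have n3 : |D2 (D1 ψ) (0, u)| ≤ ‖f u‖ := (norm_snd_le (f u).2).trans (norm_snd_le (f u))
      have hN := norm_nonneg (f u)
      have p1 := (hK1 u hu).trans (le_abs_self _)
      have p2 := (hK2 u hu).trans (le_abs_self _)
      have p3 := (hK3 u hu).trans (le_abs_self _)
      have p4 := (hK4 u hu).trans (le_abs_self _)
      have est : ∀ a b x y A B : ℝ, |a| ≤ |A| → |b| ≤ |B| → |x| ≤ ‖f u‖ → |y| ≤ ‖f u‖ →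
          |x * a + y * b| ≤ (|A| + |B|) * ‖f u‖ := by
        intro a b x y A B ha hb hx hy
        calc |x * a + y * b| ≤ |x| * |a| + |y| * |b| := by
              rw [← abs_mul, ← abs_mul]; exact abs_add_le _ _
          _ ≤ ‖f u‖ * |A| + ‖f u‖ * |B| := by gcongr
          _ = _ := by ring
      have lin : ∀ d x y A B T : ℝ, d ≠ 0 → d * T = x * A + y * B →
          T = x * (A / d) + y * (B / d) := by
        intro d x y A B T hd hT
        field_simp
        linear_combination hT
      have eq1 : D2 (D2 ψ) (0, u) = D1 ψ (0, u) * c3 (0, u) + D2 ψ (0, u) * c4 (0, u) := by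
        have := hz _ (hin u hu)
        unfold graphZMC at this
        have hn := hne u hu
        apply lin _ _ _ _ _ _ hn
        linear_combination this
      have eq3 : D2 (D2 (D1 ψ)) (0, u) = D1 ψ (0, u) * c1 (0, u) + D2 ψ (0, u) * c2 (0, u) := by
        have := graphZMC_deriv (e := e) s (by
          filter_upwards [Metric.isOpen_ball.mem_nhds (hin u hu)] with y hy using hz y hy)
        have hn := hne u hu
        apply lin _ _ _ _ _ _ hn
        linear_combination this
      have b1 : |D2 (D2 ψ) (0, u)| ≤ (|K3| + |K4|) * ‖f u‖ := by
        rw [eq1]; exact est _ _ _ _ _ _ p3 p4 n2 n1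
      have b3 : |D2 (D2 (D1 ψ)) (0, u)| ≤ (|K1| + |K2|) * ‖f u‖ := by
        rw [eq3]; exact est _ _ _ _ _ _ p1 p2 n2 n1
      have q1 := abs_nonneg K1
      have q2 := abs_nonneg K2
      have q3 := abs_nonneg K3
      have q4 := abs_nonneg K4
      simp only [hf', Prod.norm_mk, Real.norm_eq_abs, max_le_iff]
      refine ⟨?_, ?_, ?_⟩ <;> nlinarith) (by
      simp only [hf]
      have h1' : D1 ψ (0, 0) = 0 := h1
      have h2' : D2 ψ (0, 0) = 0 := h2
      have h12' : D2 (D1 ψ) (0, 0) = 0 := h12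
      rw [h1', h2', h12']; rfl)
  refine ⟨ρ, hρ0, hρr, fun u hu => ?_⟩
  have h3 := hres u hu
  exact ⟨congrArg (fun p : ℝ × ℝ × ℝ => p.2.1) h3, congrArg (fun p : ℝ × ℝ × ℝ => p.1) h3⟩

end

/-! ### Circles -/

theorem one_mem_fixing (d : L3) :
    (1 : Matrix (Fin 3) (Fin 3) ℝ) ∈ {A | IsLorentz A ∧ A *ᵥ d = d} := by
  simp [IsLorentz]

theorem one_mem_axisGroup (d : L3) : (1 : Matrix (Fin 3) (Fin 3) ℝ) ∈ axisGroup d :=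
  mem_connectedComponentIn (one_mem_fixing d)

theorem isPreconnected_axisGroup (d : L3) : IsPreconnected (axisGroup d) :=
  isPreconnected_connectedComponentIn

theorem isLorentz_of_mem_axisGroup {d : L3} {A : Matrix (Fin 3) (Fin 3) ℝ} (h : A ∈ axisGroup d) :
    IsLorentz A := (connectedComponentIn_subset _ _ h).1

theorem mulVec_axis_of_mem_axisGroup {d : L3} {A : Matrix (Fin 3) (Fin 3) ℝ}
    (h : A ∈ axisGroup d) : A *ᵥ d = d := (connectedComponentIn_subset _ _ h).2

theorem IsLorentz.mulVec_injective {A : Matrix (Fin 3) (Fin 3) ℝ} (h : IsLorentz A) {v w : L3}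
    (hvw : A *ᵥ v = A *ᵥ w) : v = w := by
  rw [← sub_eq_zero]
  apply lorentz_nondegenerate
  intro u
  rw [← h, Matrix.mulVec_sub, hvw, sub_self, lorentz_zero_left]

/-- The orbit of the point `p` under the group `G(l)`, `l` the line through `c` in direction `d`. -/
def orbit (c d p : L3) : Set L3 := (fun A => isometryAt c A p) '' axisGroup d

theorem mem_orbit_self (c d p : L3) : p ∈ orbit c d p :=
  ⟨1, one_mem_axisGroup d, by simp [isometryAt]⟩

theorem lorentz_axis_of_mem_orbit {c d p P : L3} (h : P ∈ orbit c d p) :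
    lorentz (P - c) d = lorentz (p - c) d := by
  obtain ⟨A, hA, rfl⟩ := h
  have h1 := isLorentz_of_mem_axisGroup hA (p - c) d
  rw [mulVec_axis_of_mem_axisGroup hA] at h1
  simpa [isometryAt] using h1

theorem lorentz_self_of_mem_orbit {c d p P : L3} (h : P ∈ orbit c d p) :
    lorentz (P - c) (P - c) = lorentz (p - c) (p - c) := by
  obtain ⟨A, hA, rfl⟩ := h
  have h1 := isLorentz_of_mem_axisGroup hA (p - c) (p - c)
  simpa [isometryAt] using h1

theorem continuous_isometryAt (c p : L3) : Continuous fun A => isometryAt c A p := by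
  unfold isometryAt
  fun_prop

theorem isPreconnected_orbit (c d p : L3) : IsPreconnected (orbit c d p) :=
  (isPreconnected_axisGroup d).image _ (continuous_isometryAt c p).continuousOn

/-- An orbit lying on the degenerate quadric `⟨P - c, d⟩² = ⟨d, d⟩ ⟨P - c, P - c⟩` with spacelike
`d`, a pair of null lines in each plane orthogonal to `d`, is contained in a line. -/
theorem collinear_orbit_of_degenerate {c d p : L3} (hd : 0 < lorentz d d)
    (h : lorentz (p - c) d ^ 2 = lorentz d d * lorentz (p - c) (p - c)) :
    Collinear ℝ (orbit c d p) := by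
  set κ := lorentz d d with hκ
  set w := p - c with hw
  set n := κ • w - lorentz w d • d with hn
  have hnd : lorentz n d = 0 := by
    rw [hn, lorentz_sub_left, lorentz_smul_left, lorentz_smul_left]; ring
  have hnn : lorentz n n = 0 := by
    have : lorentz n n = κ * lorentz n w := by
      conv_lhs => rw [hn, lorentz_sub_left, lorentz_smul_left, lorentz_smul_left,
        lorentz_comm d n, hnd, lorentz_comm]
      ring
    rw [this, hn, lorentz_sub_left, lorentz_smul_left, lorentz_smul_left, lorentz_comm d w]
    linear_combination -κ * h
  by_cases hn0 : n = 0
  · -- the point `p` lies on the axis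
    have hwd : w = (lorentz w d / κ) • d := by
      have h1 : κ • w = lorentz w d • d := by rw [hn] at hn0; exact sub_eq_zero.1 hn0
      rw [div_eq_inv_mul, mul_smul, ← h1, smul_smul, inv_mul_cancel₀ hd.ne', one_smul]
    have hsub : orbit c d p ⊆ {p} := by
      rintro _ ⟨A, hA, rfl⟩
      have : A *ᵥ w = w := by
        rw [hwd, Matrix.mulVec_smul, mulVec_axis_of_mem_axisGroup hA]
      simp only [isometryAt, ← hw, this, Set.mem_singleton_iff]
      rw [hw]; abel
    exact (collinear_singleton ℝ p).subset hsub
  · set η := Real.sqrt κ with hη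
    have hηpos : 0 < η := Real.sqrt_pos.2 hd
    have hηη : η * η = κ := Real.mul_self_sqrt hd.le
    set v := η⁻¹ • d with hv
    have hvv : lorentz v v = 1 := by
      rw [hv, lorentz_smul_left, lorentz_smul_right, ← hκ, ← hηη]; field_simp
    have hvn : lorentz v n = 0 := by rw [hv, lorentz_smul_left, lorentz_comm, hnd, mul_zero]
    obtain ⟨m, hf⟩ := exists_nullFrame hvv hnn hn0 hvn
    have hprod : ∀ A ∈ axisGroup d, lorentz (A *ᵥ w) n * lorentz (A *ᵥ w) m = 0 := by
      intro A hA
      have h1 := isLorentz_of_mem_axisGroup hA w d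
      rw [mulVec_axis_of_mem_axisGroup hA] at h1
      have h2 := isLorentz_of_mem_axisGroup hA w w
      have h3 := hf.lorentz_eq (A *ᵥ w) (A *ᵥ w)
      have h4 : η * lorentz (A *ᵥ w) v = lorentz (A *ᵥ w) d := by
        rw [hv, lorentz_smul_right]; field_simp
      rw [h2] at h3
      rw [← h1, ← h4] at h
      have h5 : κ * (lorentz (A *ᵥ w) n * lorentz (A *ᵥ w) m) = 0 := by
        linear_combination -(κ / 4) * h3 - h / 4 + lorentz (A *ᵥ w) v ^ 2 / 4 * hηη
      exact (mul_eq_zero.1 h5).resolve_left hd.ne'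
    have hnot : ∀ A ∈ axisGroup d, ¬ (lorentz (A *ᵥ w) n = 0 ∧ lorentz (A *ᵥ w) m = 0) := by
      rintro A hA ⟨h1, h2⟩
      have h3 := hf.expand (A *ᵥ w)
      rw [h1, h2, mul_zero, zero_smul, zero_smul, add_zero, add_zero, hv, smul_smul] at h3
      have h4 : w = (lorentz (A *ᵥ w) v * η⁻¹) • d := by
        apply (isLorentz_of_mem_axisGroup hA).mulVec_injective
        rw [Matrix.mulVec_smul, mulVec_axis_of_mem_axisGroup hA]
        exact h3
      apply hn0
      rw [hn, h4, lorentz_smul_left, ← hκ, smul_smul, mul_comm, sub_self]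
    have hone : lorentz ((1 : Matrix (Fin 3) (Fin 3) ℝ) *ᵥ w) n = 0 := by
      rw [Matrix.one_mulVec]
      have : lorentz n n = κ * lorentz w n := by
        conv_lhs => rw [hn, lorentz_sub_left, lorentz_smul_left, lorentz_smul_left, ← hn,
          lorentz_comm d n, hnd]
        ring
      rw [hnn] at this
      exact (mul_eq_zero.1 this.symm).resolve_left hd.ne'
    have hc : ∀ a : L3, IsClosed {A : Matrix (Fin 3) (Fin 3) ℝ | lorentz (A *ᵥ w) a = 0} := by
      intro a
      apply isClosed_eq _ continuous_const
      exact (pairing a).continuous.comp (by fun_prop)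
    have hall : ∀ A ∈ axisGroup d, lorentz (A *ᵥ w) n = 0 := by
      intro A hA
      by_contra hne
      have h1 := (mul_eq_zero.1 (hprod A hA)).resolve_left hne
      obtain ⟨B, hB, hB1, hB2⟩ := isPreconnected_closed_iff.1 (isPreconnected_axisGroup d) _ _
        (hc n) (hc m) (fun B hB => mul_eq_zero.1 (hprod B hB)) ⟨1, one_mem_axisGroup d, hone⟩
        ⟨A, hA, h1⟩
      exact hnot B hB ⟨hB1, hB2⟩
    rw [collinear_iff_of_mem (mem_orbit_self c d p)]
    refine ⟨n, ?_⟩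
    rintro _ ⟨A, hA, rfl⟩
    refine ⟨2 * lorentz (A *ᵥ w) m - 2 * lorentz w m, ?_⟩
    have h1 := hf.expand (A *ᵥ w)
    have h2 := hf.expand w
    rw [hall A hA, mul_zero, zero_smul, add_zero] at h1
    rw [Matrix.one_mulVec] at hone
    rw [hone, mul_zero, zero_smul, add_zero] at h2
    have h3 : lorentz (A *ᵥ w) v = lorentz w v := by
      have h1 := isLorentz_of_mem_axisGroup hA w d
      rw [mulVec_axis_of_mem_axisGroup hA] at h1
      rw [hv, lorentz_smul_right, lorentz_smul_right, h1]
    rw [h3] at h1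
    simp only [isometryAt, ← hw, vadd_eq_add]
    have hp : p = c + w := by rw [hw]; abel
    generalize lorentz (A *ᵥ w) m = a at h1 ⊢
    generalize lorentz w m = b at h2 ⊢
    generalize lorentz w v = α at h1 h2
    rw [hp, h1, h2]
    module

/-- The matrix of `v ↦ d × v`, which generates the group of rotations about the direction `d`. -/
def crossMatrix (d : L3) : Matrix (Fin 3) (Fin 3) ℝ :=
  !![0, -d 2, d 1; d 2, 0, -d 0; d 1, -d 0, 0]

theorem crossMatrix_mulVec (d v : L3) : crossMatrix d *ᵥ v = lorentzCross d v := by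
  ext i
  fin_cases i <;>
    simp [crossMatrix, lorentzCross, Matrix.mulVec, dotProduct, Fin.sum_univ_three] <;>
  ring

/-- The rotation `1 + s M + k M²`, where `M` is the matrix of `v ↦ d × v`; for instance
`s = sin θ / η`, `k = (1 - cos θ) / η²` if `⟨d, d⟩ = -η²`. -/
def rotation (d : L3) (s k : ℝ) : Matrix (Fin 3) (Fin 3) ℝ :=
  1 + s • crossMatrix d + k • (crossMatrix d * crossMatrix d)

theorem rotation_mulVec (d : L3) (s k : ℝ) (v : L3) : rotation d s k *ᵥ v =
    v + s • lorentzCross d v + k • lorentzCross d (lorentzCross d v) := by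
  simp only [rotation, Matrix.add_mulVec, Matrix.one_mulVec, Matrix.smul_mulVec,
    ← Matrix.mulVec_mulVec, crossMatrix_mulVec]

theorem lorentz_rotation (d : L3) (s k : ℝ) (v w : L3) :
    lorentz (rotation d s k *ᵥ v) (rotation d s k *ᵥ w) = lorentz v w +
      (s ^ 2 - 2 * k - lorentz d d * k ^ 2) * lorentz (lorentzCross d v) (lorentzCross d w) := by
  rw [rotation_mulVec, rotation_mulVec]
  simp only [lorentz, lorentzCross, Pi.add_apply, Pi.smul_apply, smul_eq_mul, Matrix.cons_val]
  ring

theorem rotation_axis (d : L3) (s k : ℝ) : rotation d s k *ᵥ d = d := by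
  have : lorentzCross d d = 0 := by
    ext i; fin_cases i <;> simp [lorentzCross] <;> ring
  rw [rotation_mulVec, this]
  have h2 : lorentzCross d 0 = 0 := by
    ext i; fin_cases i <;> simp [lorentzCross]
  rw [h2]; simp

theorem rotation_mem_axisGroup_of_path {d : L3} {s k : ℝ → ℝ} (hs : Continuous s)
    (hk : Continuous k) (hs0 : s 0 = 0) (hk0 : k 0 = 0)
    (h : ∀ t, s t ^ 2 = 2 * k t + lorentz d d * k t ^ 2) (t : ℝ) :
    rotation d (s t) (k t) ∈ axisGroup d := by
  have hc : Continuous fun t => rotation d (s t) (k t) := by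
    unfold rotation; fun_prop
  have hsub : Set.range (fun t => rotation d (s t) (k t)) ⊆ {A | IsLorentz A ∧ A *ᵥ d = d} := by
    rintro _ ⟨t, rfl⟩
    refine ⟨fun v w => ?_, rotation_axis _ _ _⟩
    rw [lorentz_rotation, h t]; ring
  have h1 : (1 : Matrix (Fin 3) (Fin 3) ℝ) ∈ Set.range (fun t => rotation d (s t) (k t)) :=
    ⟨0, by simp [rotation, hs0, hk0]⟩
  exact (isPreconnected_range hc).subset_connectedComponentIn h1 hsub ⟨t, rfl⟩

theorem exists_cos_sin {x y : ℝ} (h : x ^ 2 + y ^ 2 = 1) :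
    ∃ θ : ℝ, x = Real.cos θ ∧ y = Real.sin θ := by
  have hn : ‖(⟨x, y⟩ : ℂ)‖ = 1 := by
    rw [Complex.norm_eq_sqrt_sq_add_sq]; simp [h]
  have h0 : (⟨x, y⟩ : ℂ) ≠ 0 := by rw [← norm_ne_zero_iff, hn]; exact one_ne_zero
  refine ⟨Complex.arg ⟨x, y⟩, ?_, ?_⟩
  · rw [Complex.cos_arg h0, hn]; simp
  · rw [Complex.sin_arg, hn]; simp

theorem rotation_mem_axisGroup {d : L3} {s k : ℝ} (h : s ^ 2 = 2 * k + lorentz d d * k ^ 2)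
    (hb : lorentz d d < 0 ∨ 0 < 1 + lorentz d d * k) : rotation d s k ∈ axisGroup d := by
  rcases lt_or_ge (lorentz d d) 0 with hneg | hpos
  · set η := Real.sqrt (-lorentz d d) with hη
    have hη0 : 0 < η := Real.sqrt_pos.2 (by linarith)
    have hηη : η ^ 2 = -lorentz d d := Real.sq_sqrt (by linarith)
    obtain ⟨θ, h1, h2⟩ := exists_cos_sin (x := 1 - η ^ 2 * k) (y := η * s) (by
      linear_combination η ^ 2 * h + η ^ 2 * k ^ 2 * hηη)
    have := rotation_mem_axisGroup_of_path (d := d) (s := fun t => Real.sin (t * θ) / η)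
      (k := fun t => (1 - Real.cos (t * θ)) / η ^ 2) (by fun_prop) (by fun_prop) (by simp) (by simp)
      (fun t => by
        have hsc := Real.sin_sq_add_cos_sq (t * θ)
        have : lorentz d d = -η ^ 2 := by linarith
        rw [this]
        field_simp
        linear_combination hsc) 1
    simp only [one_mul, ← h1, ← h2] at this
    have e1 : η * s / η = s := by field_simp
    have e2 : (1 - (1 - η ^ 2 * k)) / η ^ 2 = k := by field_simp; ring
    rwa [e1, e2] at this
  · have hb' := hb.resolve_left (not_lt.2 hpos)
    set κ := lorentz d d with hκ
    have hpos1 : ∀ x : ℝ, 0 ≤ 1 + κ * x ^ 2 := fun x => by positivity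
    have hden : ∀ x : ℝ, 0 < 1 + Real.sqrt (1 + κ * x ^ 2) := fun x => by positivity
    have := rotation_mem_axisGroup_of_path (d := d) (s := fun t => t * s)
      (k := fun t => (t * s) ^ 2 / (1 + Real.sqrt (1 + κ * (t * s) ^ 2))) (by fun_prop)
      (by
        apply Continuous.div (by fun_prop) (by fun_prop)
        intro t; exact (hden _).ne') (by simp) (by simp)
      (fun t => by
        have hsq := Real.sq_sqrt (hpos1 (t * s))
        have := (hden (t * s)).ne'
        set R := Real.sqrt (1 + κ * (t * s) ^ 2) with hR
        rw [← hκ]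
        field_simp
        linear_combination (t * s) ^ 2 * hsq) 1
    simp only [one_mul] at this
    have e : s ^ 2 / (1 + Real.sqrt (1 + κ * s ^ 2)) = k := by
      have h1 : Real.sqrt (1 + κ * s ^ 2) = 1 + κ * k := by
        rw [Real.sqrt_eq_iff_mul_self_eq (hpos1 s) hb'.le, h]; ring
      rw [h1, div_eq_iff (by linarith), h]; ring
    rwa [e] at this

theorem lorentzCross_expand (a b c y : L3) : lorentz (lorentzCross a b) c • y =
    lorentz y a • lorentzCross b c + lorentz y b • lorentzCross c a
      + lorentz y c • lorentzCross a b := by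
  ext i
  fin_cases i <;> simp [lorentz, lorentzCross] <;> ring

/-- A circle is a complete branch of a conic: it contains every point with the same values of the
invariants `⟨P - c, d⟩` and `⟨P - c, P - c⟩` which, if the axis is spacelike, lies on the same
branch. -/
theorem mem_orbit_of_invariants {c d p P : L3} (h1 : lorentz (P - c) d = lorentz (p - c) d)
    (h2 : lorentz (P - c) (P - c) = lorentz (p - c) (p - c))
    (hG : lorentz (p - c) d ^ 2 - lorentz d d * lorentz (p - c) (p - c) ≠ 0)
    (hb : lorentz d d < 0 ∨ 0 < (lorentz (p - c) d ^ 2 - lorentz d d * lorentz (P - c) (p - c)) /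
      (lorentz (p - c) d ^ 2 - lorentz d d * lorentz (p - c) (p - c))) :
    P ∈ orbit c d p := by
  set T := P - c with hT
  set w := p - c with hw
  set G := lorentz w d ^ 2 - lorentz d d * lorentz w w with hGdef
  have hMM : lorentz (lorentzCross d w) (lorentzCross d w) = G := by
    rw [hGdef]; simp only [lorentz, lorentzCross, Matrix.cons_val]; ring
  set s := lorentz T (lorentzCross d w) / G with hs
  set k := (lorentz w w - lorentz T w) / G with hk
  have hT' : T = rotation d s k *ᵥ w := by
    rw [← sub_eq_zero]
    set y := T - rotation d s k *ᵥ w with hy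
    have y1 : lorentz y d = 0 := by
      rw [hy, rotation_mulVec, lorentz_sub_left, lorentz_add_left, lorentz_add_left,
        lorentz_smul_left, lorentz_smul_left, h1]
      have e1 : lorentz (lorentzCross d w) d = 0 := by
        simp only [lorentz, lorentzCross, Matrix.cons_val]; ring
      have e2 : lorentz (lorentzCross d (lorentzCross d w)) d = 0 := by
        simp only [lorentz, lorentzCross, Matrix.cons_val]; ring
      rw [e1, e2]; ring
    have y2 : lorentz y w = 0 := by
      rw [hy, rotation_mulVec, lorentz_sub_left, lorentz_add_left, lorentz_add_left,
        lorentz_smul_left, lorentz_smul_left]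
      have e1 : lorentz (lorentzCross d w) w = 0 := by
        simp only [lorentz, lorentzCross, Matrix.cons_val]; ring
      have e2 : lorentz (lorentzCross d (lorentzCross d w)) w = -G := by
        rw [hGdef]; simp only [lorentz, lorentzCross, Matrix.cons_val]; ring
      rw [e1, e2, hk]; field_simp; ring
    have y3 : lorentz y (lorentzCross d w) = 0 := by
      rw [hy, rotation_mulVec, lorentz_sub_left, lorentz_add_left, lorentz_add_left,
        lorentz_smul_left, lorentz_smul_left, hMM]
      have e1 : lorentz w (lorentzCross d w) = 0 := by
        simp only [lorentz, lorentzCross, Matrix.cons_val]; ring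
      have e2 : lorentz (lorentzCross d (lorentzCross d w)) (lorentzCross d w) = 0 := by
        simp only [lorentz, lorentzCross, Matrix.cons_val]; ring
      rw [e1, e2, hs]; field_simp; ring
    have := lorentzCross_expand d w (lorentzCross d w) y
    rw [y1, y2, y3, hMM] at this
    simp only [zero_smul, add_zero] at this
    exact (smul_eq_zero.1 this).resolve_left hG
  have hsk : s ^ 2 = 2 * k + lorentz d d * k ^ 2 := by
    have := lorentz_rotation d s k w w
    rw [← hT', h2, hMM] at this
    have h3 : (s ^ 2 - 2 * k - lorentz d d * k ^ 2) * G = 0 := by linarith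
    have h4 := (mul_eq_zero.1 h3).resolve_right hG
    linarith
  refine ⟨rotation d s k, rotation_mem_axisGroup hsk ?_, ?_⟩
  · refine hb.imp id fun hb => ?_
    have e : 1 + lorentz d d * k = (lorentz w d ^ 2 - lorentz d d * lorentz T w) / G := by
      rw [hk]; field_simp; rw [hGdef]; ring
    rwa [e]
  · simp only [isometryAt, ← hw, ← hT']
    rw [hT]; abel

theorem IsLine.isPreconnected {C : Set L3} (h : IsLine C) : IsPreconnected C := by
  obtain ⟨c, d, -, rfl⟩ := h
  have : lineThrough c d = Set.range fun s : ℝ => c + s • d := by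
    ext p; simp only [lineThrough, Set.mem_ofPred_eq, Set.mem_range, eq_comm]
  rw [this]
  exact isPreconnected_range (by fun_prop)

theorem IsCircle.exists_orbit {C : Set L3} (h : IsCircle C) :
    ∃ c d p, d ≠ 0 ∧ C = orbit c d p ∧ ¬ Collinear ℝ C := h

theorem IsCircle.isPreconnected {C : Set L3} (h : IsCircle C) : IsPreconnected C := by
  obtain ⟨c, d, p, -, rfl, -⟩ := h.exists_orbit
  exact isPreconnected_orbit c d p

/-! ### The foliation by the planes `ℓ = u` -/

section

variable {S : Type*} [TopologicalSpace S] [ChartedSpace E2 S]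

/-- An immersed zero mean curvature surface without timelike points or without spacelike points,
foliated by circles and at most countably many lines in the planes `ℓ = u`. -/
structure IsOneSidedFoliated (X : S → L3) (ℓ : L3 →ₗ[ℝ] ℝ) : Prop where
  smooth : ContMDiff (𝓡 2) 𝓘(ℝ, L3) ∞ X
  inj : ∀ z, Function.Injective (dX X z)
  zmc : HasZeroMeanCurvature X
  transverse : ∀ z, ∃ w, ℓ (dX X z w) ≠ 0
  leaves : ∀ z, IsCircle (leaf X ℓ (ℓ (X z))) ∨ IsLine (leaf X ℓ (ℓ (X z)))
  countable : {u : ℝ | IsLine (leaf X ℓ u)}.Countable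
  oneSided : (∀ z, ¬ TimelikeAt X z) ∨ ∀ z, ¬ SpacelikeAt X z

namespace IsOneSidedFoliated

variable {X : S → L3} {ℓ : L3 →ₗ[ℝ] ℝ}

theorem isPreconnected_leaf (h : IsOneSidedFoliated X ℓ) (z : S) :
    IsPreconnected (leaf X ℓ (ℓ (X z))) :=
  (h.leaves z).elim IsCircle.isPreconnected IsLine.isPreconnected

theorem continuous_height (h : IsOneSidedFoliated X ℓ) : Continuous fun z => ℓ (X z) :=
  (LinearMap.continuous_of_finiteDimensional ℓ).comp h.smooth.continuous

/-- The height function of a surface transverse to the planes `ℓ = u` is open. -/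
theorem map_height_nhds [IsManifold (𝓡 2) ∞ S] (h : IsOneSidedFoliated X ℓ) (z : S) :
    Filter.map (fun z => ℓ (X z)) (nhds z) = nhds (ℓ (X z)) := by
  obtain ⟨w, hw⟩ := h.transverse z
  exact map_comp_nhds h.smooth (LinearMap.toContinuousLinearMap ℓ) fun t =>
    ⟨(t / ℓ (dX X z w)) • w, by simp [hw]⟩

theorem frequently_height [IsManifold (𝓡 2) ∞ S] (h : IsOneSidedFoliated X ℓ) (z : S)
    {p : S → Prop} (hp : ∀ᶠ z' in nhds z, p z') :
    ∀ᶠ u in nhds (ℓ (X z)), ∃ z', ℓ (X z') = u ∧ p z' := by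
  rw [← h.map_height_nhds z, Filter.eventually_map]
  filter_upwards [hp] with z' hz' using ⟨z', rfl, hz'⟩

end IsOneSidedFoliated

theorem IsCircle.exists_quadric {C : Set L3} (h : IsCircle C) :
    ∃ (c : L3) (k : ℝ), ∀ P ∈ C, lorentz (P - c) (P - c) = k := by
  obtain ⟨c, d, p, -, rfl, -⟩ := h.exists_orbit
  exact ⟨c, _, fun P hP => lorentz_self_of_mem_orbit hP⟩

/-- The quadratic form `x² - e q²`, which is the metric of the planes `p + e q = u`. -/
def coordN (v n c : L3) (e : ℝ) (P : L3) : ℝ := coordX v c P ^ 2 - e * coordQ n c P ^ 2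

section Conic

variable {v n m c : L3} {e : ℝ}

theorem lorentz_sub_sub (hf : NullFrame v n m) (c0 P : L3) :
    lorentz (P - c0) (P - c0) = coordX v c P ^ 2
      + (coordU n m e c P - e * coordQ n c P) * coordQ n c P
      + 2 * (coordX v c P * lorentz (c - c0) v
        + ((coordU n m e c P - e * coordQ n c P) * lorentz (c - c0) n
        + coordQ n c P * lorentz (c - c0) m)) + lorentz (c - c0) (c - c0) := by
  have e0 : P - c0 = (P - c) + (c - c0) := by abel
  rw [e0]
  simp only [lorentz_add_left, lorentz_add_right, lorentz_comm (c - c0) (P - c)]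
  rw [hf.lorentz_eq (P - c) (P - c), hf.lorentz_eq (P - c) (c - c0)]
  unfold coordX coordU coordQ
  ring

/-- A leaf in a plane `p + e q = u` is contained in a conic with quadratic part proportional to
`x² - e q²`. -/
theorem exists_conic (hf : NullFrame v n m) {C : Set L3} (hC : IsCircle C ∨ IsLine C) {u : ℝ}
    (hu : ∀ P ∈ C, coordU n m e c P = u) :
    ∃ a b b' d : ℝ, (a ≠ 0 ∨ b ≠ 0 ∨ b' ≠ 0) ∧
      ∀ P ∈ C, a * coordN v n c e P + b * coordX v c P + b' * coordQ n c P + d = 0 := by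
  rcases hC with hC | ⟨c1, d1, hd1, rfl⟩
  · obtain ⟨c0, k, hk⟩ := hC.exists_quadric
    refine ⟨1, 2 * lorentz (c - c0) v, u - 2 * e * lorentz (c - c0) n + 2 * lorentz (c - c0) m,
      2 * u * lorentz (c - c0) n + lorentz (c - c0) (c - c0) - k, Or.inl one_ne_zero, ?_⟩
    intro P hP
    have h1 := hk P hP
    rw [lorentz_sub_sub (c := c) (e := e) hf c0 P, hu P hP] at h1
    unfold coordN
    linear_combination h1
  · -- the direction of the line lies in the plane
    have hpar : 2 * lorentz d1 m + e * (2 * lorentz d1 n) = 0 := by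
      have h0 := hu c1 ⟨0, by simp⟩
      have h1 := hu (c1 + d1) ⟨1, by simp⟩
      have e1 : c1 + d1 - c = (c1 - c) + d1 := by abel
      unfold coordU at h0 h1
      rw [e1, lorentz_add_left, lorentz_add_left] at h1
      linarith
    refine ⟨0, 2 * lorentz d1 n, -lorentz d1 v,
      -(2 * lorentz d1 n * coordX v c c1) + lorentz d1 v * coordQ n c c1, Or.inr ?_, ?_⟩
    · by_contra hcon
      push Not at hcon
      have h1 : lorentz d1 n = 0 := by linarith [hcon.1]
      have h2 : lorentz d1 v = 0 := by linarith [hcon.2]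
      rw [h1] at hpar
      exact hd1 (hf.eq_zero_of_orthogonal h2 h1 (by linarith))
    · rintro P ⟨s, rfl⟩
      have e1 : c1 + s • d1 - c = (c1 - c) + s • d1 := by abel
      unfold coordX coordQ
      rw [e1]
      simp only [lorentz_add_left, lorentz_smul_left]
      ring

end Conic

/-! ### The local normal form of a surface near a lightlike point -/

/-- Geometric data of a lightlike direction transverse to the foliation: a null frame `v, n, m` with
`v` in the planes `ℓ = const` and `ℓ(n) = 1`, so that `ℓ = p + e q`. -/
structure IsAdapted (ℓ : L3 →ₗ[ℝ] ℝ) (v n m : L3) (e : ℝ) : Prop where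
  frame : NullFrame v n m
  height : ∀ w, ℓ w = 2 * lorentz w m + e * (2 * lorentz w n)

theorem IsAdapted.coordU_eq {ℓ : L3 →ₗ[ℝ] ℝ} {v n m : L3} {e : ℝ} (h : IsAdapted ℓ v n m e)
    (c P : L3) : coordU n m e c P = ℓ P - ℓ c := by
  rw [← map_sub, h.height]; rfl

theorem IsAdapted.height_n {ℓ : L3 →ₗ[ℝ] ℝ} {v n m : L3} {e : ℝ} (h : IsAdapted ℓ v n m e) :
    ℓ n = 1 := by
  rw [h.height, h.frame.nm, h.frame.nn]; ring

/-- The computation behind the Riccati equation: if the graph `ψ = A(u)(x² - e ψ²)`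
satisfies the zero mean curvature equation, then `A'' = 2 A A'`. The letters `p1, …, p22` stand for
the partial derivatives of `ψ`. -/
theorem riccati_algebra {e A A1 A2 x N p1 p2 p11 p12 p22 : ℝ}
    (hN : N = x ^ 2 - e * (A * N) ^ 2) (hN0 : N ≠ 0) (hx : x ≠ 0)
    (h1 : p1 = A * (2 * x - 2 * e * (A * N) * p1))
    (h2 : p2 = A1 * N - 2 * e * A * (A * N) * p2)
    (h11 : p11 = A * (2 - 2 * e * p1 ^ 2 - 2 * e * (A * N) * p11))
    (h12 : p12 = A1 * (2 * x - 2 * e * (A * N) * p1)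
      - A * (2 * e * p2 * p1 + 2 * e * (A * N) * p12))
    (h22 : p22 = A2 * N - 4 * e * A1 * (A * N) * p2 - 2 * e * A * p2 ^ 2
      - 2 * e * A * (A * N) * p22)
    (hz : (1 - e * p1 ^ 2) * p22 - p1 * (1 - 2 * e * p2) * p12 + p2 * (1 - e * p2) * p11 = 0) :
    A2 = 2 * A * A1 := by
  obtain ⟨H, hH⟩ : ∃ H, H = 1 + 2 * e * A ^ 2 * N := ⟨_, rfl⟩
  have hx2 : x ^ 2 = N * (H + 1) / 2 := by rw [hH]; linear_combination -hN
  have hH0 : H ≠ 0 := by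
    intro h0
    have h3 : A * x = 0 := by
      have : p1 * H = 2 * (A * x) := by rw [hH]; linear_combination h1
      rw [h0, mul_zero] at this; linarith
    have hA : A = 0 := (mul_eq_zero.1 h3).resolve_right hx
    rw [hA] at hH
    rw [hH] at h0
    norm_num at h0
  have q1 : p1 = 2 * A * x / H := by
    rw [eq_div_iff hH0, hH]; linear_combination h1
  have q2 : p2 = A1 * N / H := by
    rw [eq_div_iff hH0, hH]; linear_combination h2
  have r1 : 1 - e * p1 ^ 2 = 1 / H ^ 2 := by
    rw [q1]; field_simp
    linear_combination (-4 * e * A ^ 2) * hx2 + (H + 1) * hH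
  have r0 : 2 * x - 2 * e * (A * N) * p1 = 2 * x / H := by
    rw [q1]; field_simp; rw [hH]; ring
  have q11 : p11 = 2 * A / H ^ 3 := by
    have : p11 * H = 2 * A * (1 - e * p1 ^ 2) := by rw [hH]; linear_combination h11
    rw [r1] at this
    rw [eq_div_iff (pow_ne_zero 3 hH0)]
    field_simp at this
    linear_combination this
  have q12 : p12 = 2 * x * A1 / H ^ 3 := by
    rw [r0] at h12
    have : p12 * H = A1 * (2 * x / H) - A * (2 * e * p2 * p1) := by
      linear_combination h12 + p12 * hH
    rw [q1, q2] at this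
    rw [eq_div_iff (pow_ne_zero 3 hH0)]
    field_simp at this
    have h3 : p12 * H ^ 3 = 2 * x * A1 * (H - 2 * e * A ^ 2 * N) := by linear_combination this
    rw [h3, hH]; ring
  have q22 : p22 = (A2 * N * H ^ 2 - 4 * e * A * A1 ^ 2 * N ^ 2 * H - 2 * e * A * A1 ^ 2 * N ^ 2)
      / H ^ 3 := by
    have : p22 * H = A2 * N - 4 * e * A1 * (A * N) * p2 - 2 * e * A * p2 ^ 2 := by
      rw [hH]; linear_combination h22
    rw [q2] at this
    rw [eq_div_iff (pow_ne_zero 3 hH0)]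
    field_simp at this
    linear_combination this
  rw [r1, q11, q12, q22, q1, q2] at hz
  have h3 : N * H ^ 2 * (A2 - 2 * A * A1) = 0 := by
    field_simp at hz
    linear_combination hz + 4 * A * A1 * (H - 2 * e * A1 * N) * hx2
  have h4 := (mul_eq_zero.1 h3).resolve_left (mul_ne_zero hN0 (pow_ne_zero 2 hH0))
  linarith

end

section

/-- A function tangent to the axis is small compared with `x`. -/
theorem eventually_sq_lt_of_deriv_eq_zero {f : ℝ → ℝ} (e : ℝ) (h : HasDerivAt f 0 0)
    (h0 : f 0 = 0) : ∀ᶠ x in nhds (0 : ℝ), x ≠ 0 → 0 < x ^ 2 - e * f x ^ 2 := by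
  have h1 := h.isLittleO.def (c := 1 / (1 + |e|)) (by positivity)
  filter_upwards [h1] with x hx hx0
  simp only [h0, sub_zero, smul_zero, Real.norm_eq_abs] at hx
  have hpos : 0 < 1 + |e| := by positivity
  have h2 : f x ^ 2 ≤ (1 / (1 + |e|) * |x|) ^ 2 := by
    rw [← sq_abs]
    exact pow_le_pow_left₀ (abs_nonneg _) hx 2
  rw [mul_pow, sq_abs] at h2
  have h3 : e * f x ^ 2 ≤ |e| * ((1 / (1 + |e|)) ^ 2 * x ^ 2) :=
    (mul_le_mul_of_nonneg_right (le_abs_self e) (sq_nonneg _)).trans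
      (mul_le_mul_of_nonneg_left h2 (abs_nonneg e))
  have h4 : |e| * (1 / (1 + |e|)) ^ 2 < 1 := by
    rw [div_pow, one_pow, mul_one_div, div_lt_one (by positivity)]
    nlinarith [abs_nonneg e]
  have h5 : 0 < x ^ 2 := by positivity
  nlinarith

theorem mem_ball_pair {r x u : ℝ} (hx : |x| < r) (hu : |u| < r) :
    ((x, u) : ℝ × ℝ) ∈ Metric.ball (0 : ℝ × ℝ) r := by
  rw [mem_ball_zero_iff, Prod.norm_mk, max_lt_iff, Real.norm_eq_abs, Real.norm_eq_abs]
  exact ⟨hx, hu⟩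

/-- If the leaves of a graph of zero mean curvature are the conics `ψ = a(u)(x² - e ψ²)`, then `a`
satisfies a Riccati equation. -/
theorem hasDerivAt_of_conic_leaves {e r ρ : ℝ} {ψ : ℝ × ℝ → ℝ} {a : ℝ → ℝ}
    (hρ : 0 < ρ) (hρr : ρ < r)
    (hs : ∀ y ∈ Metric.ball (0 : ℝ × ℝ) r, ContDiffAt ℝ ∞ ψ y)
    (hz : ∀ y ∈ Metric.ball (0 : ℝ × ℝ) r, graphZMC e ψ y = 0)
    (h0 : ψ (0, 0) = 0) (h1 : D1 ψ (0, 0) = 0)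
    (ha : ∀ u ∈ Set.Ioo (-ρ) ρ, ∀ x, |x| < r → ψ (x, u) = a u * (x ^ 2 - e * ψ (x, u) ^ 2)) :
    ∃ ρ' > 0, ρ' ≤ ρ ∧ ∃ k, ∀ u ∈ Set.Ioo (-ρ') ρ', HasDerivAt a (a u ^ 2 + k) u := by
  have hr : 0 < r := hρ.trans hρr
  have hsn : ∀ x u, |x| < r → |u| < r → SmoothNear ψ (x, u) := fun x u hx hu =>
    smoothNear_of_ball hs (mem_ball_pair hx hu)
  -- a value `x₀` with `x₀² - e ψ² ≠ 0`
  obtain ⟨x₀, hx0, hx0r, hN0⟩ : ∃ x₀, x₀ ≠ 0 ∧ |x₀| < r ∧ x₀ ^ 2 - e * ψ (x₀, 0) ^ 2 ≠ 0 := by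
    have hd := hasDerivAt_D1 (hsn 0 0 (by simpa using hr) (by simpa using hr)).at
    rw [h1] at hd
    obtain ⟨δ, hδ, hball⟩ := Metric.eventually_nhds_iff_ball.1
      (eventually_sq_lt_of_deriv_eq_zero e hd h0)
    have hm : 0 < min δ r := lt_min hδ hr
    refine ⟨min δ r / 2, by positivity, ?_, ?_⟩
    · rw [abs_of_pos (by positivity)]; linarith [min_le_right δ r]
    · refine (hball _ ?_ (by positivity)).ne'
      rw [mem_ball_zero_iff, Real.norm_eq_abs, abs_of_pos (by positivity)]
      linarith [min_le_left δ r]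
  have hcu : ContinuousAt (fun u => x₀ ^ 2 - e * ψ (x₀, u) ^ 2) 0 := by
    have hc := (hasDerivAt_D2 (hsn x₀ 0 hx0r (by simpa using hr)).at).continuousAt
    exact continuousAt_const.sub (continuousAt_const.mul (hc.pow 2))
  obtain ⟨δ, hδ, hball⟩ := Metric.eventually_nhds_iff_ball.1 (hcu.eventually_ne hN0)
  set ρ' := min δ ρ with hρ'
  have hρ'0 : 0 < ρ' := lt_min hδ hρ
  have hin : ∀ u ∈ Set.Ioo (-ρ') ρ', u ∈ Set.Ioo (-ρ) ρ ∧ |u| < r ∧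
      x₀ ^ 2 - e * ψ (x₀, u) ^ 2 ≠ 0 := by
    intro u hu
    have hu' : |u| < ρ' := abs_lt.2 hu
    have h2 : |u| < ρ := hu'.trans_le (min_le_right _ _)
    refine ⟨abs_lt.1 h2, h2.trans hρr, hball u ?_⟩
    rw [mem_ball_zero_iff, Real.norm_eq_abs]
    exact hu'.trans_le (min_le_left _ _)
  set B : ℝ → ℝ := fun u => ψ (x₀, u) / (x₀ ^ 2 - e * ψ (x₀, u) ^ 2) with hB
  have hBa : ∀ u ∈ Set.Ioo (-ρ') ρ', B u = a u := by
    intro u hu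
    obtain ⟨hu1, -, hu3⟩ := hin u hu
    rw [hB]; simp only
    rw [div_eq_iff hu3]; exact ha u hu1 x₀ hx0r
  have hBs : ContDiffOn ℝ ∞ B (Set.Ioo (-ρ') ρ') := by
    intro u hu
    obtain ⟨hu1, hu2, hu3⟩ := hin u hu
    have h2 : ContDiffAt ℝ ∞ (fun u => ψ (x₀, u)) u :=
      ContDiffAt.comp (g := ψ) (f := fun u => (x₀, u)) u (hsn x₀ u hx0r hu2).at
        (contDiffAt_const.prodMk contDiffAt_id)
    apply ContDiffAt.contDiffWithinAt
    exact h2.div (contDiffAt_const.sub (contDiffAt_const.mul (h2.pow 2))) hu3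
  have hBd := ((contDiffOn_infty_iff_deriv_of_isOpen isOpen_Ioo).1 hBs)
  have d1 : ∀ u ∈ Set.Ioo (-ρ') ρ', HasDerivAt B (deriv B u) u := fun u hu =>
    (hBd.1.differentiableAt (isOpen_Ioo.mem_nhds hu)).hasDerivAt
  have d2 : ∀ u ∈ Set.Ioo (-ρ') ρ', HasDerivAt (deriv B) (deriv (deriv B) u) u := fun u hu =>
    ((hBd.2.differentiableOn (by simp)).differentiableAt (isOpen_Ioo.mem_nhds hu)).hasDerivAt
  have hform : ∀ u ∈ Set.Ioo (-ρ') ρ', ∀ x, |x| < r →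
      ψ (x, u) = B u * (x ^ 2 - e * ψ (x, u) ^ 2) := by
    intro u hu x hx
    rw [hBa u hu]; exact ha u (hin u hu).1 x hx
  -- first derivatives of the equation of the leaves
  have ex : ∀ u ∈ Set.Ioo (-ρ') ρ', ∀ x, |x| < r →
      D1 ψ (x, u) = B u * (2 * x - 2 * e * ψ (x, u) * D1 ψ (x, u)) := by
    intro u hu x hx
    have hd := hasDerivAt_D1 (hsn x u hx (hin u hu).2.1).at
    have hd2 := (((hasDerivAt_id x).pow 2).sub ((hd.pow 2).const_mul e)).const_mul (B u)
    have heq : (fun s => ψ (s, u)) =ᶠ[nhds x] fun s => B u * (s ^ 2 - e * ψ (s, u) ^ 2) := by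
      have : ∀ᶠ s in nhds x, |s| < r := (continuous_abs.tendsto x).eventually_lt_const hx
      filter_upwards [this] with s hs using hform u hu s hs
    have := (hd.congr_of_eventuallyEq heq.symm).unique hd2
    simp only [id, Nat.cast_ofNat, Nat.add_one_sub_one, pow_one] at this
    linear_combination this
  have eu : ∀ u ∈ Set.Ioo (-ρ') ρ', D2 ψ (x₀, u) = deriv B u * (x₀ ^ 2 - e * ψ (x₀, u) ^ 2)
      - 2 * e * B u * ψ (x₀, u) * D2 ψ (x₀, u) := by
    intro u hu
    have hd := hasDerivAt_D2 (hsn x₀ u hx0r (hin u hu).2.1).at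
    have hd2 := (d1 u hu).mul (((hd.pow 2).const_mul e).const_sub (x₀ ^ 2))
    have heq : (fun s => ψ (x₀, s)) =ᶠ[nhds u] fun s => B s * (x₀ ^ 2 - e * ψ (x₀, s) ^ 2) := by
      filter_upwards [isOpen_Ioo.mem_nhds hu] with s hs using hform s hs x₀ hx0r
    have := (hd.congr_of_eventuallyEq heq.symm).unique hd2
    simp only [Pi.pow_apply, Nat.cast_ofNat, Nat.add_one_sub_one, pow_one] at this
    linear_combination this
  have hric : ∀ u ∈ Set.Ioo (-ρ') ρ', deriv (deriv B) u = 2 * B u * deriv B u := by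
    intro u hu
    obtain ⟨hu1, hu2, hu3⟩ := hin u hu
    have s := hsn x₀ u hx0r hu2
    have hball := mem_ball_pair hx0r hu2
    -- second derivatives of the equation of the leaves
    have exx : D1 (D1 ψ) (x₀, u) = B u * (2 - 2 * e * D1 ψ (x₀, u) ^ 2
        - 2 * e * ψ (x₀, u) * D1 (D1 ψ) (x₀, u)) := by
      have hd := hasDerivAt_D1 s.at
      have hdd := hasDerivAt_D1 s.d1.at
      have hd2 := (((hasDerivAt_id x₀).const_mul 2).sub ((hd.const_mul (2 * e)).mul hdd)).const_mul
        (B u)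
      have heq : (fun s => D1 ψ (s, u)) =ᶠ[nhds x₀]
          fun s => B u * (2 * s - 2 * e * ψ (s, u) * D1 ψ (s, u)) := by
        have : ∀ᶠ s in nhds x₀, |s| < r := (continuous_abs.tendsto x₀).eventually_lt_const hx0r
        filter_upwards [this] with s hs using ex u hu s hs
      have := (hdd.congr_of_eventuallyEq heq.symm).unique hd2
      linear_combination this
    have exu : D2 (D1 ψ) (x₀, u) = deriv B u * (2 * x₀ - 2 * e * ψ (x₀, u) * D1 ψ (x₀, u))
        - B u * (2 * e * D2 ψ (x₀, u) * D1 ψ (x₀, u) + 2 * e * ψ (x₀, u) * D2 (D1 ψ) (x₀, u)) := by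
      have hd := hasDerivAt_D2 s.at
      have hdd := hasDerivAt_D2 s.d1.at
      have hd2 := (d1 u hu).mul (((hd.const_mul (2 * e)).mul hdd).const_sub (2 * x₀))
      have heq : (fun s => D1 ψ (x₀, s)) =ᶠ[nhds u]
          fun s => B s * (2 * x₀ - 2 * e * ψ (x₀, s) * D1 ψ (x₀, s)) := by
        filter_upwards [isOpen_Ioo.mem_nhds hu] with s hs using ex s hs x₀ hx0r
      have := (hdd.congr_of_eventuallyEq heq.symm).unique hd2
      simp only [Pi.mul_apply] at this
      linear_combination this
    have euu : D2 (D2 ψ) (x₀, u) = deriv (deriv B) u * (x₀ ^ 2 - e * ψ (x₀, u) ^ 2)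
        - 4 * e * deriv B u * ψ (x₀, u) * D2 ψ (x₀, u) - 2 * e * B u * D2 ψ (x₀, u) ^ 2
        - 2 * e * B u * ψ (x₀, u) * D2 (D2 ψ) (x₀, u) := by
      have hd := hasDerivAt_D2 s.at
      have hdd := hasDerivAt_D2 s.d2.at
      have hd2 := ((d2 u hu).mul (((hd.pow 2).const_mul e).const_sub (x₀ ^ 2))).sub
        ((((d1 u hu).const_mul (2 * e)).mul hd).mul hdd)
      have heq : (fun s => D2 ψ (x₀, s)) =ᶠ[nhds u]
          fun s => deriv B s * (x₀ ^ 2 - e * ψ (x₀, s) ^ 2)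
            - 2 * e * B s * ψ (x₀, s) * D2 ψ (x₀, s) := by
        filter_upwards [isOpen_Ioo.mem_nhds hu] with s hs using eu s hs
      have := (hdd.congr_of_eventuallyEq heq.symm).unique hd2
      simp only [Pi.pow_apply, Pi.mul_apply, Nat.cast_ofNat, Nat.add_one_sub_one, pow_one] at this
      linear_combination this
    have hψ := hform u hu x₀ hx0r
    obtain ⟨N, hN⟩ : ∃ N, N = x₀ ^ 2 - e * ψ (x₀, u) ^ 2 := ⟨_, rfl⟩
    rw [← hN] at hψ hu3
    have e1 := ex u hu x₀ hx0r
    have e2 := eu u hu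
    have hz' := hz _ hball
    unfold graphZMC at hz'
    rw [← hN] at e2 euu
    rw [hψ] at hN e1 e2 exx exu euu
    refine riccati_algebra hN hu3 hx0 e1 ?_ exx exu ?_ hz'
    · linear_combination e2
    · linear_combination euu
  have hconst : ∀ u ∈ Set.Ioo (-ρ') ρ', deriv B u - B u ^ 2 = deriv B 0 - B 0 ^ 2 := by
    intro u hu
    have hd : ∀ t ∈ Set.Ioo (-ρ') ρ', HasDerivAt (fun t => deriv B t - B t ^ 2) 0 t := by
      intro t ht
      refine ((d2 t ht).sub ((d1 t ht).pow 2)).congr_deriv ?_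
      rw [hric t ht]; simp
    exact isOpen_Ioo.is_const_of_deriv_eq_zero isPreconnected_Ioo
      (fun t ht => (hd t ht).differentiableAt.differentiableWithinAt)
      (fun t ht => (hd t ht).deriv) hu ⟨by linarith, hρ'0⟩
  refine ⟨ρ', hρ'0, min_le_right _ _, deriv B 0 - B 0 ^ 2, fun u hu => ?_⟩
  have h2 : HasDerivAt B (a u ^ 2 + (deriv B 0 - B 0 ^ 2)) u := by
    rw [← hBa u hu, ← hconst u hu]
    refine (d1 u hu).congr_deriv (by ring)
  refine h2.congr_of_eventuallyEq ?_
  filter_upwards [isOpen_Ioo.mem_nhds hu] with s hs using (hBa s hs).symm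

/-- An equation of the leaf `q = ψ(x)`, tangent to the `x`-axis at the origin, in which only `q` and
the quadratic form `x² - e q²` occur. -/
theorem conic_coeff {e r a b b' d : ℝ} {f : ℝ → ℝ} (hr : 0 < r) (hne : a ≠ 0 ∨ b ≠ 0 ∨ b' ≠ 0)
    (h0 : f 0 = 0) (h1 : HasDerivAt f 0 0)
    (h : ∀ x, |x| < r → a * (x ^ 2 - e * f x ^ 2) + b * x + b' * f x + d = 0) :
    d = 0 ∧ b = 0 ∧ b' ≠ 0 := by
  have hd : d = 0 := by
    have := h 0 (by simpa using hr)
    rw [h0] at this; linarith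
  have hev : ∀ᶠ x in nhds (0 : ℝ), |x| < r :=
    (continuous_abs.tendsto 0).eventually_lt_const (by simpa using hr)
  have hb : b = 0 := by
    have h2 := ((((hasDerivAt_id (0 : ℝ)).pow 2).sub ((h1.pow 2).const_mul e)).const_mul a).add
      (((hasDerivAt_id (0 : ℝ)).const_mul b).add ((h1.const_mul b').add_const d))
    have h3 := h2.unique ((hasDerivAt_const (0 : ℝ) (0 : ℝ)).congr_of_eventuallyEq (by
      filter_upwards [hev] with x hx
      have := h x hx
      simp only [Pi.add_apply, Pi.sub_apply, Pi.pow_apply, id]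
      linarith))
    simpa using h3
  refine ⟨hd, hb, fun hb' => ?_⟩
  have ha : a ≠ 0 := by
    rcases hne with h' | h' | h'
    · exact h'
    · exact absurd hb h'
    · exact absurd hb' h'
  obtain ⟨δ, hδ, hball⟩ := Metric.eventually_nhds_iff_ball.1
    ((eventually_sq_lt_of_deriv_eq_zero e h1 h0).and hev)
  have hx : δ / 2 ∈ Metric.ball (0 : ℝ) δ := by
    rw [mem_ball_zero_iff, Real.norm_eq_abs, abs_of_pos (by positivity)]; linarith
  obtain ⟨h2, h3⟩ := hball _ hx
  have h4 := h2 (by positivity)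
  have h5 := h _ h3
  rw [hb, hb', hd] at h5
  have h6 : a * ((δ / 2) ^ 2 - e * f (δ / 2) ^ 2) = 0 := by linarith
  exact (mul_ne_zero ha h4.ne') h6

variable {S : Type*} [TopologicalSpace S] [ChartedSpace E2 S]

/-- The differential of `ψ` vanishes at a point where the tangent plane is orthogonal to `n`. -/
theorem IsGraphOn.derivs_eq_zero [IsManifold (𝓡 2) ∞ S] {X : S → L3} {v n m c : L3} {e r : ℝ}
    {Ω : Set S} {ψ : ℝ × ℝ → ℝ} (h : IsGraphOn X v n m c e Ω r ψ)
    (hf : NullFrame v n m) (hX : ContMDiff (𝓡 2) 𝓘(ℝ, L3) ∞ X) {z : S}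
    (hinj : Function.Injective (dX X z)) (hz : z ∈ Ω) (ht : ∀ w, lorentz (dX X z w) n = 0) :
    D1 ψ (base X v n m c e z) = 0 ∧ D2 ψ (base X v n m c e z) = 0 := by
  have hn : IsNormalAt X z n := ⟨hinj, hf.n_ne, ht⟩
  have ha := h.isNormalAt hf hX hinj hz
  obtain ⟨w1, hw1⟩ := hn.exists_preimage hf.vn
  obtain ⟨w2, hw2⟩ := hn.exists_preimage hf.nn
  have h1 := ha.orth w1
  have h2 := ha.orth w2
  rw [hw1] at h1
  rw [hw2] at h2
  simp only [graphNormal, lorentz_add_right, lorentz_smul_right, hf.vv, hf.vm, hf.vn, hf.nv, hf.nm,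
    hf.nn] at h1 h2
  exact ⟨by linarith, by linarith⟩

theorem IsOneSidedFoliated.graphDet_oneSided [IsManifold (𝓡 2) ∞ S] {X : S → L3}
    {ℓ : L3 →ₗ[ℝ] ℝ} (h : IsOneSidedFoliated X ℓ) {v n m c : L3} {e r : ℝ}
    {Ω : Set S} {ψ : ℝ × ℝ → ℝ} (hg : IsGraphOn X v n m c e Ω r ψ) (hf : NullFrame v n m) :
    (∀ y ∈ Metric.ball (0 : ℝ × ℝ) r, 0 ≤ graphDet e ψ y) ∨
      ∀ y ∈ Metric.ball (0 : ℝ × ℝ) r, graphDet e ψ y ≤ 0 := by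
  refine h.oneSided.imp ?_ ?_ <;> intro h' y hy <;> obtain ⟨z, hz, rfl⟩ := hg.surj y hy
  · have := h' z
    rw [hg.timelikeAt_iff hf h.smooth (h.inj z) hz] at this
    exact not_lt.1 this
  · have := h' z
    rw [hg.spacelikeAt_iff hf h.smooth (h.inj z) hz] at this
    exact not_lt.1 this

/-- Along the null direction through a lightlike point of a one-sided surface, the surface contains
a null segment with constant tangent plane. -/
theorem IsOneSidedFoliated.derivs_eq_zero_segment [IsManifold (𝓡 2) ∞ S] {X : S → L3}
    {ℓ : L3 →ₗ[ℝ] ℝ} (h : IsOneSidedFoliated X ℓ) {v n m : L3} {e r : ℝ}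
    {Ω : Set S} {ψ : ℝ × ℝ → ℝ} {z : S} (hg : IsGraphOn X v n m (X z) e Ω r ψ)
    (hf : NullFrame v n m) (hz : z ∈ Ω) (ht : ∀ w, lorentz (dX X z w) n = 0) :
    ∃ ρ > 0, ρ < r ∧ ∀ u ∈ Set.Icc (-ρ) ρ, ψ (0, u) = 0 ∧ D1 ψ (0, u) = 0 ∧ D2 ψ (0, u) = 0 := by
  have hb0 : base X v n m (X z) e z = (0, 0) := by
    simp [base, coordX, coordU, lorentz_zero_left]
  have h0b : (0 : ℝ × ℝ) ∈ Metric.ball (0 : ℝ × ℝ) r := Metric.mem_ball_self hg.pos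
  obtain ⟨h1, h2⟩ := hg.derivs_eq_zero hf h.smooth (h.inj z) hz ht
  rw [hb0] at h1 h2
  have hψ0 : ψ (0, 0) = 0 := by
    have := hg.eq z hz
    change _ = ψ (base X v n m (X z) e z) at this
    rw [hb0] at this
    rw [← this]; simp [coordQ, lorentz_zero_left]
  -- the determinant of the metric has a local extremum
  have hdet0 : graphDet e ψ (0, 0) = 0 := by simp [graphDet, h1, h2]
  have h12 : D2 (D1 ψ) (0, 0) = 0 := by
    have hd := hasDerivAt_graphDet_fst (e := e) (hg.smooth _ h0b : ContDiffAt ℝ ∞ ψ (0, 0))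
    have hext : IsLocalExtr (fun s => graphDet e ψ (s, 0)) (0 : ℝ) := by
      have hev : ∀ᶠ s in nhds (0 : ℝ), (s, (0 : ℝ)) ∈ Metric.ball (0 : ℝ × ℝ) r := by
        have : ContinuousAt (fun s : ℝ => (s, (0 : ℝ))) 0 := by fun_prop
        exact this.eventually (Metric.isOpen_ball.mem_nhds h0b)
      refine (h.graphDet_oneSided hg hf).imp ?_ ?_ <;> intro h'
      · filter_upwards [hev] with s hs
        rw [hdet0]; exact h' _ hs
      · filter_upwards [hev] with s hs
        rw [hdet0]; exact h' _ hs
    have := hext.hasDerivAt_eq_zero hd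
    rw [h1, h2] at this
    linarith
  obtain ⟨ρ, hρ, hρr, hline⟩ := graph_contains_null_line hg.pos hg.smooth
    (fun y hy => hg.graphZMC_eq_zero hf h.smooth h.inj h.zmc hy) h1 h2 h12
  refine ⟨ρ, hρ, hρr, fun u hu => ⟨?_, hline u hu⟩⟩
  have hd : ∀ t ∈ Set.Icc (-ρ) ρ, HasDerivAt (fun s => ψ (0, s)) 0 t := by
    intro t ht
    have := hasDerivAt_D2 (hg.smooth (0, t) (mem_ball_pair (by simpa using hg.pos)
      ((abs_le.2 ht).trans_lt hρr)))
    rwa [(hline t ht).2] at this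
  exact eq_zero_of_norm_deriv_le (f := fun s => ψ (0, s)) (f' := fun _ => 0) (K := 0) hd
    (by simp) hψ0 u hu

/-- The local normal form near a lightlike point: the surface contains a null segment through the
point and is the union of the conics `q = A(u)(x² - e q²)` in the planes `ℓ = u`, where `A`
satisfies a Riccati equation. -/
theorem IsOneSidedFoliated.exists_normal_form [IsManifold (𝓡 2) ∞ S] {X : S → L3}
    {ℓ : L3 →ₗ[ℝ] ℝ} (h : IsOneSidedFoliated X ℓ) {v n m : L3} {e : ℝ} (ha : IsAdapted ℓ v n m e)
    {z₀ : S} (ht : ∀ w, lorentz (dX X z₀ w) n = 0) :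
    ∃ ρ > 0, ∃ (A : ℝ → ℝ) (k : ℝ), (∀ u ∈ Set.Ioo (-ρ) ρ, HasDerivAt A (A u ^ 2 + k) u) ∧
      (∀ u ∈ Set.Ioo (-ρ) ρ, ∃ z, X z = X z₀ + u • n ∧ ∀ w, lorentz (dX X z w) n = 0) ∧
      ∀ z, ℓ (X z) - ℓ (X z₀) ∈ Set.Ioo (-ρ) ρ →
        coordQ n (X z₀) (X z) = A (ℓ (X z) - ℓ (X z₀)) * coordN v n (X z₀) e (X z) := by
  have hf := ha.frame
  obtain ⟨Ω, r, ψ, hz₀, hg⟩ := exists_isGraphOn h.smooth (h.inj z₀) hf e ht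
  obtain ⟨ρ, hρ, hρr, hline⟩ := h.derivs_eq_zero_segment hg hf hz₀ ht
  have hsub : ∀ u ∈ Set.Ioo (-ρ) ρ, u ∈ Set.Icc (-ρ) ρ ∧ |u| < r := fun u hu =>
    ⟨Set.Ioo_subset_Icc_self hu, (abs_lt.2 hu).trans hρr⟩
  have hseg : ∀ u ∈ Set.Ioo (-ρ) ρ,
      ∃ z, X z = X z₀ + u • n ∧ ∀ w, lorentz (dX X z w) n = 0 := by
    intro u hu
    obtain ⟨hu1, hu2⟩ := hsub u hu
    obtain ⟨z, hz, hzb⟩ := hg.surj (0, u) (mem_ball_pair (by simpa using hg.pos) hu2)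
    have hq := hg.eq z hz
    rw [hzb, (hline u hu1).1] at hq
    have hx : coordX v (X z₀) (X z) = 0 := congrArg Prod.fst hzb
    have hu' : coordU n m e (X z₀) (X z) = u := congrArg Prod.snd hzb
    refine ⟨z, ?_, fun w => ?_⟩
    · have h1 := hf.expand (X z - X z₀)
      unfold coordX at hx
      unfold coordU at hu'
      unfold coordQ at hq
      rw [hq, mul_zero, add_zero] at hu'
      rw [hx, hq, hu', zero_smul, zero_smul, zero_add, add_zero] at h1
      rw [← h1]; abel
    · have := (hg.isNormalAt hf h.smooth (h.inj z) hz).orth w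
      rw [show base X v n m (X z₀) e z = (0, u) from hzb] at this
      simp only [graphNormal, (hline u hu1).2.1, (hline u hu1).2.2, mul_zero, zero_smul, zero_add,
        zero_sub, lorentz_smul_right] at this
      linarith
  have hcon : ∀ u ∈ Set.Ioo (-ρ) ρ, ∃ a : ℝ, ∀ z, ℓ (X z) - ℓ (X z₀) = u →
      coordQ n (X z₀) (X z) = a * coordN v n (X z₀) e (X z) := by
    intro u hu
    obtain ⟨hu1, hu2⟩ := hsub u hu
    obtain ⟨z₁, hz₁, -⟩ := hseg u hu
    have hu0 : ℓ (X z₁) - ℓ (X z₀) = u := by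
      rw [hz₁, map_add, map_smul, ha.height_n]; simp
    obtain ⟨a, b, b', d, hne, heq⟩ := exists_conic (c := X z₀) (e := e) (u := u) hf (h.leaves z₁)
      (fun P hP => by
        obtain ⟨z, hz, rfl⟩ := hP
        rw [ha.coordU_eq, ← hu0]
        exact congrArg (· - _) hz)
    have hψ : ∀ x, |x| < r → a * (x ^ 2 - e * ψ (x, u) ^ 2) + b * x + b' * ψ (x, u) + d = 0 := by
      intro x hx
      obtain ⟨z, hz, hzb⟩ := hg.surj (x, u) (mem_ball_pair hx hu2)
      have hx' : coordX v (X z₀) (X z) = x := congrArg Prod.fst hzb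
      have hu' : coordU n m e (X z₀) (X z) = u := congrArg Prod.snd hzb
      have hq := hg.eq z hz
      rw [hzb] at hq
      have := heq (X z) ⟨z, by
        rw [ha.coordU_eq] at hu'
        change ℓ (X z) = ℓ (X z₁)
        linarith, rfl⟩
      unfold coordN at this
      rwa [hx', hq] at this
    have hd := hasDerivAt_D1 (hg.smooth (0, u) (mem_ball_pair (by simpa using hg.pos) hu2))
    rw [(hline u hu1).2.1] at hd
    obtain ⟨hd0, hb0, hb'⟩ := conic_coeff (f := fun x => ψ (x, u)) hg.pos hne (hline u hu1).1 hd hψ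
    refine ⟨-a / b', fun z hz => ?_⟩
    have := heq (X z) ⟨z, by change ℓ (X z) = ℓ (X z₁); linarith, rfl⟩
    rw [hd0, hb0] at this
    field_simp
    linarith
  choose! A hA using hcon
  have hAψ : ∀ u ∈ Set.Ioo (-ρ) ρ, ∀ x, |x| < r →
      ψ (x, u) = A u * (x ^ 2 - e * ψ (x, u) ^ 2) := by
    intro u hu x hx
    obtain ⟨hu1, hu2⟩ := hsub u hu
    obtain ⟨z, hz, hzb⟩ := hg.surj (x, u) (mem_ball_pair hx hu2)
    have hx' : coordX v (X z₀) (X z) = x := congrArg Prod.fst hzb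
    have hu' : coordU n m e (X z₀) (X z) = u := congrArg Prod.snd hzb
    have hq := hg.eq z hz
    rw [hzb] at hq
    have := hA u hu z (by rw [← ha.coordU_eq]; exact hu')
    unfold coordN at this
    rwa [hx', hq] at this
  have h00 : (0 : ℝ) ∈ Set.Icc (-ρ) ρ := ⟨by linarith, hρ.le⟩
  obtain ⟨ρ', hρ', hρ'ρ, k, hk⟩ := hasDerivAt_of_conic_leaves hρ hρr hg.smooth
    (fun y hy => hg.graphZMC_eq_zero hf h.smooth h.inj h.zmc hy) (hline 0 h00).1 (hline 0 h00).2.1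
    hAψ
  have hss : ∀ u ∈ Set.Ioo (-ρ') ρ', u ∈ Set.Ioo (-ρ) ρ := fun u hu =>
    ⟨by linarith [hu.1], by linarith [hu.2]⟩
  exact ⟨ρ', hρ', A, k, hk, fun u hu => hseg u (hss u hu), fun z hz => hA _ (hss _ hz) z rfl⟩

end

/-! ### Graphs whose leaves are hyperbolas with null asymptotes -/

theorem hasDerivAt_deriv_of_contDiffOn {a b : ℝ} {f : ℝ → ℝ} (h : ContDiffOn ℝ ∞ f (Set.Ioo a b))
    {u : ℝ} (hu : u ∈ Set.Ioo a b) :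
    HasDerivAt f (deriv f u) u ∧ HasDerivAt (deriv f) (deriv (deriv f) u) u := by
  have hd := (contDiffOn_infty_iff_deriv_of_isOpen isOpen_Ioo).1 h
  exact ⟨(hd.1.differentiableAt (isOpen_Ioo.mem_nhds hu)).hasDerivAt,
    ((hd.2.differentiableOn (by simp)).differentiableAt (isOpen_Ioo.mem_nhds hu)).hasDerivAt⟩

/-- A solution of a linear differential inequality which tends to zero at the left end of the
interval vanishes. -/
theorem eq_zero_of_tendsto_of_norm_deriv_le {E : Type*} [NormedAddCommGroup E] [NormedSpace ℝ E]
    {f f' : ℝ → E} {a b K : ℝ} (hd : ∀ x ∈ Set.Ioo a b, HasDerivAt f (f' x) x)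
    (hb : ∀ x ∈ Set.Ioo a b, ‖f' x‖ ≤ K * ‖f x‖)
    (h0 : Filter.Tendsto f (nhdsWithin a (Set.Ioi a)) (nhds 0)) :
    ∀ x ∈ Set.Ioo a b, f x = 0 := by
  intro x hx
  have h1 : ∀ᶠ y in nhdsWithin a (Set.Ioi a), ‖f x‖ ≤ ‖f y‖ * Real.exp (K * (x - y)) := by
    filter_upwards [Ioo_mem_nhdsGT hx.1] with y hy
    have hsub : ∀ t ∈ Set.Icc y x, t ∈ Set.Ioo a b := fun t ht =>
      ⟨hy.1.trans_le ht.1, ht.2.trans_lt hx.2⟩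
    have := norm_le_gronwallBound_of_norm_deriv_right_le (f := f) (f' := f') (δ := ‖f y‖) (K := K)
      (ε := 0) (a := y) (b := x)
      (fun t ht => (hd t (hsub t ht)).continuousAt.continuousWithinAt)
      (fun t ht => (hd t (hsub t (Set.Ico_subset_Icc_self ht))).hasDerivWithinAt) le_rfl
      (fun t ht => by rw [add_zero]; exact hb t (hsub t (Set.Ico_subset_Icc_self ht)))
      x ⟨hy.2.le, le_rfl⟩
    rwa [gronwallBound_ε0] at this
  have h2 : Filter.Tendsto (fun y => ‖f y‖ * Real.exp (K * (x - y))) (nhdsWithin a (Set.Ioi a))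
      (nhds (0 * Real.exp (K * (x - a)))) := by
    refine Filter.Tendsto.mul (by simpa using h0.norm) ?_
    have : Continuous fun y => Real.exp (K * (x - y)) := by fun_prop
    exact (this.tendsto a).mono_left nhdsWithin_le_nhds
  rw [zero_mul] at h2
  exact norm_le_zero_iff.1 (ge_of_tendsto h2 h1)

/-- If the curves `x = const` of a graph of zero mean curvature are the hyperbolas
`q = B + κ p / (1 + g p)`, then the zero mean curvature equation splits into three ordinary
differential equations. -/
theorem mobius_leaves_equations {a b r : ℝ} {ψ : ℝ × ℝ → ℝ} {B κ g : ℝ → ℝ}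
    (hab : Set.Ioo a b ⊆ Set.Ioo (-r) r)
    (hs : ∀ y ∈ Metric.ball (0 : ℝ × ℝ) r, ContDiffAt ℝ ∞ ψ y)
    (hz : ∀ y ∈ Metric.ball (0 : ℝ × ℝ) r, graphZMC 0 ψ y = 0)
    (hB : ContDiffOn ℝ ∞ B (Set.Ioo a b)) (hκ : ContDiffOn ℝ ∞ κ (Set.Ioo a b))
    (hg : ContDiffOn ℝ ∞ g (Set.Ioo a b)) (hκ0 : ∀ x ∈ Set.Ioo a b, κ x ≠ 0)
    (h : ∀ x ∈ Set.Ioo a b, ∀ p, |p| < r → (ψ (x, p) - B x) * (1 + g x * p) = κ x * p)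
    {x : ℝ} (hx : x ∈ Set.Ioo a b) :
    -2 * g x * κ x - deriv B x * deriv κ x + κ x * deriv (deriv B) x = 0 ∧
    2 * g x ^ 2 * κ x + 2 * deriv B x * κ x * deriv g x - deriv κ x ^ 2
      + κ x * deriv (deriv κ) x = 0 ∧
    deriv κ x * deriv g x = κ x * deriv (deriv g) x := by
  have hr : 0 < r := by have := hab hx; linarith [this.1, this.2]
  set T : ℝ → ℝ → ℝ := fun s p => p / (1 + g s * p) with hT
  -- the zero mean curvature equation is a quadratic polynomial in `t = p / (1 + g p)`
  have key : ∀ p, |p| < r → 1 + g x * p ≠ 0 →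
      (-2 * g x * κ x - deriv B x * deriv κ x + κ x * deriv (deriv B) x) +
      (2 * g x ^ 2 * κ x + 2 * deriv B x * κ x * deriv g x - deriv κ x ^ 2
        + κ x * deriv (deriv κ) x) * T x p +
      κ x * (deriv κ x * deriv g x - κ x * deriv (deriv g) x) * T x p ^ 2 = 0 := by
    intro p hp hp0
    have hball : ∀ s ∈ Set.Ioo a b, ∀ p', |p'| < r → SmoothNear ψ (s, p') := fun s hs' p' hp' =>
      smoothNear_of_ball hs (mem_ball_pair (abs_lt.2 (hab hs')) hp')
    have hgc : ContinuousAt g x := (hasDerivAt_deriv_of_contDiffOn hg hx).1.continuousAt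
    have evs : ∀ᶠ s in nhds x, s ∈ Set.Ioo a b ∧ 1 + g s * p ≠ 0 :=
      Filter.Eventually.and (isOpen_Ioo.mem_nhds hx)
        ((continuousAt_const.add (hgc.mul continuousAt_const)).eventually_ne hp0)
    have evp : ∀ᶠ p' in nhds p, |p'| < r ∧ 1 + g x * p' ≠ 0 := by
      refine ((continuous_abs.tendsto p).eventually_lt_const hp).and ?_
      have : Continuous fun p' => 1 + g x * p' := by fun_prop
      exact this.continuousAt.eventually_ne hp0
    have form : ∀ s p', s ∈ Set.Ioo a b → |p'| < r → 1 + g s * p' ≠ 0 →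
        ψ (s, p') = B s + κ s * T s p' := by
      intro s p' h1 h2 h3
      have := h s h1 p' h2
      rw [← eq_div_iff h3] at this
      simp only [hT]
      linear_combination this
    have dTp : ∀ p', 1 + g x * p' ≠ 0 →
        HasDerivAt (fun p' => T x p') ((1 - g x * T x p') ^ 2) p' := by
      intro p' h2
      have := (hasDerivAt_id p').div (((hasDerivAt_id p').const_mul (g x)).const_add 1) h2
      refine this.congr_deriv ?_
      simp only [hT, id]
      field_simp
      ring
    have f1 : ∀ s ∈ Set.Ioo a b, ∀ p', |p'| < r → 1 + g s * p' ≠ 0 →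
        (HasDerivAt (fun s => T s p') (-deriv g s * T s p' ^ 2) s) → D1 ψ (s, p') =
        deriv B s + deriv κ s * T s p' - κ s * deriv g s * T s p' ^ 2 := by
      intro s h1 p' hp' h2 hdT
      have hd := hasDerivAt_D1 (hball s h1 p' hp').at
      have hd2 := (hasDerivAt_deriv_of_contDiffOn hB h1).1.add
        ((hasDerivAt_deriv_of_contDiffOn hκ h1).1.mul hdT)
      have hgc' : ContinuousAt g s := (hasDerivAt_deriv_of_contDiffOn hg h1).1.continuousAt
      have heq : (fun s => ψ (s, p')) =ᶠ[nhds s] fun s => B s + κ s * T s p' := by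
        filter_upwards [isOpen_Ioo.mem_nhds h1, (continuousAt_const.add
          (hgc'.mul (continuousAt_const (y := p')))).eventually_ne h2] with s' h3 h4
        exact form s' p' h3 hp' h4
      have := (hd.congr_of_eventuallyEq heq.symm).unique hd2
      linear_combination this
    have dTs' : ∀ s ∈ Set.Ioo a b, ∀ p', 1 + g s * p' ≠ 0 →
        HasDerivAt (fun s => T s p') (-deriv g s * T s p' ^ 2) s := by
      intro s h1 p' h2
      have := (hasDerivAt_const s p').div
        (((hasDerivAt_deriv_of_contDiffOn hg h1).1.mul_const p').const_add 1) h2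
      refine this.congr_deriv ?_
      simp only [hT]
      field_simp
      ring
    have f11 : D1 (D1 ψ) (x, p) = deriv (deriv B) x + deriv (deriv κ) x * T x p
        - 2 * deriv κ x * deriv g x * T x p ^ 2 - κ x * deriv (deriv g) x * T x p ^ 2
        + 2 * κ x * deriv g x ^ 2 * T x p ^ 3 := by
      have hd := hasDerivAt_D1 (hball x hx p hp).d1.at
      have hdT := dTs' x hx p hp0
      have hd2 := ((hasDerivAt_deriv_of_contDiffOn hB hx).2.add
        ((hasDerivAt_deriv_of_contDiffOn hκ hx).2.mul hdT)).sub
        (((hasDerivAt_deriv_of_contDiffOn hκ hx).1.mul (hasDerivAt_deriv_of_contDiffOn hg hx).2).mul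
          (hdT.pow 2))
      have heq : (fun s => D1 ψ (s, p)) =ᶠ[nhds x]
          fun s => deriv B s + deriv κ s * T s p - κ s * deriv g s * T s p ^ 2 := by
        filter_upwards [evs] with s hs'
        exact f1 s hs'.1 p hp hs'.2 (dTs' s hs'.1 p hs'.2)
      have := (hd.congr_of_eventuallyEq heq.symm).unique hd2
      simp only [Pi.mul_apply, Pi.pow_apply, Nat.cast_ofNat, Nat.add_one_sub_one, pow_one] at this
      linear_combination this
    have f12 : D2 (D1 ψ) (x, p) =
        (deriv κ x - 2 * κ x * deriv g x * T x p) * (1 - g x * T x p) ^ 2 := by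
      have hd := hasDerivAt_D2 (hball x hx p hp).d1.at
      have hdT := dTp p hp0
      have hd2 := ((hdT.const_mul (deriv κ x)).const_add (deriv B x)).sub
        ((hdT.pow 2).const_mul (κ x * deriv g x))
      have heq : (fun p' => D1 ψ (x, p')) =ᶠ[nhds p]
          fun p' => deriv B x + deriv κ x * T x p' - κ x * deriv g x * T x p' ^ 2 := by
        filter_upwards [evp] with p' hp'
        exact f1 x hx p' hp'.1 hp'.2 (dTs' x hx p' hp'.2)
      have := (hd.congr_of_eventuallyEq heq.symm).unique hd2
      simp only [Nat.cast_ofNat, Nat.add_one_sub_one, pow_one] at this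
      linear_combination this
    have f2 : ∀ p', |p'| < r → 1 + g x * p' ≠ 0 →
        D2 ψ (x, p') = κ x * (1 - g x * T x p') ^ 2 := by
      intro p' hp' h2
      have hd := hasDerivAt_D2 (hball x hx p' hp').at
      have hd2 := ((dTp p' h2).const_mul (κ x)).const_add (B x)
      have heq : (fun p' => ψ (x, p')) =ᶠ[nhds p'] fun p' => B x + κ x * T x p' := by
        have hc : Continuous fun p' => 1 + g x * p' := by fun_prop
        filter_upwards [(continuous_abs.tendsto p').eventually_lt_const hp',
          hc.continuousAt.eventually_ne h2] with p'' h3 h4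
        exact form x p'' hx h3 h4
      exact (hd.congr_of_eventuallyEq heq.symm).unique hd2
    have f22 : D2 (D2 ψ) (x, p) = -2 * κ x * g x * (1 - g x * T x p) ^ 3 := by
      have hd := hasDerivAt_D2 (hball x hx p hp).d2.at
      have hd2 := ((((dTp p hp0).const_mul (g x)).const_sub 1).pow 2).const_mul (κ x)
      have heq : (fun p' => D2 ψ (x, p')) =ᶠ[nhds p]
          fun p' => κ x * (1 - g x * T x p') ^ 2 := by
        filter_upwards [evp] with p' hp' using f2 p' hp'.1 hp'.2
      have := (hd.congr_of_eventuallyEq heq.symm).unique hd2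
      simp only [Nat.cast_ofNat, Nat.add_one_sub_one, pow_one] at this
      linear_combination this
    have hz' := hz _ (mem_ball_pair (abs_lt.2 (hab hx)) hp)
    unfold graphZMC at hz'
    rw [f22, f12, f11, f2 p hp hp0, f1 x hx p hp hp0 (dTs' x hx p hp0)] at hz'
    have hu : (1 - g x * T x p) ^ 2 ≠ 0 := by
      apply pow_ne_zero
      have : 1 - g x * T x p = 1 / (1 + g x * p) := by
        simp only [hT]; field_simp; ring
      rw [this]
      exact one_div_ne_zero hp0
    refine (mul_eq_zero.1 ?_).resolve_left hu
    linear_combination hz'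
  obtain ⟨ε, hε, hεr, hεg⟩ : ∃ ε > 0, ε < r ∧ ε * |g x| < 1 := by
    refine ⟨min (r / 2) (1 / (2 * (1 + |g x|))), by positivity,
      (min_le_left _ _).trans_lt (by linarith), ?_⟩
    have h1 : min (r / 2) (1 / (2 * (1 + |g x|))) * |g x| ≤ 1 / (2 * (1 + |g x|)) * |g x| :=
      mul_le_mul_of_nonneg_right (min_le_right _ _) (abs_nonneg _)
    refine h1.trans_lt ?_
    rw [one_div_mul_eq_div, div_lt_one (by positivity)]
    linarith [abs_nonneg (g x)]
  have hεg' := abs_lt.1 (show |g x * ε| < 1 by rwa [abs_mul, abs_of_pos hε, mul_comm])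
  have k0 := key 0 (by simpa using hr) (by simp)
  have k1 := key ε (by rwa [abs_of_pos hε]) (by linarith)
  have k2 := key (-ε) (by rwa [abs_neg, abs_of_pos hε]) (by linarith)
  have hT0 : T x 0 = 0 := by simp [hT]
  have hT1 : 0 < T x ε := div_pos hε (by linarith)
  have hT2 : T x (-ε) < 0 := div_neg_of_neg_of_pos (by linarith) (by linarith)
  rw [hT0] at k0
  simp only [mul_zero, ne_eq, OfNat.ofNat_ne_zero, not_false_eq_true, zero_pow, add_zero] at k0
  rw [k0, zero_add] at k1 k2
  obtain ⟨c1, hc1⟩ : ∃ c, c = 2 * g x ^ 2 * κ x + 2 * deriv B x * κ x * deriv g x - deriv κ x ^ 2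
      + κ x * deriv (deriv κ) x := ⟨_, rfl⟩
  obtain ⟨c2, hc2⟩ : ∃ c, c = deriv κ x * deriv g x - κ x * deriv (deriv g) x := ⟨_, rfl⟩
  rw [← hc1, ← hc2] at k1 k2
  have e1 : c1 + κ x * c2 * T x ε = 0 := by
    refine (mul_eq_zero.1 ?_).resolve_left hT1.ne'
    linear_combination k1
  have e2 : c1 + κ x * c2 * T x (-ε) = 0 := by
    refine (mul_eq_zero.1 ?_).resolve_left hT2.ne
    linear_combination k2
  have hc2' : c2 = 0 := by
    have : κ x * c2 * (T x ε - T x (-ε)) = 0 := by linear_combination e1 - e2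
    rcases mul_eq_zero.1 this with h3 | h3
    · exact (mul_eq_zero.1 h3).resolve_left (hκ0 x hx)
    · linarith
  refine ⟨k0, ?_, by linarith⟩
  rw [← hc1]
  rw [hc2'] at e1
  linarith

/-- The three ordinary differential equations for `B`, `κ`, `g` integrate to a linear system for
`(κ, g)`, so that `κ` cannot be non-zero if `(κ, g)` tends to zero at the end of the interval. -/
theorem mobius_leaves_false {a b K₁ K₂ : ℝ} (hlt : a < b) {B κ g : ℝ → ℝ}
    (hB : ContDiffOn ℝ ∞ B (Set.Ioo a b)) (hκ : ContDiffOn ℝ ∞ κ (Set.Ioo a b))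
    (hg : ContDiffOn ℝ ∞ g (Set.Ioo a b)) (hκ0 : ∀ x ∈ Set.Ioo a b, κ x ≠ 0)
    (hB1 : ∀ x ∈ Set.Ioo a b, |B x| ≤ K₁) (hB2 : ∀ x ∈ Set.Ioo a b, |deriv B x| ≤ K₂)
    (heq : ∀ x ∈ Set.Ioo a b,
      -2 * g x * κ x - deriv B x * deriv κ x + κ x * deriv (deriv B) x = 0 ∧
      2 * g x ^ 2 * κ x + 2 * deriv B x * κ x * deriv g x - deriv κ x ^ 2
        + κ x * deriv (deriv κ) x = 0 ∧
      deriv κ x * deriv g x = κ x * deriv (deriv g) x)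
    (hκl : Filter.Tendsto κ (nhdsWithin a (Set.Ioi a)) (nhds 0))
    (hgl : Filter.Tendsto g (nhdsWithin a (Set.Ioi a)) (nhds 0)) : False := by
  have hmid : (a + b) / 2 ∈ Set.Ioo a b := ⟨by linarith, by linarith⟩
  have const : ∀ f : ℝ → ℝ, (∀ x ∈ Set.Ioo a b, HasDerivAt f 0 x) →
      ∀ x ∈ Set.Ioo a b, f x = f ((a + b) / 2) := fun f hf x hx =>
    isOpen_Ioo.is_const_of_deriv_eq_zero isPreconnected_Ioo
      (fun t ht => (hf t ht).differentiableAt.differentiableWithinAt)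
      (fun t ht => (hf t ht).deriv) hx hmid
  obtain ⟨ν, hν⟩ : ∃ ν, ∀ x ∈ Set.Ioo a b, deriv g x = -ν * κ x := by
    refine ⟨-(deriv g ((a + b) / 2) / κ ((a + b) / 2)), fun x hx => ?_⟩
    have := const (fun x => deriv g x / κ x) (fun t ht => by
      refine ((hasDerivAt_deriv_of_contDiffOn hg ht).2.div
        (hasDerivAt_deriv_of_contDiffOn hκ ht).1 (hκ0 t ht)).congr_deriv ?_
      rw [div_eq_zero_iff]
      left
      linarith [(heq t ht).2.2]) x hx
    rw [neg_neg, ← this, div_mul_cancel₀ _ (hκ0 x hx)]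
  obtain ⟨C, hC⟩ : ∃ C, ∀ x ∈ Set.Ioo a b, deriv κ x = (ν * B x + C) * κ x - deriv B x * g x := by
    refine ⟨(deriv κ ((a + b) / 2) + g ((a + b) / 2) * deriv B ((a + b) / 2)) / κ ((a + b) / 2)
      - ν * B ((a + b) / 2), fun x hx => ?_⟩
    have := const (fun x => (deriv κ x + g x * deriv B x) / κ x - ν * B x) (fun t ht => by
      obtain ⟨k1, k2⟩ := hasDerivAt_deriv_of_contDiffOn hκ ht
      obtain ⟨g1, -⟩ := hasDerivAt_deriv_of_contDiffOn hg ht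
      obtain ⟨b1, b2⟩ := hasDerivAt_deriv_of_contDiffOn hB ht
      refine (((k2.add (g1.mul b2)).div k1 (hκ0 t ht)).sub (b1.const_mul ν)).congr_deriv ?_
      obtain ⟨q0, q1, -⟩ := heq t ht
      have hνt := hν t ht
      have hk := hκ0 t ht
      simp only [Pi.add_apply, Pi.mul_apply]
      rw [hνt] at q1 ⊢
      rw [sub_eq_zero, div_eq_iff (pow_ne_zero 2 hk)]
      linear_combination q1 + g t * q0) x hx
    have hk := hκ0 x hx
    rw [← this]
    field_simp
    ring
  have hz := eq_zero_of_tendsto_of_norm_deriv_le (f := fun x => (κ x, g x))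
    (f' := fun x => (deriv κ x, deriv g x)) (a := a) (b := b)
    (K := (|ν| * K₁ + |C|) + K₂ + |ν|)
    (fun x hx => (hasDerivAt_deriv_of_contDiffOn hκ hx).1.prodMk
      (hasDerivAt_deriv_of_contDiffOn hg hx).1)
    (fun x hx => by
      have b1 := hB1 x hx
      have b2 := hB2 x hx
      have n1 : |κ x| ≤ ‖(κ x, g x)‖ := norm_fst_le (κ x, g x)
      have n2 : |g x| ≤ ‖(κ x, g x)‖ := norm_snd_le (κ x, g x)
      set M := ‖(κ x, g x)‖
      have hM : 0 ≤ M := norm_nonneg _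
      have hK1 : 0 ≤ K₁ := (abs_nonneg _).trans b1
      have hK2 : 0 ≤ K₂ := (abs_nonneg _).trans b2
      have h1 : |deriv κ x| ≤ ((|ν| * K₁ + |C|) + K₂) * M := by
        rw [hC x hx]
        refine (abs_sub _ _).trans ?_
        rw [abs_mul, abs_mul, add_mul]
        refine add_le_add (mul_le_mul ?_ n1 (abs_nonneg _) (by positivity))
          (mul_le_mul b2 n2 (abs_nonneg _) hK2)
        refine (abs_add_le _ _).trans (add_le_add_left ?_ _)
        rw [abs_mul]
        exact mul_le_mul_of_nonneg_left b1 (abs_nonneg _)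
      have h2 : |deriv g x| ≤ |ν| * M := by
        rw [hν x hx, abs_mul, abs_neg]
        exact mul_le_mul_of_nonneg_left n1 (abs_nonneg _)
      rw [Prod.norm_mk, Real.norm_eq_abs, Real.norm_eq_abs, max_le_iff]
      have p1 : 0 ≤ |ν| * M := by positivity
      have p2 : 0 ≤ ((|ν| * K₁ + |C|) + K₂) * M := by positivity
      constructor
      · linarith
      · linarith)
    (hκl.prodMk_nhds hgl) _ hmid
  exact hκ0 _ hmid (congrArg Prod.fst hz)

/-- Straight lines in the `(p, q)`-plane. -/
def IsPlaneLine (C : Set (ℝ × ℝ)) : Prop :=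
  ∃ a δ : ℝ × ℝ, δ ≠ 0 ∧ C = Set.range fun s : ℝ => a + s • δ

/-- Subsets of non-degenerate hyperbolas in the `(p, q)`-plane with null asymptotes. -/
def IsNullHyperbola (C : Set (ℝ × ℝ)) : Prop :=
  ∃ p₀ q₀ K : ℝ, K ≠ 0 ∧ ∀ y ∈ C, (y.1 - p₀) * (y.2 - q₀) = K

theorem eventually_abs_lt_zero {r : ℝ} (hr : 0 < r) : ∀ᶠ p in nhds (0 : ℝ), |p| < r :=
  (continuous_abs.tendsto 0).eventually_lt_const (by simpa using hr)

/-- A leaf which crosses `p = 0` as a graph with non-zero slope is a graph of a Möbius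
transformation. -/
theorem exists_mobius {f : ℝ → ℝ} {r κ : ℝ} {C : Set (ℝ × ℝ)} (hr : 0 < r)
    (hC : IsPlaneLine C ∨ IsNullHyperbola C) (hmem : ∀ p, |p| < r → (p, f p) ∈ C)
    (hd : HasDerivAt f κ 0) (hκ : κ ≠ 0) :
    ∃ g, ∀ y ∈ C, (y.2 - f 0) * (1 + g * y.1) = κ * y.1 := by
  obtain ⟨a, b, b', d, hne, heq⟩ : ∃ a b b' d : ℝ, (a ≠ 0 ∨ b ≠ 0 ∨ b' ≠ 0) ∧
      ∀ y ∈ C, a * y.1 * y.2 + b * y.1 + b' * y.2 + d = 0 := by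
    rcases hC with ⟨a, δ, hδ, rfl⟩ | ⟨p₀, q₀, K, -, hK⟩
    · refine ⟨0, δ.2, -δ.1, δ.1 * a.2 - δ.2 * a.1, Or.inr ?_, ?_⟩
      · by_contra! hc
        exact hδ (Prod.ext (by simpa using hc.2) hc.1)
      · rintro _ ⟨s, rfl⟩
        simp only [Prod.fst_add, Prod.snd_add, Prod.smul_fst, Prod.smul_snd, smul_eq_mul]
        ring
    · exact ⟨1, -q₀, -p₀, p₀ * q₀ - K, Or.inl one_ne_zero, fun y hy => by
        linear_combination hK y hy⟩
  have h0 := heq _ (hmem 0 (by simpa using hr))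
  simp only [mul_zero, zero_mul, zero_add] at h0
  have h1 : a * f 0 + b + b' * κ = 0 := by
    have h2 := ((((hasDerivAt_id (0 : ℝ)).const_mul a).mul hd).add
      ((hasDerivAt_id (0 : ℝ)).const_mul b)).add ((hd.const_mul b').add_const d)
    have h3 := h2.unique ((hasDerivAt_const (0 : ℝ) (0 : ℝ)).congr_of_eventuallyEq (by
      filter_upwards [eventually_abs_lt_zero hr] with x hx
      have := heq _ (hmem x hx)
      simp only [Pi.add_apply, Pi.mul_apply, id]
      linarith))
    simp only [id] at h3
    linarith
  have hb' : b' ≠ 0 := by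
    rintro rfl
    have ha : a ≠ 0 := by
      rintro rfl
      rcases hne with h | h | h
      · exact h rfl
      · exact h (by linarith)
      · exact h rfl
    have h3 := hd.unique ((hasDerivAt_const (0 : ℝ) (f 0)).congr_of_eventuallyEq (by
      filter_upwards [eventually_abs_lt_zero hr] with x hx
      by_cases hx0 : x = 0
      · rw [hx0]
      · have := heq _ (hmem x hx)
        simp only at this
        have h4 : a * x * (f x - f 0) = 0 := by linear_combination this - x * h1 - h0
        have := (mul_eq_zero.1 h4).resolve_left (mul_ne_zero ha hx0)
        linarith))
    exact hκ h3
  refine ⟨a / b', fun y hy => ?_⟩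
  have h2 := heq y hy
  field_simp
  linear_combination h2 - h0 - y.1 * h1

/-- A leaf which crosses `p = 0` as a graph with slope zero is a full null line. -/
theorem mem_of_slope_zero {f : ℝ → ℝ} {r : ℝ} {C : Set (ℝ × ℝ)} (hr : 0 < r)
    (hC : IsPlaneLine C ∨ IsNullHyperbola C) (hmem : ∀ p, |p| < r → (p, f p) ∈ C)
    (hd : HasDerivAt f 0 0) : ¬ IsNullHyperbola C ∧ ∀ p, (p, f 0) ∈ C := by
  have hnot : ¬ IsNullHyperbola C := by
    rintro ⟨p₀, q₀, K, hK, h⟩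
    have h0 := h _ (hmem 0 (by simpa using hr))
    have h2 := ((hasDerivAt_id (0 : ℝ)).sub_const p₀).mul (hd.sub_const q₀)
    have h3 := h2.unique ((hasDerivAt_const (0 : ℝ) K).congr_of_eventuallyEq (by
      filter_upwards [eventually_abs_lt_zero hr] with x hx
      exact h _ (hmem x hx)))
    simp only [id, mul_zero, add_zero, one_mul] at h3
    simp only at h0
    rw [h3, mul_zero] at h0
    exact hK h0.symm
  refine ⟨hnot, ?_⟩
  obtain ⟨a, δ, hδ, rfl⟩ := hC.resolve_right hnot
  have heq : ∀ p, |p| < r → δ.2 * (p - a.1) = δ.1 * (f p - a.2) := by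
    intro p hp
    obtain ⟨s, hs⟩ := hmem p hp
    have h1 := congrArg Prod.fst hs
    have h2 := congrArg Prod.snd hs
    simp only [Prod.fst_add, Prod.snd_add, Prod.smul_fst, Prod.smul_snd, smul_eq_mul] at h1 h2
    rw [← h2]; nth_rewrite 1 [← h1]; ring
  have h2 : δ.2 = 0 := by
    have h2 := ((hasDerivAt_id (0 : ℝ)).sub_const a.1).const_mul δ.2
    have h3 := h2.unique (((hd.sub_const a.2).const_mul δ.1).congr_of_eventuallyEq (by
      filter_upwards [eventually_abs_lt_zero hr] with x hx
      exact heq x hx))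
    simpa using h3
  have h1 : δ.1 ≠ 0 := fun h1 => hδ (Prod.ext h1 h2)
  intro p
  refine ⟨(p - a.1) / δ.1, Prod.ext ?_ ?_⟩
  · simp only [Prod.fst_add, Prod.smul_fst, smul_eq_mul]
    field_simp
    ring
  · have h3 := heq 0 (by simpa using hr)
    rw [h2, zero_mul] at h3
    have := (mul_eq_zero.1 h3.symm).resolve_left h1
    simp only [Prod.snd_add, Prod.smul_snd, smul_eq_mul, h2, mul_zero]
    linarith

theorem pos_of_mobius {C : Set (ℝ × ℝ)} (hC : IsPreconnected C) {B κ g : ℝ} (hκ : κ ≠ 0)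
    (h0 : (0, B) ∈ C) (h : ∀ y ∈ C, (y.2 - B) * (1 + g * y.1) = κ * y.1) :
    ∀ y ∈ C, 0 < 1 + g * y.1 := by
  intro y hy
  by_contra! hneg
  have hpre := hC.image (fun y => 1 + g * y.1) (by fun_prop)
  obtain ⟨y', hy', h1⟩ := hpre.Icc_subset (Set.mem_image_of_mem _ hy) (Set.mem_image_of_mem _ h0)
    ⟨hneg, by simp⟩
  simp only at h1
  have h2 := h y' hy'
  rw [h1, mul_zero] at h2
  have h3 := (mul_eq_zero.1 h2.symm).resolve_left hκ
  rw [h3] at h1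
  simp at h1

/-- A graph of zero mean curvature over the `(x, p)`-plane, whose leaves `x = const` are lines and
hyperbolas with null asymptotes and only countably many lines, is nowhere tangent to the null
direction contained in the leaves. -/
theorem D2_ne_zero_of_leaves {r : ℝ} {ψ : ℝ × ℝ → ℝ} {L : ℝ → Set (ℝ × ℝ)} (hr : 0 < r)
    (hs : ∀ y ∈ Metric.ball (0 : ℝ × ℝ) r, ContDiffAt ℝ ∞ ψ y)
    (hz : ∀ y ∈ Metric.ball (0 : ℝ × ℝ) r, graphZMC 0 ψ y = 0)
    (hmem : ∀ x p, |x| < r → |p| < r → (p, ψ (x, p)) ∈ L x)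
    (hconn : ∀ x, |x| < r → IsPreconnected (L x))
    (hL : ∀ x, |x| < r → IsPlaneLine (L x) ∨ IsNullHyperbola (L x))
    (hcount : {x | |x| < r ∧ ¬ IsNullHyperbola (L x)}.Countable)
    (hlsc : ∀ x, |x| < r → ∀ y ∈ L x, ∀ U ∈ nhds y, ∀ᶠ x' in nhds x, ∃ y' ∈ L x', y' ∈ U) :
    D2 ψ (0, 0) ≠ 0 := by
  intro h00
  have hr0 : |(0 : ℝ)| < r := by simpa using hr
  set κ : ℝ → ℝ := fun x => D2 ψ (x, 0) with hκdef
  have hsn : ∀ x p, |x| < r → |p| < r → SmoothNear ψ (x, p) := fun x u hx hu =>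
    smoothNear_of_ball hs (mem_ball_pair hx hu)
  have hκc : ∀ x, |x| < r → ContinuousAt κ x := fun x hx =>
    (hasDerivAt_D1 (hsn x 0 hx hr0).d2.at).continuousAt
  have hdp : ∀ x, |x| < r → HasDerivAt (fun p => ψ (x, p)) (κ x) 0 := fun x hx =>
    hasDerivAt_D2 (hsn x 0 hx hr0).at
  -- an interval adjacent to a zero of `κ`
  obtain ⟨b, hb0, hbr, hκb⟩ : ∃ b, 0 < b ∧ b < r ∧ κ b ≠ 0 := by
    by_contra! hc
    have hsub : Set.Ioo 0 r ⊆ {x | |x| < r ∧ ¬ IsNullHyperbola (L x)} := by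
      intro x hx
      have hxr : |x| < r := by rw [abs_of_pos hx.1]; exact hx.2
      have hd := hdp x hxr
      rw [hc x hx.1 hx.2] at hd
      exact ⟨hxr, (mem_of_slope_zero hr (hL x hxr) (fun p hp => hmem x p hxr hp) hd).1⟩
    have := (hcount.mono hsub).measure_zero MeasureTheory.volume
    rw [Real.volume_Ioo, ENNReal.ofReal_eq_zero] at this
    linarith
  have hIcc : ∀ x ∈ Set.Icc 0 b, |x| < r := fun x hx => by
    rw [abs_of_nonneg hx.1]; exact hx.2.trans_lt hbr
  have hcomp : IsCompact (Set.Icc 0 b ∩ κ ⁻¹' {0}) := by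
    have hc : ContinuousOn κ (Set.Icc 0 b) := fun x hx => (hκc x (hIcc x hx)).continuousWithinAt
    exact isCompact_Icc.of_isClosed_subset (hc.preimage_isClosed_of_isClosed isClosed_Icc
      isClosed_singleton) Set.inter_subset_left
  obtain ⟨a, ⟨ha, hκa⟩, hmax⟩ := hcomp.exists_isGreatest ⟨0, ⟨le_rfl, hb0.le⟩, h00⟩
  have hκa : κ a = 0 := hκa
  have hab : a < b := lt_of_le_of_ne ha.2 (fun h => hκb (h ▸ hκa))
  have har := hIcc a ha
  have hin : ∀ x ∈ Set.Ioo a b, |x| < r := fun x hx => hIcc x ⟨ha.1.trans hx.1.le, hx.2.le⟩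
  have hκ0 : ∀ x ∈ Set.Ioo a b, κ x ≠ 0 := fun x hx h =>
    absurd (hmax ⟨⟨ha.1.trans hx.1.le, hx.2.le⟩, h⟩) (not_le.2 hx.1)
  -- the leaves as graphs of Möbius transformations
  set B : ℝ → ℝ := fun x => ψ (x, 0) with hBdef
  set p₁ := r / 2 with hp₁
  have hp10 : p₁ ≠ 0 := by positivity
  have hp1r : |p₁| < r := by rw [abs_of_pos (by positivity)]; linarith
  set g : ℝ → ℝ := fun x => (κ x * p₁ / (ψ (x, p₁) - B x) - 1) / p₁ with hgdef
  have hmob : ∀ x ∈ Set.Ioo a b, ψ (x, p₁) - B x ≠ 0 ∧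
      ∀ y ∈ L x, (y.2 - B x) * (1 + g x * y.1) = κ x * y.1 := by
    intro x hx
    have hxr := hin x hx
    obtain ⟨g', hg'⟩ := exists_mobius hr (hL x hxr) (fun p hp => hmem x p hxr hp) (hdp x hxr)
      (hκ0 x hx)
    have h1 := hg' _ (hmem x p₁ hxr hp1r)
    simp only at h1
    have h2 : ψ (x, p₁) - B x ≠ 0 := by
      intro h2
      rw [h2, zero_mul] at h1
      exact mul_ne_zero (hκ0 x hx) hp10 h1.symm
    have h3 : g x = g' := by
      simp only [hgdef]
      rw [div_eq_iff hp10, sub_eq_iff_eq_add, div_eq_iff h2, ← h1]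
      ring
    exact ⟨h2, h3 ▸ hg'⟩
  have cB : ContDiffOn ℝ ∞ B (Set.Ioo a b) := fun x hx =>
    (ContDiffAt.comp (g := ψ) (f := fun x => (x, (0 : ℝ))) x (hsn x 0 (hin x hx) hr0).at
      (contDiffAt_id.prodMk contDiffAt_const)).contDiffWithinAt
  have cκ : ContDiffOn ℝ ∞ κ (Set.Ioo a b) := fun x hx =>
    (ContDiffAt.comp (g := D2 ψ) (f := fun x => (x, (0 : ℝ))) x (hsn x 0 (hin x hx) hr0).d2.at
      (contDiffAt_id.prodMk contDiffAt_const)).contDiffWithinAt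
  have cψ : ContDiffOn ℝ ∞ (fun x => ψ (x, p₁)) (Set.Ioo a b) := fun x hx =>
    (ContDiffAt.comp (g := ψ) (f := fun x => (x, p₁)) x (hsn x p₁ (hin x hx) hp1r).at
      (contDiffAt_id.prodMk contDiffAt_const)).contDiffWithinAt
  have cg : ContDiffOn ℝ ∞ g (Set.Ioo a b) :=
    (((cκ.mul contDiffOn_const).div (cψ.sub cB) fun x hx => (hmob x hx).1).sub
      contDiffOn_const).div_const p₁
  have hpos : ∀ x ∈ Set.Ioo a b, ∀ y ∈ L x, 0 < 1 + g x * y.1 := fun x hx =>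
    pos_of_mobius (hconn x (hin x hx)) (hκ0 x hx) (hmem x 0 (hin x hx) hr0) (hmob x hx).2
  -- the leaf over `a` is a full null line, and the leaves depend lower semicontinuously on `x`
  have hline : ∀ p, (p, B a) ∈ L a := by
    have hd := hdp a har
    rw [hκa] at hd
    exact (mem_of_slope_zero hr (hL a har) (fun p hp => hmem a p har hp) hd).2
  have hgl : Filter.Tendsto g (nhdsWithin a (Set.Ioi a)) (nhds 0) := by
    rw [Metric.tendsto_nhds]
    intro ε hε
    have hM : 0 < ε⁻¹ := inv_pos.2 hε
    have e1 := hlsc a har _ (hline (ε⁻¹ + 1)) {y | ε⁻¹ < y.1}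
      ((isOpen_lt continuous_const continuous_fst).mem_nhds (by simp))
    have e2 := hlsc a har _ (hline (-(ε⁻¹ + 1))) {y | y.1 < -ε⁻¹}
      ((isOpen_lt continuous_fst continuous_const).mem_nhds (by simp))
    filter_upwards [nhdsWithin_le_nhds e1, nhdsWithin_le_nhds e2, Ioo_mem_nhdsGT hab]
      with x h1 h2 hx
    obtain ⟨y1, hy1, hy1'⟩ := h1
    obtain ⟨y2, hy2, hy2'⟩ := h2
    have hy1' : ε⁻¹ < y1.1 := hy1'
    have hy2' : y2.1 < -ε⁻¹ := hy2'
    have q1 := hpos x hx y1 hy1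
    have q2 := hpos x hx y2 hy2
    have hεε : ε * ε⁻¹ = 1 := mul_inv_cancel₀ hε.ne'
    rw [dist_zero_right, Real.norm_eq_abs, abs_lt]
    constructor
    · by_contra! hc
      nlinarith [mul_le_mul_of_nonneg_right hc (hM.trans hy1').le,
        mul_lt_mul_of_pos_left hy1' hε]
    · by_contra! hc
      nlinarith [mul_le_mul_of_nonneg_right hc (by linarith : 0 ≤ -y2.1),
        mul_lt_mul_of_pos_left hy2' hε]
  have hκl : Filter.Tendsto κ (nhdsWithin a (Set.Ioi a)) (nhds 0) := by
    have := (hκc a har).tendsto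
    rw [hκa] at this
    exact this.mono_left nhdsWithin_le_nhds
  have hbsub : ∀ x ∈ Set.Icc a b, |x| < r := fun x hx => hIcc x ⟨ha.1.trans hx.1, hx.2⟩
  have dB : ∀ x ∈ Set.Icc a b, HasDerivAt B (D1 ψ (x, 0)) x := fun x hx =>
    hasDerivAt_D1 (hsn x 0 (hbsub x hx) hr0).at
  obtain ⟨K₁, hK₁⟩ := isCompact_Icc.exists_bound_of_continuousOn (s := Set.Icc a b) (f := B)
    fun x hx => (dB x hx).continuousAt.continuousWithinAt
  obtain ⟨K₂, hK₂⟩ := isCompact_Icc.exists_bound_of_continuousOn (s := Set.Icc a b)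
    (f := fun x => D1 ψ (x, 0)) fun x hx =>
      (hasDerivAt_D1 (hsn x 0 (hbsub x hx) hr0).d1.at).continuousAt.continuousWithinAt
  refine mobius_leaves_false (K₂ := K₂) hab cB cκ cg hκ0
    (fun x hx => hK₁ x (Set.Ioo_subset_Icc_self hx))
    (fun x hx => ?_) (fun x hx => mobius_leaves_equations (fun x hx => abs_lt.1 (hin x hx)) hs hz
      cB cκ cg hκ0 (fun x hx p hp => (hmob x hx).2 _ (hmem x p (hin x hx) hp)) hx) hκl hgl
  rw [(dB x (Set.Ioo_subset_Icc_self hx)).deriv]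
  exact hK₂ x (Set.Ioo_subset_Icc_self hx)

/-! ### Transversality of the null direction and the planes -/

section

/-- A circle in a plane orthogonal to `T` lies on a quadric `⟨P - c₀, P - c₀⟩ = k`, which does not
degenerate if `T` is spacelike, and it contains every point on its branch of the quadric. -/
theorem IsCircle.exists_center {C : Set L3} (h : IsCircle C) {T : L3} (hT : T ≠ 0)
    (hpl : ∀ P ∈ C, ∀ Q ∈ C, lorentz (P - Q) T = 0) :
    ∃ c₀, ∃ p ∈ C, (∀ P ∈ C, lorentz (P - c₀) (P - c₀) = lorentz (p - c₀) (p - c₀)) ∧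
      (0 < lorentz T T →
        lorentz (p - c₀) T ^ 2 ≠ lorentz T T * lorentz (p - c₀) (p - c₀)) ∧
      ∀ P, lorentz (P - p) T = 0 → lorentz (P - c₀) (P - c₀) = lorentz (p - c₀) (p - c₀) →
        lorentz (p - c₀) T ^ 2 - lorentz T T * lorentz (p - c₀) (p - c₀) ≠ 0 →
        (lorentz T T < 0 ∨ 0 < (lorentz (p - c₀) T ^ 2 - lorentz T T * lorentz (P - c₀) (p - c₀)) /
          (lorentz (p - c₀) T ^ 2 - lorentz T T * lorentz (p - c₀) (p - c₀))) → P ∈ C := by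
  obtain ⟨c₀, d, p, hd, rfl, hcol⟩ := h.exists_orbit
  have hp := mem_orbit_self c₀ d p
  -- the axis is orthogonal to the plane, since otherwise the circle is contained in a line
  have hcross : lorentzCross T d = 0 := by
    by_contra hne
    apply hcol
    obtain ⟨y, hy⟩ : ∃ y, lorentz (lorentzCross T d) y ≠ 0 := by
      by_contra! hc
      exact hne (lorentz_nondegenerate hc)
    rw [collinear_iff_of_mem hp]
    refine ⟨lorentzCross T d, fun P hP =>
      ⟨lorentz (P - p) y / lorentz (lorentzCross T d) y, ?_⟩⟩
    have h1 := hpl P hP p hp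
    have h2 : lorentz (P - p) d = 0 := by
      have := lorentz_axis_of_mem_orbit hP
      simp only [lorentz_sub_left] at this ⊢
      linarith
    have h3 := lorentzCross_expand T d y (P - p)
    rw [h1, h2, zero_smul, zero_smul, zero_add, zero_add] at h3
    rw [vadd_eq_add, eq_comm, ← eq_sub_iff_add_eq, div_eq_inv_mul, mul_smul, ← h3, smul_smul,
      inv_mul_cancel₀ hy, one_smul]
  obtain ⟨s, hs⟩ : ∃ s : ℝ, d = s • T := by
    obtain ⟨i, hi⟩ : ∃ i, T i ≠ 0 := by
      by_contra! hc
      exact hT (funext hc)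
    have c0 : T 1 * d 2 - T 2 * d 1 = 0 := congrFun hcross 0
    have c1 : T 2 * d 0 - T 0 * d 2 = 0 := congrFun hcross 1
    have c2 : -(T 0 * d 1 - T 1 * d 0) = 0 := congrFun hcross 2
    have hall : ∀ i j, T i * d j = T j * d i := by
      intro i j
      fin_cases i <;> fin_cases j <;> simp only [Fin.zero_eta, Fin.mk_one, Fin.reduceFinMk] <;>
        linarith
    refine ⟨d i / T i, funext fun j => ?_⟩
    simp only [Pi.smul_apply, smul_eq_mul]
    field_simp
    linarith [hall i j]
  have hs0 : s ≠ 0 := fun h0 => hd (by rw [hs, h0, zero_smul])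
  have hs2 : 0 < s ^ 2 := by positivity
  have hdd : lorentz d d = s ^ 2 * lorentz T T := by
    rw [hs, lorentz_smul_left, lorentz_smul_right]; ring
  have hwd : ∀ w, lorentz w d = s * lorentz w T := fun w => by rw [hs, lorentz_smul_right]
  refine ⟨c₀, p, hp, fun P hP => lorentz_self_of_mem_orbit hP, fun hpos heq => ?_,
    fun P h1 h2 hG hb => ?_⟩
  · refine hcol (collinear_orbit_of_degenerate (by rw [hdd]; positivity) ?_)
    rw [hdd, hwd]
    linear_combination s ^ 2 * heq
  · have e1 : ∀ t, lorentz (p - c₀) d ^ 2 - lorentz d d * t =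
        s ^ 2 * (lorentz (p - c₀) T ^ 2 - lorentz T T * t) := fun t => by rw [hdd, hwd]; ring
    refine mem_orbit_of_invariants ?_ h2 ?_ ?_
    · rw [hwd, hwd]
      simp only [lorentz_sub_left] at h1 ⊢
      congr 1
      linarith
    · rw [e1]
      exact mul_ne_zero hs2.ne' hG
    · rw [e1, e1, mul_div_mul_left _ _ hs2.ne', hdd]
      exact hb.imp (fun hneg => mul_neg_of_pos_of_neg hs2 hneg) id

section PlanarLeaves

variable {v n m c : L3} {x : ℝ} {C : Set L3}

theorem IsLine.isPlaneLine_image (hf : NullFrame v n m) (h : IsLine C)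
    (hx : ∀ P ∈ C, coordX v c P = x) :
    IsPlaneLine ((fun P => (coordU n m 0 c P, coordQ n c P)) '' C) := by
  obtain ⟨c1, d1, hd1, rfl⟩ := h
  have e1 : ∀ s : ℝ, c1 + s • d1 - c = (c1 - c) + s • d1 := fun s => by abel
  have hv : lorentz d1 v = 0 := by
    have h0 := hx c1 ⟨0, by simp⟩
    have h1 := hx (c1 + (1 : ℝ) • d1) ⟨1, rfl⟩
    unfold coordX at h0 h1
    rw [e1, lorentz_add_left, one_smul] at h1
    linarith
  refine ⟨(coordU n m 0 c c1, coordQ n c c1), (2 * lorentz d1 m, 2 * lorentz d1 n), ?_, ?_⟩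
  · intro h0
    have h1 := congrArg Prod.fst h0
    have h2 := congrArg Prod.snd h0
    simp only [Prod.fst_zero, Prod.snd_zero] at h1 h2
    exact hd1 (hf.eq_zero_of_orthogonal hv (by linarith) (by linarith))
  · have hE : ∀ s : ℝ, (coordU n m 0 c (c1 + s • d1), coordQ n c (c1 + s • d1)) =
        (coordU n m 0 c c1, coordQ n c c1) + s • (2 * lorentz d1 m, 2 * lorentz d1 n) := by
      intro s
      unfold coordU coordQ
      rw [e1]
      simp only [lorentz_add_left, lorentz_smul_left, Prod.smul_mk, Prod.mk_add_mk, smul_eq_mul]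
      ext <;> simp only <;> ring
    ext y
    constructor
    · rintro ⟨_, ⟨s, rfl⟩, rfl⟩
      exact ⟨s, (hE s).symm⟩
    · rintro ⟨s, rfl⟩
      exact ⟨c1 + s • d1, ⟨s, rfl⟩, hE s⟩

/-- A circle in a timelike plane is contained in a hyperbola with null asymptotes. -/
theorem IsCircle.isNullHyperbola_image (hf : NullFrame v n m) (h : IsCircle C)
    (hx : ∀ P ∈ C, coordX v c P = x) :
    IsNullHyperbola ((fun P => (coordU n m 0 c P, coordQ n c P)) '' C) := by
  have hpl : ∀ P ∈ C, ∀ Q ∈ C, lorentz (P - Q) v = 0 := by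
    intro P hP Q hQ
    have h1 := hx P hP
    have h2 := hx Q hQ
    unfold coordX at h1 h2
    simp only [lorentz_sub_left] at h1 h2 ⊢
    linarith
  have hv0 : v ≠ 0 := by
    rintro rfl
    have := hf.vv
    rw [lorentz_zero_left] at this
    exact zero_ne_one this
  obtain ⟨c₀, p, hp, hquad, hdeg, -⟩ := h.exists_center hv0 hpl
  have hself : ∀ P, lorentz (P - c₀) (P - c₀) = lorentz (P - c₀) v ^ 2 +
      (coordU n m 0 c P - coordU n m 0 c c₀) * (coordQ n c P - coordQ n c c₀) := by
    intro P
    rw [hf.lorentz_eq]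
    unfold coordU coordQ
    simp only [lorentz_sub_left]
    ring
  have hvv : ∀ P ∈ C, lorentz (P - c₀) v = lorentz (p - c₀) v := by
    intro P hP
    have := hpl P hP p hp
    simp only [lorentz_sub_left] at this ⊢
    linarith
  refine ⟨coordU n m 0 c c₀, coordQ n c c₀,
    lorentz (p - c₀) (p - c₀) - lorentz (p - c₀) v ^ 2, fun hK => ?_, ?_⟩
  · refine hdeg (by rw [hf.vv]; exact one_pos) ?_
    rw [hf.vv]
    linarith
  · rintro _ ⟨P, hP, rfl⟩
    have h1 := hself P
    rw [hquad P hP, hvv P hP] at h1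
    simp only
    linarith

end PlanarLeaves

variable {S : Type*} [TopologicalSpace S] [ChartedSpace E2 S]

/-- The null direction at a lightlike point is transverse to the planes of the foliation. -/
theorem IsOneSidedFoliated.height_ne_zero [IsManifold (𝓡 2) ∞ S] {X : S → L3} {ℓ : L3 →ₗ[ℝ] ℝ}
    (h : IsOneSidedFoliated X ℓ) {z : S} {n : L3} (hn : lorentz n n = 0) (hN : IsNormalAt X z n) :
    ℓ n ≠ 0 := by
  intro hℓn
  obtain ⟨a, ha⟩ := exists_dual ℓ
  have han : lorentz a n = 0 := by rw [lorentz_comm, ← ha, hℓn]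
  have hane : ∀ s : ℝ, a ≠ s • n := by
    rintro s rfl
    obtain ⟨w, hw⟩ := h.transverse z
    rw [ha, lorentz_smul_right, hN.orth, mul_zero] at hw
    exact hw rfl
  have haa := lorentz_self_pos_of_orthogonal_null hN.ne hn han hane
  set α := Real.sqrt (lorentz a a) with hα
  have hα0 : 0 < α := Real.sqrt_pos.2 haa
  have hα2 : α * α = lorentz a a := Real.mul_self_sqrt haa.le
  set v := α⁻¹ • a with hv
  have hvv : lorentz v v = 1 := by
    rw [hv, lorentz_smul_left, lorentz_smul_right, ← hα2]
    field_simp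
  have hvn : lorentz v n = 0 := by rw [hv, lorentz_smul_left, han, mul_zero]
  have hℓv : ∀ w, ℓ w = α * lorentz w v := fun w => by
    rw [ha, hv, lorentz_smul_right, mul_inv_cancel_left₀ hα0.ne']
  obtain ⟨m, hf⟩ := exists_nullFrame hvv hn hN.ne hvn
  obtain ⟨Ω, r, ψ, hzΩ, hg⟩ := exists_isGraphOn h.smooth (h.inj z) hf 0 hN.orth
  set c := X z with hc
  have hcx : ∀ P, ℓ P = ℓ c + α * coordX v c P := fun P => by
    unfold coordX
    rw [← hℓv, map_sub]; ring
  have hpt : ∀ x p, |x| < r → |p| < r → ∃ z', coordX v c (X z') = x ∧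
      coordU n m 0 c (X z') = p ∧ coordQ n c (X z') = ψ (x, p) ∧ ℓ (X z') = ℓ c + α * x := by
    intro x p hx hp
    obtain ⟨z', hz', he⟩ := hg.surj (x, p) (mem_ball_pair hx hp)
    have hx' : coordX v c (X z') = x := congrArg Prod.fst he
    refine ⟨z', hx', congrArg Prod.snd he, ?_, ?_⟩
    · rw [hg.eq z' hz', he]
    · rw [hcx, hx']
  have hleafx : ∀ x, ∀ P ∈ leaf X ℓ (ℓ c + α * x), coordX v c P = x := by
    rintro x _ ⟨z', hz', rfl⟩
    have h1 : ℓ (X z') = ℓ c + α * x := hz'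
    rw [hcx] at h1
    exact mul_left_cancel₀ hα0.ne' (by linarith)
  set L : ℝ → Set (ℝ × ℝ) := fun x =>
    (fun P => (coordU n m 0 c P, coordQ n c P)) '' leaf X ℓ (ℓ c + α * x) with hL
  have hcont : Continuous fun P => (coordU n m 0 c P, coordQ n c P) :=
    (contDiff_coordU n m 0 c).continuous.prodMk (contDiff_coordQ n c).continuous
  have hr0 : |(0 : ℝ)| < r := by simpa using hg.pos
  have hcl : ∀ x, |x| < r → (IsCircle (leaf X ℓ (ℓ c + α * x)) ∨ IsLine (leaf X ℓ (ℓ c + α * x))) ∧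
      IsPreconnected (leaf X ℓ (ℓ c + α * x)) := by
    intro x hx
    obtain ⟨z', -, -, -, h4⟩ := hpt x 0 hx hr0
    rw [← h4]
    exact ⟨h.leaves z', h.isPreconnected_leaf z'⟩
  refine D2_ne_zero_of_leaves (L := L) hg.pos hg.smooth
    (fun y hy => hg.graphZMC_eq_zero hf h.smooth h.inj h.zmc hy) ?_ ?_ ?_ ?_ ?_ ?_
  · intro x p hx hp
    obtain ⟨z', -, h2, h3, h4⟩ := hpt x p hx hp
    exact ⟨X z', ⟨z', h4, rfl⟩, Prod.ext h2 h3⟩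
  · exact fun x hx => (hcl x hx).2.image _ hcont.continuousOn
  · exact fun x hx => (hcl x hx).1.symm.imp (fun h' => h'.isPlaneLine_image hf (hleafx x))
      fun h' => h'.isNullHyperbola_image hf (hleafx x)
  · have hinj : Function.Injective fun x : ℝ => ℓ c + α * x := fun x y hxy =>
      mul_left_cancel₀ hα0.ne' (add_left_cancel hxy)
    refine (h.countable.preimage hinj).mono fun x hx => ?_
    exact ((hcl x hx.1).1).resolve_left fun h' => hx.2 (h'.isNullHyperbola_image hf (hleafx x))
  · rintro x hx _ ⟨_, ⟨z', hz', rfl⟩, rfl⟩ U hU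
    have hz' : ℓ (X z') = ℓ c + α * x := hz'
    have h1 := h.frequently_height z'
      (p := fun z' => (coordU n m 0 c (X z'), coordQ n c (X z')) ∈ U)
      ((hcont.comp h.smooth.continuous).continuousAt.eventually hU)
    rw [hz'] at h1
    have h2 : Continuous fun x : ℝ => ℓ c + α * x := by fun_prop
    filter_upwards [h2.continuousAt.eventually h1] with x' hx'
    obtain ⟨z'', h3, h4⟩ := hx'
    exact ⟨_, ⟨X z'', ⟨z'', h3, rfl⟩, rfl⟩, h4⟩
  · have hb := (hg.derivs_eq_zero hf h.smooth (h.inj z) hzΩ hN.orth).2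
    have hb0 : base X v n m c 0 z = (0, 0) := by
      simp [base, coordX, coordU, hc, lorentz_zero_left]
    rwa [hb0] at hb

end

/-! ### Circles and lines in a plane of the foliation -/

section

namespace IsAdapted

variable {ℓ : L3 →ₗ[ℝ] ℝ} {v n m c : L3} {e u : ℝ} {C : Set L3}

theorem eq_add (h : IsAdapted ℓ v n m e) (c P : L3) :
    P = c + coordX v c P • v + (ℓ P - ℓ c - e * coordQ n c P) • n + coordQ n c P • m := by
  have h1 := h.frame.expand (P - c)
  have h2 := h.coordU_eq c P
  have h3 : 2 * lorentz (P - c) m = ℓ P - ℓ c - e * coordQ n c P := by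
    rw [← h2]; unfold coordU coordQ; ring
  rw [h3] at h1
  have h4 : P = c + (P - c) := by abel
  rw [add_assoc, add_assoc, ← add_assoc (coordX v c P • v)]
  conv_lhs => rw [h4, h1]
  rfl

/-- The point of the null line through `c` in the direction `n` at the height `u`. -/
theorem height_axis (h : IsAdapted ℓ v n m e) (c : L3) (u : ℝ) :
    ℓ (c + (u - ℓ c) • n) = u := by
  rw [map_add, map_smul, h.height_n]; simp

theorem coord_add (h : IsAdapted ℓ v n m e) (c : L3) (x p q : ℝ) :
    coordX v c (c + x • v + p • n + q • m) = x ∧ coordQ n c (c + x • v + p • n + q • m) = q ∧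
      ℓ (c + x • v + p • n + q • m) = ℓ c + p + e * q := by
  have hf := h.frame
  have e1 : c + x • v + p • n + q • m - c = x • v + p • n + q • m := by abel
  refine ⟨?_, ?_, ?_⟩
  · unfold coordX
    rw [e1]
    simp only [lorentz_add_left, lorentz_smul_left, hf.vv, hf.nv, hf.mv]
    ring
  · unfold coordQ
    rw [e1]
    simp only [lorentz_add_left, lorentz_smul_left, hf.vn, hf.nn, hf.mn]
    ring
  · simp only [map_add, map_smul, h.height v, h.height n, h.height m, hf.vm, hf.vn, hf.nm, hf.nn,
      hf.mm, hf.mn, smul_eq_mul]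
    ring

theorem eq_axis (h : IsAdapted ℓ v n m e) {P : L3} (hx : coordX v c P = 0)
    (hq : coordQ n c P = 0) : P = c + (ℓ P - ℓ c) • n := by
  have := h.eq_add c P
  rw [hx, hq] at this
  simpa using this

theorem collinear (h : IsAdapted ℓ v n m e) (hu : ∀ P ∈ C, ℓ P = u) {a b d : ℝ}
    (hne : a ≠ 0 ∨ b ≠ 0) (heq : ∀ P ∈ C, a * coordX v c P + b * coordQ n c P + d = 0) :
    Collinear ℝ C := by
  rcases C.eq_empty_or_nonempty with rfl | ⟨P₀, hP₀⟩
  · exact collinear_empty ℝ L3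
  rw [collinear_iff_of_mem hP₀]
  refine ⟨b • v - a • (m - e • n), fun P hP => ?_⟩
  obtain ⟨t, h1, h2⟩ : ∃ t, coordX v c P - coordX v c P₀ = t * b ∧
      coordQ n c P - coordQ n c P₀ = -t * a := by
    have h1 := heq P hP
    have h2 := heq P₀ hP₀
    by_cases hb : b = 0
    · have ha : a ≠ 0 := hne.resolve_right (fun h => h hb)
      refine ⟨-(coordQ n c P - coordQ n c P₀) / a, ?_, by field_simp⟩
      rw [hb, mul_zero]
      rw [hb] at h1 h2
      have : a * (coordX v c P - coordX v c P₀) = 0 := by linarith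
      exact (mul_eq_zero.1 this).resolve_left ha
    · refine ⟨(coordX v c P - coordX v c P₀) / b, by field_simp, ?_⟩
      field_simp
      linarith
  refine ⟨t, ?_⟩
  rw [vadd_eq_add]
  have e1 := h.eq_add c P
  have e2 := h.eq_add c P₀
  rw [hu P hP] at e1
  rw [hu P₀ hP₀] at e2
  rw [show coordX v c P = coordX v c P₀ + t * b by linarith,
    show coordQ n c P = coordQ n c P₀ + -t * a by linarith] at e1
  conv_rhs => rw [e2]
  rw [e1]
  module

theorem exists_line_param (h : IsAdapted ℓ v n m e) (hC : IsLine C) (hu : ∀ P ∈ C, ℓ P = u) :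
    ∃ x₁ q₁ δx δq : ℝ, (δx ≠ 0 ∨ δq ≠ 0) ∧
      ∀ s, ∃ P ∈ C, coordX v c P = x₁ + s * δx ∧ coordQ n c P = q₁ + s * δq := by
  obtain ⟨c1, d1, hd1, rfl⟩ := hC
  have e1 : ∀ s : ℝ, c1 + s • d1 - c = (c1 - c) + s • d1 := fun s => by abel
  have hd0 : ℓ d1 = 0 := by
    have h0 := hu c1 ⟨0, by simp⟩
    have h1 := hu (c1 + (1 : ℝ) • d1) ⟨1, rfl⟩
    rw [map_add, one_smul] at h1
    linarith
  refine ⟨coordX v c c1, coordQ n c c1, lorentz d1 v, 2 * lorentz d1 n, ?_,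
    fun s => ⟨c1 + s • d1, ⟨s, rfl⟩, ?_, ?_⟩⟩
  · by_contra! hc
    have h2 : lorentz d1 n = 0 := by linarith [hc.2]
    rw [h.height, h2] at hd0
    exact hd1 (h.frame.eq_zero_of_orthogonal hc.1 h2 (by linarith))
  · unfold coordX
    rw [e1, lorentz_add_left, lorentz_smul_left]
  · unfold coordQ
    rw [e1, lorentz_add_left, lorentz_smul_left]
    ring

/-- A line in the conic `q = A (x² - e q²)` on which `A q ≥ 0` is the line `q = 0`. -/
theorem line_eq (h : IsAdapted ℓ v n m e) (hC : IsLine C) (hu : ∀ P ∈ C, ℓ P = u) {A : ℝ}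
    (heq : ∀ P ∈ C, coordQ n c P = A * coordN v n c e P)
    (hnn : ∀ P ∈ C, 0 ≤ A * coordQ n c P) :
    A = 0 ∧ ∃ P ∈ C, coordX v c P = 0 ∧ coordQ n c P = 0 := by
  obtain ⟨x₁, q₁, δx, δq, hδ, hpt⟩ := h.exists_line_param (c := c) hC hu
  have hA : A = 0 := by
    by_contra hA
    by_cases hq : δq = 0
    · have hx : δx ≠ 0 := hδ.resolve_right (fun h => h hq)
      have key : ∀ s, q₁ = A * ((x₁ + s * δx) ^ 2 - e * q₁ ^ 2) := by
        intro s
        obtain ⟨P, hP, h1, h2⟩ := hpt s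
        have := heq P hP
        unfold coordN at this
        rwa [h1, h2, hq, mul_zero, add_zero] at this
      have h1 := key 1
      have h2 := key (-1)
      have h3 := key 0
      have : A * δx ^ 2 = 0 := by linear_combination h3 - h1 / 2 - h2 / 2
      exact mul_ne_zero hA (pow_ne_zero 2 hx) this
    · obtain ⟨P, hP, -, h2⟩ := hpt ((-1 / A - q₁) / δq)
      have := hnn P hP
      rw [h2, div_mul_cancel₀ _ hq, add_sub_cancel, mul_div_cancel₀ _ hA] at this
      linarith
  refine ⟨hA, ?_⟩
  have hz : ∀ s, q₁ + s * δq = 0 := by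
    intro s
    obtain ⟨P, hP, -, h2⟩ := hpt s
    rw [← h2, heq P hP, hA, zero_mul]
  have hq1 : q₁ = 0 := by simpa using hz 0
  have hq : δq = 0 := by have := hz 1; rw [hq1] at this; linarith
  have hx : δx ≠ 0 := hδ.resolve_right (fun h => h hq)
  obtain ⟨P, hP, h1, h2⟩ := hpt (-x₁ / δx)
  refine ⟨P, hP, ?_, by rw [h2]; exact hz _⟩
  rw [h1]; field_simp; ring

/-- A line in the pair of lines `x² - e q² = 0` takes both signs of `q`. -/
theorem line_signs (h : IsAdapted ℓ v n m e) (hC : IsLine C) (hu : ∀ P ∈ C, ℓ P = u)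
    (heq : ∀ P ∈ C, coordN v n c e P = 0) :
    (∃ P ∈ C, 0 < coordQ n c P) ∧ ∃ P ∈ C, coordQ n c P < 0 := by
  obtain ⟨x₁, q₁, δx, δq, hδ, hpt⟩ := h.exists_line_param (c := c) hC hu
  have hq : δq ≠ 0 := by
    intro hq
    have hx : δx ≠ 0 := hδ.resolve_right (fun h => h hq)
    have key : ∀ s, (x₁ + s * δx) ^ 2 - e * q₁ ^ 2 = 0 := by
      intro s
      obtain ⟨P, hP, h1, h2⟩ := hpt s
      have := heq P hP
      unfold coordN at this
      rwa [h1, h2, hq, mul_zero, add_zero] at this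
    have : δx ^ 2 = 0 := by linear_combination -key 0 + key 1 / 2 + key (-1) / 2
    exact pow_ne_zero 2 hx this
  constructor
  · obtain ⟨P, hP, -, h2⟩ := hpt ((1 - q₁) / δq)
    refine ⟨P, hP, ?_⟩
    rw [h2, div_mul_cancel₀ _ hq]
    linarith
  · obtain ⟨P, hP, -, h2⟩ := hpt ((-1 - q₁) / δq)
    refine ⟨P, hP, ?_⟩
    rw [h2, div_mul_cancel₀ _ hq]
    linarith

/-- The normal vector of the planes `ℓ = u`. -/
def heightNormal (n m : L3) (e : ℝ) : L3 := (2 : ℝ) • m + (2 * e) • n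

theorem height_eq_lorentz (h : IsAdapted ℓ v n m e) (w : L3) :
    ℓ w = lorentz w (heightNormal n m e) := by
  rw [h.height]
  simp only [heightNormal, lorentz_add_right, lorentz_smul_right]
  ring

theorem heightNormal_self (h : IsAdapted ℓ v n m e) :
    lorentz (heightNormal n m e) (heightNormal n m e) = 4 * e := by
  rw [← h.height_eq_lorentz]
  simp only [heightNormal, map_add, map_smul, h.height n, h.height m, h.frame.nm, h.frame.nn,
    h.frame.mm, h.frame.mn, smul_eq_mul]
  ring

/-- A circle in a plane `ℓ = u`, in coordinates: its quadric is `x² - e q² - 2 x₀ x + h q = k'`. -/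
theorem exists_circle_coords (h : IsAdapted ℓ v n m e) (hC : IsCircle C)
    (hu : ∀ P ∈ C, ℓ P = u) (c : L3) :
    ∃ x₀ q₀ t : ℝ, ∃ p ∈ C,
      (∀ P ∈ C, coordN v n c e P - 2 * x₀ * coordX v c P + (t + e * q₀) * coordQ n c P =
        coordN v n c e p - 2 * x₀ * coordX v c p + (t + e * q₀) * coordQ n c p) ∧
      (0 < e → (t - e * q₀) ^ 2 ≠ 4 * e * (coordN v n c e p - 2 * x₀ * coordX v c p +
        (t + e * q₀) * coordQ n c p + x₀ ^ 2 - t * q₀)) ∧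
      ∀ P, ℓ P = u →
        coordN v n c e P - 2 * x₀ * coordX v c P + (t + e * q₀) * coordQ n c P =
          coordN v n c e p - 2 * x₀ * coordX v c p + (t + e * q₀) * coordQ n c p →
        (t - e * q₀) ^ 2 ≠ 4 * e * (coordN v n c e p - 2 * x₀ * coordX v c p +
          (t + e * q₀) * coordQ n c p + x₀ ^ 2 - t * q₀) →
        (e < 0 ∨ 0 < ((t - e * q₀) ^ 2 - 4 * e * ((coordX v c P - x₀) * (coordX v c p - x₀)
            + ((t - e * coordQ n c P) * (coordQ n c p - q₀)
              + (coordQ n c P - q₀) * (t - e * coordQ n c p)) / 2)) /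
          ((t - e * q₀) ^ 2 - 4 * e * (coordN v n c e p - 2 * x₀ * coordX v c p +
          (t + e * q₀) * coordQ n c p + x₀ ^ 2 - t * q₀))) → P ∈ C := by
  set T := heightNormal n m e with hT
  have hT0 : T ≠ 0 := by
    intro h0
    have := h.height_eq_lorentz n
    rw [← hT, h0, lorentz_zero_right, h.height_n] at this
    exact one_ne_zero this
  obtain ⟨c₀, p, hp, h1, h2, h3⟩ := hC.exists_center hT0 fun P hP Q hQ => by
    rw [← h.height_eq_lorentz, map_sub, hu P hP, hu Q hQ, sub_self]
  set x₀ := coordX v c c₀ with hx₀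
  set q₀ := coordQ n c c₀ with hq₀
  set t := u - ℓ c₀ + e * q₀ with ht
  have hx : ∀ P, lorentz (P - c₀) v = coordX v c P - x₀ := fun P => by
    rw [hx₀]; unfold coordX; simp only [lorentz_sub_left]; ring
  have hq : ∀ P, lorentz (P - c₀) n = (coordQ n c P - q₀) / 2 := fun P => by
    rw [hq₀]; unfold coordQ; simp only [lorentz_sub_left]; ring
  have hm : ∀ P, ℓ P = u → lorentz (P - c₀) m = (t - e * coordQ n c P) / 2 := fun P hP => by
    have h4 := h.height (P - c₀)
    rw [map_sub, hP, hq] at h4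
    rw [ht]; linarith
  have hin : ∀ P Q, ℓ P = u → ℓ Q = u → lorentz (P - c₀) (Q - c₀) =
      (coordX v c P - x₀) * (coordX v c Q - x₀) + ((t - e * coordQ n c P) * (coordQ n c Q - q₀)
        + (coordQ n c P - q₀) * (t - e * coordQ n c Q)) / 2 := fun P Q hP hQ => by
    rw [h.frame.lorentz_eq, hx, hx, hq, hq, hm P hP, hm Q hQ]; ring
  have hself : ∀ P, ℓ P = u → lorentz (P - c₀) (P - c₀) = coordN v n c e P - 2 * x₀ * coordX v c P
      + (t + e * q₀) * coordQ n c P + x₀ ^ 2 - t * q₀ := fun P hP => by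
    rw [hin P P hP hP]; unfold coordN; ring
  have hpT : lorentz (p - c₀) T = t - e * q₀ := by
    rw [← h.height_eq_lorentz, map_sub, hu p hp, ht]; ring
  have hTT : lorentz T T = 4 * e := h.heightNormal_self
  rw [hpT, hTT, hself p (hu p hp)] at h2 h3
  refine ⟨x₀, q₀, t, p, hp, fun P hP => ?_, fun he => h2 (by linarith), fun P hP h4 h5 h6 => ?_⟩
  · have := h1 P hP
    rw [hself P (hu P hP), hself p (hu p hp)] at this
    linarith
  · refine h3 P ?_ ?_ (sub_ne_zero.2 h5) ?_
    · rw [← h.height_eq_lorentz, map_sub, hP, hu p hp, sub_self]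
    · rw [hself P hP]; linarith
    · rw [hin P p hP (hu p hp)]
      exact h6.imp (fun he => by linarith) id

/-- A circle is not contained in a pair of crossing lines `x² - e q² = 0`. -/
theorem circle_ne (h : IsAdapted ℓ v n m e) (hC : IsCircle C) (hu : ∀ P ∈ C, ℓ P = u)
    (heq : ∀ P ∈ C, coordN v n c e P = 0) : False := by
  have hncol : ¬ Collinear ℝ C := by
    obtain ⟨-, -, -, -, -, h'⟩ := hC.exists_orbit
    exact h'
  rcases le_or_gt e 0 with he | he
  · refine hncol (h.collinear (c := c) hu (a := 1) (b := 0) (d := 0) (Or.inl one_ne_zero)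
      fun P hP => ?_)
    have := heq P hP
    unfold coordN at this
    have : coordX v c P ^ 2 = 0 := by
      nlinarith [sq_nonneg (coordX v c P), sq_nonneg (coordQ n c P)]
    rw [pow_eq_zero_iff two_ne_zero] at this
    rw [this]; ring
  · obtain ⟨x₀, q₀, t, p, hp, h1, h2, -⟩ := h.exists_circle_coords hC hu c
    have hlin : ¬ (-2 * x₀ ≠ 0 ∨ t + e * q₀ ≠ 0) := fun hne => by
      refine hncol (h.collinear (c := c) hu (d := 2 * x₀ * coordX v c p -
        (t + e * q₀) * coordQ n c p) hne fun P hP => ?_)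
      have := h1 P hP
      rw [heq P hP, heq p hp] at this
      linarith
    push Not at hlin
    have hx0 : x₀ = 0 := by linarith [hlin.1]
    apply h2 he
    rw [heq p hp, hx0]
    have ht : t = -(e * q₀) := by linarith [hlin.2]
    rw [ht]; ring

/-- A circle contained in the conic `q = A (x² - e q²)` contains every point on its branch of the
conic. -/
theorem mem_circle (h : IsAdapted ℓ v n m e) (hC : IsCircle C) (hu : ∀ P ∈ C, ℓ P = u) {A : ℝ}
    (heq : ∀ P ∈ C, coordQ n c P = A * coordN v n c e P) :
    A ≠ 0 ∧ ∀ P, ℓ P = u → coordQ n c P = A * coordN v n c e P →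
      (e < 0 ∨ (coordX v c P = 0 ∧ coordQ n c P = 0 ∧ ∀ P' ∈ C, 0 < 1 + 2 * e * A * coordQ n c P'))
      → P ∈ C := by
  have hncol : ¬ Collinear ℝ C := by
    obtain ⟨-, -, -, -, -, h'⟩ := hC.exists_orbit
    exact h'
  have hA : A ≠ 0 := by
    rintro rfl
    refine hncol (h.collinear (c := c) hu (a := 0) (b := 1) (d := 0) (Or.inr one_ne_zero)
      fun P hP => ?_)
    rw [heq P hP]; ring
  refine ⟨hA, fun P hP hPN hb => ?_⟩
  have hN : ∀ P, coordQ n c P = A * coordN v n c e P → coordN v n c e P = coordQ n c P / A :=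
    fun P hP => by rw [hP]; field_simp
  obtain ⟨x₀, q₀, t, p, hp, h1, -, h2⟩ := h.exists_circle_coords hC hu c
  have hlin : ¬ (-2 * x₀ ≠ 0 ∨ t + e * q₀ + 1 / A ≠ 0) := fun hne => by
    refine hncol (h.collinear (c := c) hu (d := 2 * x₀ * coordX v c p -
      (t + e * q₀ + 1 / A) * coordQ n c p) hne fun P hP => ?_)
    have := h1 P hP
    rw [hN P (heq P hP), hN p (heq p hp)] at this
    linear_combination this
  push Not at hlin
  have hx0 : x₀ = 0 := by linarith [hlin.1]
  have hpN := hN p (heq p hp)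
  have ht : t = -(e * q₀) - 1 / A := by linarith [hlin.2]
  have hG : (t - e * q₀) ^ 2 - 4 * e * (coordN v n c e p - 2 * x₀ * coordX v c p +
      (t + e * q₀) * coordQ n c p + x₀ ^ 2 - t * q₀) = 1 / A ^ 2 := by
    rw [hpN, hx0, ht]; field_simp; ring
  apply h2 P hP
  · rw [hN P hPN, hpN, hx0, ht]; ring
  · intro h3
    rw [h3, sub_self] at hG
    exact one_div_ne_zero (pow_ne_zero 2 hA) hG.symm
  · refine hb.imp id fun ⟨hPx, hPq, hpos⟩ => ?_
    rw [hG, hPx, hPq, hx0, ht]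
    have h4 := hpos p hp
    have h5 : ((-(e * q₀) - 1 / A - e * q₀) ^ 2 - 4 * e * ((0 - 0) * (coordX v c p - 0)
        + ((-(e * q₀) - 1 / A - e * 0) * (coordQ n c p - q₀)
          + (0 - q₀) * (-(e * q₀) - 1 / A - e * coordQ n c p)) / 2)) / (1 / A ^ 2) =
        1 + 2 * e * A * coordQ n c p := by
      field_simp; ring
    rw [h5]
    exact h4

end IsAdapted

end

/-! ### The null line meets every leaf -/

section

theorem continuous_coordN (v n c : L3) (e : ℝ) : Continuous (coordN v n c e) :=
  ((contDiff_coordX v c).continuous.pow 2).sub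
    (continuous_const.mul ((contDiff_coordQ n c).continuous.pow 2))

variable {S : Type*} [TopologicalSpace S] [ChartedSpace E2 S]

/-- The heights of the points of the null line through `c` in the direction `n` which belong to the
surface, with tangent plane orthogonal to `n`. -/
def axisHeights (X : S → L3) (ℓ : L3 →ₗ[ℝ] ℝ) (n c : L3) : Set ℝ :=
  {u | ∃ z, X z = c + (u - ℓ c) • n ∧ ∀ w, lorentz (dX X z w) n = 0}

namespace IsOneSidedFoliated

variable {X : S → L3} {ℓ : L3 →ₗ[ℝ] ℝ} {v n m c : L3} {e : ℝ}

theorem exists_normal_form_axis [IsManifold (𝓡 2) ∞ S] (h : IsOneSidedFoliated X ℓ)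
    (ha : IsAdapted ℓ v n m e) {u : ℝ} (hu : u ∈ axisHeights X ℓ n c) :
    ∃ (A : ℝ → ℝ) (k : ℝ), ∀ᶠ u' in nhds u, HasDerivAt A (A u' ^ 2 + k) u' ∧
      u' ∈ axisHeights X ℓ n c ∧
      ∀ z, ℓ (X z) = u' → coordQ n c (X z) = A u' * coordN v n c e (X z) := by
  obtain ⟨z₀, hz₀, ht⟩ := hu
  have hf := ha.frame
  have hu0 : ℓ (X z₀) = u := by rw [hz₀, ha.height_axis]
  obtain ⟨ρ, hρ, A, k, h1, h2, h3⟩ := h.exists_normal_form ha ht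
  have hX : ∀ P, coordX v (X z₀) P = coordX v c P := fun P => by
    unfold coordX
    rw [hz₀]
    simp only [lorentz_sub_left, lorentz_add_left, lorentz_smul_left, hf.nv]
    ring
  have hQ : ∀ P, coordQ n (X z₀) P = coordQ n c P := fun P => by
    unfold coordQ
    rw [hz₀]
    simp only [lorentz_sub_left, lorentz_add_left, lorentz_smul_left, hf.nn]
    ring
  refine ⟨fun u' => A (u' - u), k, ?_⟩
  filter_upwards [Ioo_mem_nhds (show u - ρ < u by linarith) (show u < u + ρ by linarith)]
    with u' hu'
  have hm : u' - u ∈ Set.Ioo (-ρ) ρ := ⟨by linarith [hu'.1], by linarith [hu'.2]⟩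
  refine ⟨(h1 _ hm).comp_sub_const u' u, ?_, fun z hz => ?_⟩
  · obtain ⟨z, hz, hzt⟩ := h2 _ hm
    refine ⟨z, ?_, hzt⟩
    rw [hz, hz₀, add_assoc, ← add_smul]
    congr 2
    ring
  · have := h3 z (by rw [hu0, hz]; exact hm)
    unfold coordN at this ⊢
    rwa [hu0, hz, hQ, hX] at this

theorem isOpen_axisHeights [IsManifold (𝓡 2) ∞ S] (h : IsOneSidedFoliated X ℓ)
    (ha : IsAdapted ℓ v n m e) : IsOpen (axisHeights X ℓ n c) := by
  rw [isOpen_iff_mem_nhds]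
  intro u hu
  obtain ⟨A, k, h1⟩ := h.exists_normal_form_axis ha hu
  filter_upwards [h1] with u' hu' using hu'.2.1

/-- On a leaf through a point of the null line, `A q` does not change sign. For `e > 0` the leaf is
a branch of a hyperbola. -/
theorem coeff_mul_nonneg (h : IsOneSidedFoliated X ℓ) (ha : IsAdapted ℓ v n m e) {u A : ℝ}
    (hu : u ∈ axisHeights X ℓ n c)
    (hA : ∀ z, ℓ (X z) = u → coordQ n c (X z) = A * coordN v n c e (X z)) {z : S}
    (hz : ℓ (X z) = u) : 0 ≤ A * coordQ n c (X z) := by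
  rcases le_or_gt e 0 with he | he
  · have h1 : 0 ≤ coordN v n c e (X z) := by
      unfold coordN
      nlinarith [sq_nonneg (coordX v c (X z)), sq_nonneg (coordQ n c (X z))]
    rw [hA z hz, ← mul_assoc]
    exact mul_nonneg (mul_self_nonneg A) h1
  · by_contra! hneg
    obtain ⟨z₀, hz₀, -⟩ := hu
    have hu0 : ℓ (X z₀) = u := by rw [hz₀, ha.height_axis]
    have hq0 : coordQ n c (X z₀) = 0 := by
      unfold coordQ
      rw [hz₀, add_sub_cancel_left, lorentz_smul_left, ha.frame.nn]; ring
    -- `H = 1 + 2 e A q` satisfies `H² = 1 + 4 e A² x² ≥ 1` on the leaf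
    have hH : ∀ P ∈ leaf X ℓ u, 1 ≤ (1 + 2 * e * A * coordQ n c P) ^ 2 := by
      rintro _ ⟨z', hz', rfl⟩
      have h1 := hA z' hz'
      unfold coordN at h1
      have h2 : (1 + 2 * e * A * coordQ n c (X z')) ^ 2 =
          1 + 4 * e * A ^ 2 * coordX v c (X z') ^ 2 := by
        linear_combination 4 * e * A * h1
      rw [h2]
      have : 0 ≤ 4 * e * A ^ 2 * coordX v c (X z') ^ 2 := by positivity
      linarith
    have hpre := (h.isPreconnected_leaf z).image (fun P => 1 + 2 * e * A * coordQ n c P)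
      (continuous_const.add (continuous_const.mul (contDiff_coordQ n c).continuous)).continuousOn
    rw [hz] at hpre
    have hm1 : 1 + 2 * e * A * coordQ n c (X z) ∈
      (fun P => 1 + 2 * e * A * coordQ n c P) '' leaf X ℓ u := ⟨X z, ⟨z, hz, rfl⟩, rfl⟩
    have hm0 : (1 : ℝ) ∈ (fun P => 1 + 2 * e * A * coordQ n c P) '' leaf X ℓ u :=
      ⟨X z₀, ⟨z₀, hu0, rfl⟩, by simp only [hq0]; ring⟩
    have h1 := hH (X z) ⟨z, hz, rfl⟩
    have h2 : 1 + 2 * e * A * coordQ n c (X z) ≤ 0 := by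
      by_contra! hc
      have : 2 * e * A * coordQ n c (X z) < 0 := by nlinarith
      nlinarith
    obtain ⟨P, hP, h3⟩ := hpre.Icc_subset hm1 hm0 ⟨h2, zero_le_one⟩
    have h4 := hH P hP
    simp only at h3
    rw [h3] at h4
    norm_num at h4

/-- The leaf over a limit of heights of the null line passes through the null line. -/
theorem exists_axis_point (h : IsOneSidedFoliated X ℓ) (ha : IsAdapted ℓ v n m e) {z₁ : S} {A : ℝ}
    (hA : ∀ z, ℓ (X z) = ℓ (X z₁) → coordQ n c (X z) = A * coordN v n c e (X z) ∧
        0 ≤ A * coordQ n c (X z)) :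
    ∃ z, X z = c + (ℓ (X z₁) - ℓ c) • n := by
  set β := ℓ (X z₁) with hβ
  have hu : ∀ P ∈ leaf X ℓ β, ℓ P = β := by
    rintro _ ⟨z, hz, rfl⟩; exact hz
  have hq : ∀ P ∈ leaf X ℓ β, coordQ n c P = A * coordN v n c e P := by
    rintro _ ⟨z, hz, rfl⟩; exact (hA z hz).1
  have hnn : ∀ P ∈ leaf X ℓ β, 0 ≤ A * coordQ n c P := by
    rintro _ ⟨z, hz, rfl⟩; exact (hA z hz).2
  rcases h.leaves z₁ with hC | hC
  · obtain ⟨-, hmem⟩ := ha.mem_circle hC hu hq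
    have hc0 : coordX v c (c + (β - ℓ c) • n) = 0 := by
      unfold coordX
      rw [add_sub_cancel_left, lorentz_smul_left, ha.frame.nv, mul_zero]
    have hq0 : coordQ n c (c + (β - ℓ c) • n) = 0 := by
      unfold coordQ
      rw [add_sub_cancel_left, lorentz_smul_left, ha.frame.nn]; ring
    obtain ⟨z, -, hz⟩ := hmem (c + (β - ℓ c) • n) (ha.height_axis c β)
      (by unfold coordN; rw [hc0, hq0]; ring) (by
        rcases lt_or_ge e 0 with he | he
        · exact Or.inl he
        · refine Or.inr ⟨hc0, hq0, fun P hP => ?_⟩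
          have := mul_nonneg he (hnn P hP)
          nlinarith)
    exact ⟨z, hz⟩
  · obtain ⟨-, _, ⟨z, hz, rfl⟩, hx0, hq0⟩ := ha.line_eq hC hu hq hnn
    refine ⟨z, ?_⟩
    have := ha.eq_axis hx0 hq0
    rwa [show ℓ (X z) = β from hz] at this

variable [IsManifold (𝓡 2) ∞ S]

/-- Over the closure of the heights of the null line, no leaf is contained in `x² - e q² = 0`. -/
theorem exists_coordN_ne_zero (h : IsOneSidedFoliated X ℓ) (ha : IsAdapted ℓ v n m e) {z₁ : S}
    (hcl : ℓ (X z₁) ∈ closure (axisHeights X ℓ n c)) :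
    ∃ z, ℓ (X z) = ℓ (X z₁) ∧ coordN v n c e (X z) ≠ 0 := by
  by_contra! hc
  have hu : ∀ P ∈ leaf X ℓ (ℓ (X z₁)), ℓ P = ℓ (X z₁) := by
    rintro _ ⟨z, hz, rfl⟩; exact hz
  have hN : ∀ P ∈ leaf X ℓ (ℓ (X z₁)), coordN v n c e P = 0 := by
    rintro _ ⟨z, hz, rfl⟩; exact hc z hz
  rcases h.leaves z₁ with hC | hC
  · exact ha.circle_ne hC hu hN
  · obtain ⟨⟨_, ⟨z, hz, rfl⟩, hpos⟩, ⟨_, ⟨z', hz', rfl⟩, hneg⟩⟩ := ha.line_signs hC hu hN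
    have hqc : Continuous fun z => coordQ n c (X z) :=
      (contDiff_coordQ n c).continuous.comp h.smooth.continuous
    have hz : ℓ (X z) = ℓ (X z₁) := hz
    have hz' : ℓ (X z') = ℓ (X z₁) := hz'
    have e1 := h.frequently_height z (hqc.continuousAt.eventually_const_lt hpos)
    have e2 := h.frequently_height z' (hqc.continuousAt.eventually_lt_const hneg)
    rw [hz] at e1
    rw [hz'] at e2
    obtain ⟨u, huG, ⟨y, hy, hy'⟩, ⟨t, ht, ht'⟩⟩ :=
      ((mem_closure_iff_frequently.1 hcl).and_eventually (e1.and e2)).exists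
    obtain ⟨A, k, hA⟩ := h.exists_normal_form_axis ha huG
    have hAu := hA.self_of_nhds.2.2
    have i1 := h.coeff_mul_nonneg ha huG hAu hy
    have i2 := h.coeff_mul_nonneg ha huG hAu ht
    have hA0 : A u = 0 := by
      rcases lt_trichotomy (A u) 0 with hlt | heq | hgt
      · nlinarith
      · exact heq
      · nlinarith
    have := hAu y hy
    rw [hA0, zero_mul] at this
    exact hy'.ne' this

/-- The conics of the leaves near a limit of heights of the null line converge. -/
theorem exists_limit_coeff (h : IsOneSidedFoliated X ℓ) (ha : IsAdapted ℓ v n m e) {z₁ : S}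
    (hcl : ℓ (X z₁) ∈ closure (axisHeights X ℓ n c)) {a : ℝ → ℝ}
    (haq : ∀ u ∈ axisHeights X ℓ n c, ∀ z, ℓ (X z) = u →
      coordQ n c (X z) = a u * coordN v n c e (X z)) :
    ∃ A, Filter.Tendsto a (nhdsWithin (ℓ (X z₁)) (axisHeights X ℓ n c)) (nhds A) ∧
      ∀ z, ℓ (X z) = ℓ (X z₁) → coordQ n c (X z) = A * coordN v n c e (X z) ∧
        0 ≤ A * coordQ n c (X z) := by
  obtain ⟨z₀, hz₀, hN₀⟩ := h.exists_coordN_ne_zero ha hcl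
  set β := ℓ (X z₁) with hβ
  have hne : (nhdsWithin β (axisHeights X ℓ n c)).NeBot := mem_closure_iff_nhdsWithin_neBot.1 hcl
  have hqc : Continuous fun z => coordQ n c (X z) :=
    (contDiff_coordQ n c).continuous.comp h.smooth.continuous
  have hNc : Continuous fun z => coordN v n c e (X z) :=
    (continuous_coordN v n c e).comp h.smooth.continuous
  set A := coordQ n c (X z₀) / coordN v n c e (X z₀) with hA
  have hlim : Filter.Tendsto a (nhdsWithin β (axisHeights X ℓ n c)) (nhds A) := by
    refine Filter.tendsto_def.2 fun U hU => ?_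
    have h1 : ∀ᶠ z in nhds z₀, coordQ n c (X z) / coordN v n c e (X z) ∈ U ∧
        coordN v n c e (X z) ≠ 0 :=
      ((hqc.continuousAt.div hNc.continuousAt hN₀).eventually hU).and
        (hNc.continuousAt.eventually_ne hN₀)
    have h2 := h.frequently_height z₀ h1
    rw [hz₀] at h2
    filter_upwards [nhdsWithin_le_nhds h2, self_mem_nhdsWithin] with u hu huG
    obtain ⟨z, hz, hzU, hzN⟩ := hu
    rw [haq u huG z hz, mul_div_cancel_right₀ _ hzN] at hzU
    exact hzU
  refine ⟨A, hlim, fun z hz => ⟨?_, ?_⟩⟩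
  · by_contra hc
    have h1 : ContinuousAt (fun y : S × ℝ => coordQ n c (X y.1) - y.2 * coordN v n c e (X y.1))
        (z, A) := by
      apply Continuous.continuousAt
      exact (hqc.comp continuous_fst).sub (continuous_snd.mul (hNc.comp continuous_fst))
    have h2 := h1.eventually_ne (sub_ne_zero.2 hc)
    rw [nhds_prod_eq] at h2
    obtain ⟨p, hp, p', hp', h3⟩ := Filter.eventually_prod_iff.1 h2
    have h4 := h.frequently_height z hp
    rw [hz] at h4
    obtain ⟨u, ⟨⟨z', hz', hpz⟩, hpu⟩, huG⟩ :=
      (((h4.filter_mono nhdsWithin_le_nhds).and (hlim.eventually hp')).and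
        eventually_mem_nhdsWithin).exists
    exact h3 hpz hpu (sub_eq_zero.2 (haq u huG z' hz'))
  · by_contra! hc
    have h1 : ContinuousAt (fun y : S × ℝ => y.2 * coordQ n c (X y.1)) (z, A) := by
      apply Continuous.continuousAt
      exact continuous_snd.mul (hqc.comp continuous_fst)
    have h2 := h1.eventually_lt_const hc
    rw [nhds_prod_eq] at h2
    obtain ⟨p, hp, p', hp', h3⟩ := Filter.eventually_prod_iff.1 h2
    have h4 := h.frequently_height z hp
    rw [hz] at h4
    obtain ⟨u, ⟨⟨z', hz', hpz⟩, hpu⟩, huG⟩ :=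
      (((h4.filter_mono nhdsWithin_le_nhds).and (hlim.eventually hp')).and
        eventually_mem_nhdsWithin).exists
    exact absurd (h.coeff_mul_nonneg ha huG (haq u huG) hz') (not_le.2 (h3 hpz hpu))

/-- At a point of the null line the surface is a graph over the `(x, u)`-plane. -/
theorem eq_zero_of_dX_axis (h : IsOneSidedFoliated X ℓ) (ha : IsAdapted ℓ v n m e) {z : S} {A : ℝ}
    (hz : coordQ n c (X z) = 0)
    (hA : ∀ z', ℓ (X z') = ℓ (X z) → coordQ n c (X z') = A * coordN v n c e (X z') ∧
        0 ≤ A * coordQ n c (X z')) {w : E2} (h1 : lorentz (dX X z w) v = 0)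
    (h2 : ℓ (dX X z w) = 0) : w = 0 := by
  by_contra hw
  have hq : lorentz (dX X z w) n ≠ 0 := by
    intro h3
    apply hw
    apply h.inj z
    rw [map_zero]
    rw [ha.height, h3] at h2
    exact ha.frame.eq_zero_of_orthogonal h1 (by linarith) (by linarith)
  -- otherwise `(q, ℓ)` are coordinates, and `q` takes both signs on the leaf
  obtain ⟨w₂, hw₂⟩ := h.transverse z
  have hopen := map_comp_nhds h.smooth
    (((2 : ℝ) • pairing n).prod (LinearMap.toContinuousLinearMap ℓ)) (z := z) (by
      rintro ⟨s, t⟩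
      refine ⟨((s - t / ℓ (dX X z w₂) * (2 * lorentz (dX X z w₂) n)) /
        (2 * lorentz (dX X z w) n)) • w + (t / ℓ (dX X z w₂)) • w₂, ?_⟩
      simp only [map_add, map_smul, ContinuousLinearMap.prod_apply,
        smul_apply, pairing_apply, LinearMap.coe_toContinuousLinearMap', h2, smul_eq_mul]
      ext
      · simp only [Prod.fst_add, Prod.smul_fst, smul_eq_mul]
        field_simp
        ring
      · simp only [Prod.snd_add, Prod.smul_snd, smul_eq_mul]
        field_simp
        ring)
  have hrange : Set.range (fun z' => (((2 : ℝ) • pairing n).prod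
      (LinearMap.toContinuousLinearMap ℓ)) (X z')) ∈ nhds ((((2 : ℝ) • pairing n).prod
      (LinearMap.toContinuousLinearMap ℓ)) (X z)) := by
    rw [← hopen]
    exact Filter.range_mem_map
  obtain ⟨ε, hε, hball⟩ := Metric.mem_nhds_iff.1 hrange
  have hpt : ∀ δ, |δ| < ε → ∃ z', ℓ (X z') = ℓ (X z) ∧ coordQ n c (X z') = δ := by
    intro δ hδ
    obtain ⟨z', hz'⟩ := hball (show (((2 : ℝ) • pairing n).prod
      (LinearMap.toContinuousLinearMap ℓ)) (X z) + (δ, 0) ∈ _ by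
        rw [mem_ball_iff_norm, add_sub_cancel_left, Prod.norm_mk, norm_zero, Real.norm_eq_abs]
        exact max_lt hδ hε)
    have e1 := congrArg Prod.fst hz'
    have e2 := congrArg Prod.snd hz'
    simp only [ContinuousLinearMap.prod_apply, smul_apply, pairing_apply,
      smul_eq_mul, LinearMap.coe_toContinuousLinearMap', Prod.fst_add, Prod.snd_add, add_zero]
      at e1 e2
    refine ⟨z', e2, ?_⟩
    unfold coordQ at hz ⊢
    rw [lorentz_sub_left] at hz ⊢
    linarith
  obtain ⟨y, hy, hyq⟩ := hpt (ε / 2) (by rw [abs_of_pos (by positivity)]; linarith)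
  obtain ⟨t, ht, htq⟩ := hpt (-(ε / 2)) (by rw [abs_neg, abs_of_pos (by positivity)]; linarith)
  obtain ⟨q1, i1⟩ := hA y hy
  have i2 := (hA t ht).2
  rw [hyq] at i1 q1
  rw [htq] at i2
  have hA0 : A * (ε / 2) = 0 := by linarith
  have hA0' : A = 0 := (mul_eq_zero.1 hA0).resolve_right (by positivity)
  rw [hA0', zero_mul] at q1
  linarith

/-- The heights of the null line are closed in the set of all heights. -/
theorem mem_axisHeights_of_mem_closure (h : IsOneSidedFoliated X ℓ) (ha : IsAdapted ℓ v n m e)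
    {z₁ : S} (hcl : ℓ (X z₁) ∈ closure (axisHeights X ℓ n c)) :
    ℓ (X z₁) ∈ axisHeights X ℓ n c := by
  by_contra hnot
  have hf := ha.frame
  have hcoeff : ∀ u ∈ axisHeights X ℓ n c, ∃ a : ℝ, ∀ z, ℓ (X z) = u →
      coordQ n c (X z) = a * coordN v n c e (X z) := fun u hu => by
    obtain ⟨A, k, hA⟩ := h.exists_normal_form_axis ha hu
    exact ⟨A u, hA.self_of_nhds.2.2⟩
  choose! a haq using hcoeff
  obtain ⟨A, hlim, hA⟩ := h.exists_limit_coeff ha hcl haq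
  obtain ⟨z, hz⟩ := h.exists_axis_point ha hA
  set β := ℓ (X z₁) with hβ
  have hne : (nhdsWithin β (axisHeights X ℓ n c)).NeBot := mem_closure_iff_nhdsWithin_neBot.1 hcl
  have hzβ : ℓ (X z) = β := by rw [hz, ha.height_axis]
  have hX : ∀ P, coordX v (X z) P = coordX v c P := fun P => by
    unfold coordX
    rw [hz]
    simp only [lorentz_sub_left, lorentz_add_left, lorentz_smul_left, hf.nv]
    ring
  have hQ : ∀ P, coordQ n (X z) P = coordQ n c P := fun P => by
    unfold coordQ
    rw [hz]
    simp only [lorentz_sub_left, lorentz_add_left, lorentz_smul_left, hf.nn]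
    ring
  have hz0 : coordQ n c (X z) = 0 := by
    rw [← hQ]; simp [coordQ, lorentz_zero_left]
  obtain ⟨Ω, r, ψ, hzΩ, hg⟩ := exists_isGraphOn_of_injective h.smooth (z := z) (v := v) (n := n)
    (m := m) (e := e) fun w h1 h2 => h.eq_zero_of_dX_axis ha hz0 (by rw [hzβ]; exact hA) h1
      (by rw [ha.height]; exact h2)
  have hr0 : |(0 : ℝ)| < r := by simpa using hg.pos
  have hform : ∀ x u A', |x| < r → |u| < r →
      (∀ z', ℓ (X z') = β + u → coordQ n c (X z') = A' * coordN v n c e (X z')) →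
      ψ (x, u) = A' * (x ^ 2 - e * ψ (x, u) ^ 2) := by
    intro x u A' hx hu hA'
    obtain ⟨z', hz', hzb⟩ := hg.surj (x, u) (mem_ball_pair hx hu)
    have hx' : coordX v (X z) (X z') = x := congrArg Prod.fst hzb
    have hu' : coordU n m e (X z) (X z') = u := congrArg Prod.snd hzb
    have hq := hg.eq z' hz'
    rw [hzb] at hq
    rw [ha.coordU_eq, hzβ] at hu'
    have := hA' z' (by linarith)
    unfold coordN at this
    rwa [← hX, ← hQ, hx', hq] at this
  have hψ0 : ψ (0, 0) = 0 := by
    have := hg.eq z hzΩ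
    simp only [coordQ, coordX, coordU, sub_self, lorentz_zero_left, mul_zero, add_zero] at this
    exact this.symm
  have hs : ContDiffAt ℝ ∞ ψ (0, 0) := hg.smooth _ (mem_ball_pair hr0 hr0)
  have hd1 : D1 ψ (0, 0) = 0 := by
    have hd := hasDerivAt_D1 hs
    have hd2 := (((hasDerivAt_id (0 : ℝ)).pow 2).sub ((hd.pow 2).const_mul e)).const_mul A
    have h3 := (hd.congr_of_eventuallyEq (f₁ := fun x => A * (x ^ 2 - e * ψ (x, 0) ^ 2)) (by
      filter_upwards [eventually_abs_lt_zero hg.pos] with x hx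
      exact (hform x 0 A hx hr0 (by rw [add_zero]; exact fun z' hz' => (hA z' hz').1)).symm)).unique
      hd2
    rw [h3, hψ0]
    simp
  have hd2 : D2 ψ (0, 0) = 0 := by
    have hd := hasDerivAt_D2 hs
    rw [← sub_self β] at hd
    have hd' := hd.comp_sub_const β β
    simp only [sub_self] at hd'
    have hsl := hasDerivAt_iff_tendsto_slope.1 hd'
    have hle : nhdsWithin β (axisHeights X ℓ n c) ≤ nhdsWithin β {β}ᶜ :=
      nhdsWithin_mono _ fun u hu h0 => hnot (h0 ▸ hu)
    refine tendsto_nhds_unique (hsl.mono_left hle) ?_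
    have hc : Filter.Tendsto (fun u => e * a u * ψ (0, u - β))
        (nhdsWithin β (axisHeights X ℓ n c)) (nhds (e * A * 0)) := by
      refine (hlim.const_mul e).mul ?_
      have := hd'.continuousAt.tendsto
      simp only [sub_self, hψ0] at this
      exact this.mono_left nhdsWithin_le_nhds
    rw [mul_zero] at hc
    have hev : ∀ᶠ u in nhds β, |u - β| < r := by
      have : Continuous fun u : ℝ => |u - β| := by fun_prop
      exact this.continuousAt.eventually_lt_const (by simpa using hg.pos)
    refine tendsto_const_nhds.congr' ?_
    filter_upwards [hc.eventually_const_lt (show (-1 : ℝ) < 0 by norm_num),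
      nhdsWithin_le_nhds hev, self_mem_nhdsWithin] with u hu1 hu2 huG
    have h3 := hform 0 (u - β) (a u) hr0 hu2 (by rw [add_sub_cancel]; exact haq u huG)
    have h4 : ψ (0, u - β) * (1 + e * a u * ψ (0, u - β)) = 0 := by linear_combination h3
    have h5 := (mul_eq_zero.1 h4).resolve_right (by linarith)
    rw [slope_def_field, h5, sub_self, hψ0, sub_zero, zero_div]
  refine hnot ⟨z, hz, fun w => ?_⟩
  have := (hg.isNormalAt hf h.smooth (h.inj z) hzΩ).orth w
  rw [show base X v n m (X z) e z = (0, 0) by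
    simp [base, coordX, coordU, lorentz_zero_left]] at this
  simp only [graphNormal, hd1, hd2, mul_zero, zero_smul, zero_add, zero_sub,
    lorentz_smul_right] at this
  linarith

/-- If the surface is connected, then all the leaves meet the null line through a lightlike
point. -/
theorem range_height_subset [ConnectedSpace S] (h : IsOneSidedFoliated X ℓ)
    (ha : IsAdapted ℓ v n m e) {z₀ : S} (ht : ∀ w, lorentz (dX X z₀ w) n = 0) :
    Set.range (fun z => ℓ (X z)) ⊆ axisHeights X ℓ n (X z₀) := by
  refine (isPreconnected_range h.continuous_height).subset_of_closure_inter_subset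
    (h.isOpen_axisHeights ha) ⟨ℓ (X z₀), ⟨z₀, rfl⟩, z₀, by simp, ht⟩ ?_
  rintro _ ⟨hcl, z, rfl⟩
  exact h.mem_axisHeights_of_mem_closure ha hcl

end IsOneSidedFoliated

end

/-! ### Surfaces whose leaves are conics tangent to a null line -/

section

variable {S : Type*} [TopologicalSpace S] [ChartedSpace E2 S]

/-- The leaves of the surface are the conics `q = a(u) (x² - e q²)` in the planes `ℓ = u`, which
touch the null line through `c` in the direction `n`, and `a` satisfies a Riccati equation. -/
structure HasConicLeaves (X : S → L3) (ℓ : L3 →ₗ[ℝ] ℝ) (v n m c : L3) (e : ℝ) (a : ℝ → ℝ) (k : ℝ) :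
    Prop where
  adapted : IsAdapted ℓ v n m e
  deriv : ∀ z, HasDerivAt a (a (ℓ (X z)) ^ 2 + k) (ℓ (X z))
  conic : ∀ z, coordQ n c (X z) = a (ℓ (X z)) * coordN v n c e (X z)
  nonneg : ∀ z, 0 ≤ a (ℓ (X z)) * coordQ n c (X z)
  isOpen : IsOpen (Set.range fun z => ℓ (X z))

theorem IsOneSidedFoliated.exists_hasConicLeaves [IsManifold (𝓡 2) ∞ S] [ConnectedSpace S]
    {X : S → L3} {ℓ : L3 →ₗ[ℝ] ℝ} {v n m : L3} {e : ℝ} (h : IsOneSidedFoliated X ℓ)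
    (ha : IsAdapted ℓ v n m e) {z₀ : S} (ht : ∀ w, lorentz (dX X z₀ w) n = 0) :
    ∃ a k, HasConicLeaves X ℓ v n m (X z₀) e a k := by
  set c := X z₀ with hc
  set G := axisHeights X ℓ n c with hG
  have hsub : ∀ z, ℓ (X z) ∈ G := fun z => h.range_height_subset ha ht ⟨z, rfl⟩
  have hrange : Set.range (fun z => ℓ (X z)) = G := by
    refine Set.Subset.antisymm (by rintro _ ⟨z, rfl⟩; exact hsub z) ?_
    rintro u ⟨z, hz, -⟩
    exact ⟨z, by simp only [hz, ha.height_axis]⟩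
  have hopen : IsOpen G := h.isOpen_axisHeights ha
  have hpre : IsPreconnected G := hrange ▸ isPreconnected_range h.continuous_height
  have hcoeff : ∀ u ∈ G, ∃ a : ℝ, ∀ z, ℓ (X z) = u →
      coordQ n c (X z) = a * coordN v n c e (X z) := fun u hu => by
    obtain ⟨A, k, hA⟩ := h.exists_normal_form_axis ha hu
    exact ⟨A u, hA.self_of_nhds.2.2⟩
  choose! a haq using hcoeff
  -- the coefficient is determined by a point of the leaf with `x² - e q² ≠ 0`
  have huniq : ∀ u ∈ G, ∀ A : ℝ, (∀ z, ℓ (X z) = u → coordQ n c (X z) = A * coordN v n c e (X z)) →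
      a u = A := by
    intro u hu A hA
    obtain ⟨z₁, hz₁⟩ : ∃ z, ℓ (X z) = u := by rw [← hrange] at hu; exact hu
    obtain ⟨z, hz, hN⟩ := h.exists_coordN_ne_zero (c := c) ha (z₁ := z₁)
      (subset_closure (hsub z₁))
    rw [hz₁] at hz
    have := haq u hu z hz
    rw [hA z hz] at this
    exact (mul_right_cancel₀ hN this).symm
  have hloc : ∀ u ∈ G, ∃ k, ∀ᶠ u' in nhds u, HasDerivAt a (a u' ^ 2 + k) u' := by
    intro u hu
    obtain ⟨A, k, hA⟩ := h.exists_normal_form_axis ha hu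
    refine ⟨k, ?_⟩
    filter_upwards [hA.eventually_nhds] with u' hu'
    have heq : a =ᶠ[nhds u'] A := by
      filter_upwards [hu'] with u'' h'' using huniq u'' h''.2.1 _ h''.2.2
    rw [heq.self_of_nhds]
    exact hu'.self_of_nhds.1.congr_of_eventuallyEq heq
  have hD : ∀ u ∈ G, HasDerivAt (fun u => deriv a u - a u ^ 2) 0 u := by
    intro u hu
    obtain ⟨k, hk⟩ := hloc u hu
    refine (hasDerivAt_const u k).congr_of_eventuallyEq ?_
    filter_upwards [hk] with u' hu'
    rw [hu'.deriv]; ring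
  refine ⟨a, deriv a (ℓ c) - a (ℓ c) ^ 2, ha, fun z => ?_, fun z => haq _ (hsub z) z rfl,
    fun z => h.coeff_mul_nonneg ha (hsub z) (haq _ (hsub z)) rfl, hrange ▸ hopen⟩
  have h1 := hopen.is_const_of_deriv_eq_zero hpre
    (fun t ht => (hD t ht).differentiableAt.differentiableWithinAt)
    (fun t ht => (hD t ht).deriv) (hsub z) (hsub z₀)
  obtain ⟨k, hk⟩ := hloc _ (hsub z)
  have h2 := hk.self_of_nhds
  rw [hc, ← h1, add_sub_cancel, h2.deriv]
  exact h2

/-- The normal vector of a surface with leaves `q = A (x² - e q²)`, `A' = A² + k`. -/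
def conicNormal (v n m : L3) (e A k x q N : ℝ) : L3 :=
  (2 * A * x) • v + (2 * (A ^ 2 + k) * N) • m + (2 * e * (A ^ 2 + k) * N - 4 * e * A * q - 2) • n

namespace HasConicLeaves

variable {X : S → L3} {ℓ : L3 →ₗ[ℝ] ℝ} {v n m c : L3} {e k : ℝ} {a : ℝ → ℝ}

theorem conicNormal_self (hf : NullFrame v n m) {A x q N : ℝ} (hN : N = x ^ 2 - e * q ^ 2)
    (hq : q = A * N) :
    lorentz (conicNormal v n m e A k x q N) (conicNormal v n m e A k x q N) =
      -4 * k * N * (1 - e * k * N) := by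
  simp only [conicNormal, lorentz_add_left, lorentz_add_right, lorentz_smul_left,
    lorentz_smul_right, hf.vv, hf.nn, hf.mm, hf.vn, hf.vm, hf.nm, hf.nv, hf.mv, hf.mn]
  have hx : x ^ 2 = N + e * (A * N) ^ 2 := by rw [← hq]; linarith
  rw [hq]
  linear_combination 4 * A ^ 2 * hx

theorem coordN_eq (P : L3) : coordN v n c e P = coordX v c P ^ 2 - e * coordQ n c P ^ 2 := rfl

theorem isNormalAt [IsManifold (𝓡 2) ∞ S] (h : HasConicLeaves X ℓ v n m c e a k)
    (hX : ContMDiff (𝓡 2) 𝓘(ℝ, L3) ∞ X) {z : S} (hinj : Function.Injective (dX X z)) :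
    IsNormalAt X z (conicNormal v n m e (a (ℓ (X z))) k (coordX v c (X z)) (coordQ n c (X z))
      (coordN v n c e (X z))) := by
  have hf := h.adapted.frame
  have hq := h.conic z
  have hN := coordN_eq (v := v) (n := n) (c := c) (e := e) (X z)
  refine ⟨hinj, fun h0 => ?_, fun w => ?_⟩
  · set x := coordX v c (X z)
    set q := coordQ n c (X z)
    set N := coordN v n c e (X z)
    set A := a (ℓ (X z))
    have h1 := congrArg (fun y => lorentz y v) h0
    have h2 := congrArg (fun y => lorentz y n) h0
    have h3 := congrArg (fun y => lorentz y m) h0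
    simp only [conicNormal, lorentz_add_left, lorentz_smul_left, lorentz_zero_left, hf.vv, hf.nn,
      hf.mm, hf.vn, hf.vm, hf.nm, hf.nv, hf.mv, hf.mn] at h1 h2 h3
    -- `A x = 0` and `2 e A q = -1`, which contradicts `q = A (x² - e q²)`
    have e1 : A * x = 0 := by linarith
    have e2 : 2 * e * A * q = -1 := by linear_combination -h3 + e * h2
    have e3 : (A * x) ^ 2 = A * q * (1 + e * A * q) := by
      rw [hN] at hq
      linear_combination -A * hq
    rw [e1] at e3
    have e4 : A * q = 0 := by
      have : A * q * (1 / 2) = 0 := by linear_combination -e3 - A * q * e2 / 2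
      linarith
    have : 2 * e * (A * q) = -1 := by linarith
    rw [e4] at this
    norm_num at this
  · have hℓ : HasFDerivAt (fun P => ℓ P) (LinearMap.toContinuousLinearMap ℓ) (X z) :=
      (LinearMap.toContinuousLinearMap ℓ).hasFDerivAt
    have hF := (((h.deriv z).comp_hasFDerivAt (X z) hℓ).mul
      (((hasFDerivAt_coordX v c (X z)).pow 2).sub
        (((hasFDerivAt_coordQ n c (X z)).pow 2).const_mul e))).sub (hasFDerivAt_coordQ n c (X z))
    have h0 := hasFDerivAt_apply_dX_eq_zero hX hF (Filter.Eventually.of_forall fun z' => by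
      have := h.conic z'
      rw [coordN_eq] at this
      simp only [Pi.sub_apply, Pi.mul_apply, Function.comp_apply]
      linarith) w
    simp only [sub_apply, add_apply, smul_apply, pairing_apply, smul_eq_mul,
      Function.comp_apply, Pi.sub_apply, Nat.add_one_sub_one, pow_one,
      LinearMap.coe_toContinuousLinearMap', nsmul_eq_mul, Nat.cast_ofNat,
      h.adapted.height (dX X z w), ← coordN_eq] at h0
    simp only [conicNormal, lorentz_add_right, lorentz_smul_right]
    linear_combination h0

theorem lightlikeAt_iff [IsManifold (𝓡 2) ∞ S] (h : HasConicLeaves X ℓ v n m c e a k)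
    (hX : ContMDiff (𝓡 2) 𝓘(ℝ, L3) ∞ X) {z : S} (hinj : Function.Injective (dX X z)) :
    LightlikeAt X z ↔ k * coordN v n c e (X z) * (1 - e * k * coordN v n c e (X z)) = 0 := by
  rw [(h.isNormalAt hX hinj).lightlike_iff, conicNormal_self h.adapted.frame (coordN_eq _)
    (h.conic z)]
  constructor <;> intro h' <;> linarith

theorem k_ne_zero [IsManifold (𝓡 2) ∞ S] (h : HasConicLeaves X ℓ v n m c e a k)
    (hX : ContMDiff (𝓡 2) 𝓘(ℝ, L3) ∞ X) {z : S} (hinj : Function.Injective (dX X z))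
    (hz : ¬ LightlikeAt X z) : k ≠ 0 := by
  rintro rfl
  rw [h.lightlikeAt_iff hX hinj] at hz
  simp at hz

/-- On a one-sided surface with leaves `q = a (x² - e q²)` the lightlike points off the curve
`x² - e q² = 0` lie on the axis `x = 0`: at the other points of the curve `e k (x² - e q²) = 1` the
causal character changes. -/
theorem coordX_eq_zero_of_lightlikeAt [IsManifold (𝓡 2) ∞ S]
    (h : HasConicLeaves X ℓ v n m c e a k) (hs : IsOneSidedFoliated X ℓ) (hk : k ≠ 0) {z : S}
    (hN : e * k * coordN v n c e (X z) = 1) : coordX v c (X z) = 0 := by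
  have hf := h.adapted.frame
  have hnorm := fun z' => h.isNormalAt hs.smooth (hs.inj z')
  have hself : ∀ z', _ = -4 * k * coordN v n c e (X z') * (1 - e * k * coordN v n c e (X z')) :=
    fun z' => conicNormal_self (k := k) hf (coordN_eq (X z')) (h.conic z')
  set F : L3 → ℝ := fun P => -4 * k * coordN v n c e P * (1 - e * k * coordN v n c e P) with hF
  have hF0 : F (X z) = 0 := by simp only [hF]; rw [hN]; ring
  have hext : IsLocalExtr (fun z' => F (X z')) z := by
    refine hs.oneSided.symm.imp (fun h' => ?_) fun h' => ?_
    · refine Filter.Eventually.of_forall fun z' => ?_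
      have := h' z'
      rw [(hnorm z').spacelike_iff, hself z'] at this
      exact hF0.trans_le (not_lt.1 this)
    · refine Filter.Eventually.of_forall fun z' => ?_
      have := h' z'
      rw [(hnorm z').timelike_iff, hself z'] at this
      exact (not_lt.1 this).trans_eq hF0.symm
  have hdN : HasFDerivAt (coordN v n c e) _ (X z) :=
    ((hasFDerivAt_coordX v c (X z)).pow 2).sub
      (((hasFDerivAt_coordQ n c (X z)).pow 2).const_mul e)
  have hdF : HasFDerivAt F _ (X z) :=
    (hdN.const_mul (-4 * k)).mul ((hdN.const_mul (e * k)).const_sub 1)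
  set A := a (ℓ (X z)) with hA
  set x := coordX v c (X z) with hx
  set q := coordQ n c (X z) with hq
  -- the tangent vector of the leaf
  obtain ⟨w, hw⟩ := (hnorm z).exists_preimage
    (y := (1 + 2 * e * A * q) • v + (2 * A * x) • (m - e • n)) (by
      simp only [conicNormal, lorentz_add_left, lorentz_add_right, lorentz_smul_left,
        lorentz_smul_right, lorentz_sub_left, hf.vv, hf.nn, hf.mm, hf.vn, hf.vm, hf.nm, hf.nv,
        hf.mv, hf.mn]
      ring)
  have h0 := hasFDerivAt_apply_dX_eq_zero_of_isLocalExtr hs.smooth hdF hext w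
  rw [hw] at h0
  simp only [add_apply, sub_apply, neg_apply, smul_apply, pairing_apply, smul_eq_mul, nsmul_eq_mul,
    Nat.cast_ofNat, Nat.add_one_sub_one, pow_one, lorentz_add_left, lorentz_smul_left,
    lorentz_sub_left, hf.vv, hf.nn, hf.vn, hf.nv, hf.mv, hf.mn] at h0
  have h1 : k * x = 0 := by
    linear_combination h0 / 8 - 2 * k * x * hN
  exact (mul_eq_zero.1 h1).resolve_left hk

end HasConicLeaves

end

/-! ### The lightlike part -/

section

/-- A solution of the Riccati equation which is stationary at one height is constant. -/
theorem HasConicLeaves.coeff_const {S : Type*} [TopologicalSpace S] [ConnectedSpace S]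
    {X : S → L3} {ℓ : L3 →ₗ[ℝ] ℝ} {v n m c : L3} {e k : ℝ} {a : ℝ → ℝ}
    (h : HasConicLeaves X ℓ v n m c e a k)
    (hX : Continuous X) {z₀ : S}
    (h0 : a (ℓ (X z₀)) ^ 2 + k = 0) (z : S) : a (ℓ (X z)) = a (ℓ (X z₀)) := by
  set A := a (ℓ (X z₀)) with hA
  set J := Set.range fun z => ℓ (X z) with hJ
  have hpre : IsPreconnected J :=
    isPreconnected_range ((LinearMap.continuous_of_finiteDimensional ℓ).comp hX)
  have hd : ∀ u ∈ J, HasDerivAt a (a u ^ 2 + k) u := by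
    rintro _ ⟨z, rfl⟩; exact h.deriv z
  have hopen : IsOpen (J ∩ {u | a u = A}) := by
    rw [isOpen_iff_mem_nhds]
    rintro u ⟨hu, hua⟩
    have hua : a u = A := hua
    have hb : ∀ᶠ u' in nhds u, u' ∈ J ∧ |a u' + A| ≤ 2 * |A| + 1 := by
      refine Filter.Eventually.and (h.isOpen.mem_nhds hu) ?_
      have hc : ContinuousAt (fun u' => |a u' + A|) u :=
        ((hd u hu).continuousAt.add continuousAt_const).abs
      refine (hc.eventually_lt_const (u := 2 * |A| + 1) ?_).mono fun _ h => h.le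
      change |a u + A| < 2 * |A| + 1
      rw [hua, ← two_mul, abs_mul, abs_two]; linarith
    obtain ⟨r, hr, hball⟩ := Metric.eventually_nhds_iff_ball.1 hb
    have hin : ∀ t ∈ Set.Icc (-(r / 2)) (r / 2), t + u ∈ J ∧ |a (t + u) + A| ≤ 2 * |A| + 1 := by
      intro t ht
      apply hball
      rw [mem_ball_iff_norm, add_sub_cancel_right, Real.norm_eq_abs]
      exact (abs_le.2 ht).trans_lt (by linarith)
    have hz := eq_zero_of_norm_deriv_le (f := fun t => a (t + u) - A)
      (f' := fun t => a (t + u) ^ 2 + k) (K := 2 * |A| + 1) (r := r / 2)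
      (fun t ht => ((hd _ (hin t ht).1).comp_add_const t u).sub_const A)
      (fun t ht => by
        rw [show a (t + u) ^ 2 + k = (a (t + u) + A) * (a (t + u) - A) by linear_combination h0,
          norm_mul, Real.norm_eq_abs]
        exact mul_le_mul_of_nonneg_right (hin t ht).2 (norm_nonneg _))
      (by simp [hua])
    filter_upwards [Ioo_mem_nhds (show u - r / 2 < u by linarith) (show u < u + r / 2 by linarith)]
      with u' hu'
    have hm : u' - u ∈ Set.Icc (-(r / 2)) (r / 2) := ⟨by linarith [hu'.1], by linarith [hu'.2]⟩
    have h1 := hz _ hm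
    have h2 := (hin _ hm).1
    rw [sub_add_cancel] at h1 h2
    exact ⟨h2, by simp only [Set.mem_ofPred_eq]; linarith⟩
  have hsub := hpre.subset_of_closure_inter_subset hopen ⟨ℓ (X z₀), ⟨z₀, rfl⟩, ⟨z₀, rfl⟩, rfl⟩ (by
    rintro u ⟨hcl, hu⟩
    refine ⟨hu, ?_⟩
    have := mem_closure_iff_nhdsWithin_neBot.1 hcl
    refine tendsto_nhds_unique ((hd u hu).continuousAt.tendsto.mono_left nhdsWithin_le_nhds)
      (tendsto_const_nhds.congr' ?_ : Filter.Tendsto a (nhdsWithin u (J ∩ {u | a u = A})) (nhds A))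
    filter_upwards [self_mem_nhdsWithin] with u' hu' using hu'.2.symm)
  exact (hsub ⟨z, rfl⟩).2

variable {S : Type*} [TopologicalSpace S] [ChartedSpace E2 S]

/-- Every lightlike point of a one-sided surface has an adapted null frame. -/
theorem IsOneSidedFoliated.exists_isAdapted [IsManifold (𝓡 2) ∞ S] {X : S → L3}
    {ℓ : L3 →ₗ[ℝ] ℝ} (h : IsOneSidedFoliated X ℓ) {z : S} (hl : LightlikeAt X z) :
    ∃ v n m e, IsAdapted ℓ v n m e ∧ ∀ w, lorentz (dX X z w) n = 0 := by
  obtain ⟨n₀, hn₀, hN⟩ := hl.exists_normal (h.inj z)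
  have hℓ := h.height_ne_zero hn₀ hN
  set n := (ℓ n₀)⁻¹ • n₀ with hn
  have hn0 : n ≠ 0 := smul_ne_zero (inv_ne_zero hℓ) hN.ne
  have hnn : lorentz n n = 0 := by rw [hn, lorentz_smul_left, lorentz_smul_right, hn₀]; ring
  have hℓn : ℓ n = 1 := by rw [hn, map_smul, smul_eq_mul, inv_mul_cancel₀ hℓ]
  -- a vector orthogonal to `n` and not proportional to it
  set y : L3 := ![-n 1, n 0, 0] with hy
  have hyn : lorentz y n = 0 := by
    simp only [hy, lorentz, Matrix.cons_val]; ring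
  have hys : ∀ s : ℝ, y ≠ s • n := by
    intro s hs
    have h0 := congrFun hs 0
    have h1 := congrFun hs 1
    have h2 := congrFun hs 2
    simp only [hy, Pi.smul_apply, smul_eq_mul, Matrix.cons_val] at h0 h1 h2
    apply hn0
    have hnn' := hnn
    simp only [lorentz] at hnn'
    rcases mul_eq_zero.1 h2.symm with h3 | h3
    · rw [h3] at h0 h1
      have e0 : n 0 = 0 := by linarith
      have e1 : n 1 = 0 := by linarith
      have e2 : n 2 = 0 := by
        rw [e0, e1] at hnn'
        have : n 2 * n 2 = 0 := by linarith
        exact mul_self_eq_zero.1 this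
      ext i; fin_cases i <;> simp [e0, e1, e2]
    · rw [h3] at hnn'
      have e0 : n 0 = 0 := by nlinarith [mul_self_nonneg (n 0), mul_self_nonneg (n 1)]
      have e1 : n 1 = 0 := by nlinarith [mul_self_nonneg (n 0), mul_self_nonneg (n 1)]
      ext i; fin_cases i <;> simp [e0, e1, h3]
  set y' := y - ℓ y • n with hy'
  have hy'n : lorentz y' n = 0 := by
    rw [hy', lorentz_sub_left, lorentz_smul_left, hyn, hnn]; ring
  have hy's : ∀ s : ℝ, y' ≠ s • n := fun s hs => hys (s + ℓ y) (by
    rw [add_smul, ← hs, hy']; abel)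
  have hℓy' : ℓ y' = 0 := by rw [hy', map_sub, map_smul, hℓn]; simp
  have hpos := lorentz_self_pos_of_orthogonal_null hn0 hnn hy'n hy's
  set α := Real.sqrt (lorentz y' y') with hα
  have hα0 : 0 < α := Real.sqrt_pos.2 hpos
  have hα2 : α * α = lorentz y' y' := Real.mul_self_sqrt hpos.le
  have hvv : lorentz (α⁻¹ • y') (α⁻¹ • y') = 1 := by
    rw [lorentz_smul_left, lorentz_smul_right, ← hα2]
    field_simp
  have hvn : lorentz (α⁻¹ • y') n = 0 := by rw [lorentz_smul_left, hy'n, mul_zero]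
  obtain ⟨m, hf⟩ := exists_nullFrame hvv hnn hn0 hvn
  refine ⟨α⁻¹ • y', n, m, ℓ m, ⟨hf, fun w => ?_⟩, fun w => ?_⟩
  · conv_lhs => rw [hf.expand w]
    simp only [map_add, map_smul, hℓy', hℓn, smul_eq_mul]
    ring
  · rw [hn, lorentz_smul_right, hN.orth, mul_zero]

namespace HasConicLeaves

variable {X : S → L3} {ℓ : L3 →ₗ[ℝ] ℝ} {v n m c : L3} {e k : ℝ} {a : ℝ → ℝ}

/-- A lightlike point off the null line lies opposite to it on an ellipse, at a height where the
coefficient `a` of the leaves is stationary. -/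
theorem lightlike_cases [IsManifold (𝓡 2) ∞ S] (h : HasConicLeaves X ℓ v n m c e a k)
    (hs : IsOneSidedFoliated X ℓ) (hk : k ≠ 0) {z : S} (hz : LightlikeAt X z) :
    X z = c + (ℓ (X z) - ℓ c) • n ∨
      (e < 0 ∧ coordX v c (X z) = 0 ∧ a (ℓ (X z)) ≠ 0 ∧ a (ℓ (X z)) ^ 2 + k = 0) := by
  rw [h.lightlikeAt_iff hs.smooth (hs.inj z)] at hz
  have hq := h.conic z
  have hN := coordN_eq (v := v) (n := n) (c := c) (e := e) (X z)
  rcases mul_eq_zero.1 hz with h1 | h1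
  · left
    have hN0 := (mul_eq_zero.1 h1).resolve_left hk
    rw [hN0, mul_zero] at hq
    rw [hN0, hq] at hN
    have hx : coordX v c (X z) = 0 := by
      refine pow_eq_zero_iff two_ne_zero |>.1 ?_
      linarith
    exact h.adapted.eq_axis hx hq
  · right
    have hN1 : e * k * coordN v n c e (X z) = 1 := by linarith
    have hx := h.coordX_eq_zero_of_lightlikeAt hs hk hN1
    have hnn := h.nonneg z
    set q := coordQ n c (X z)
    set N := coordN v n c e (X z)
    set A := a (ℓ (X z))
    rw [hx] at hN
    have hNne : N ≠ 0 := by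
      intro h0; rw [h0, mul_zero] at hN1; exact zero_ne_one hN1
    have hqne : q ≠ 0 := by
      intro h0; rw [h0] at hN; exact hNne (by rw [hN]; ring)
    have h2 : e * A * q = -1 := by
      refine mul_right_cancel₀ hqne ?_
      rw [hN] at hq
      linear_combination hq
    have hAne : A ≠ 0 := by
      intro h0; rw [h0] at h2; norm_num at h2
    refine ⟨?_, hx, hAne, ?_⟩
    · by_contra! he
      nlinarith [mul_nonneg he hnn]
    · -- `e k N = 1` and `(e A q)² = 1` give `k = -A²`
      have h3 : k = -A ^ 2 := by
        have h4 : (e * A * q) ^ 2 = 1 := by rw [h2]; norm_num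
        rw [hN] at hN1
        have h5 : (e * q) ^ 2 * (k + A ^ 2) = 0 := by linear_combination h4 - hN1
        have he0 : e * q ≠ 0 := by
          intro h0
          rw [show e * A * q = A * (e * q) by ring, h0] at h2
          norm_num at h2
        have := (mul_eq_zero.1 h5).resolve_left (pow_ne_zero 2 he0)
        linarith
      rw [h3]; ring

/-- If the leaves are congruent ellipses, then the surface is a circular cylinder with lightlike
rulings. -/
theorem isLightlikeCylinder [IsManifold (𝓡 2) ∞ S] [ConnectedSpace S]
    (h : HasConicLeaves X ℓ v n m c e a k) (hs : IsOneSidedFoliated X ℓ) (hk : k ≠ 0) (he : e < 0)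
    {A : ℝ} (hA0 : A ≠ 0) (hAk : A ^ 2 + k = 0) (hA : ∀ z, a (ℓ (X z)) = A) :
    IsLightlikeCylinder X := by
  have hf := h.adapted.frame
  set J := Set.range fun z => ℓ (X z) with hJ
  have hpre : IsPreconnected J := isPreconnected_range hs.continuous_height
  set σ := Real.sqrt (-e) with hσ
  have hσ0 : 0 < σ := Real.sqrt_pos.2 (by linarith)
  have hσ2 : σ * σ = -e := Real.mul_self_sqrt (by linarith)
  have heσ : e = -(σ * σ) := by linarith
  set r₀ := 1 / (2 * A * σ) with hr₀
  have hr0 : r₀ ≠ 0 := one_div_ne_zero (by positivity)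
  set ρ := |r₀| with hρ
  have hρ0 : 0 < ρ := abs_pos.2 hr0
  set E₁ := σ⁻¹ • (m - e • n) with hE₁
  set M : Matrix (Fin 3) (Fin 3) ℝ := Matrix.of fun i j => ![E₁ i, v i, ((2 * σ) • n - E₁) i] j
    with hM
  have hMv : ∀ w : L3, M *ᵥ w = w 0 • E₁ + w 1 • v + w 2 • ((2 * σ) • n - E₁) := by
    intro w
    ext i
    simp only [hM, Matrix.mulVec, dotProduct, Fin.sum_univ_three, Matrix.of_apply, Matrix.cons_val,
      Pi.add_apply, Pi.smul_apply, smul_eq_mul]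
    ring
  have hML : IsLorentz M := by
    intro w w'
    rw [hMv, hMv]
    simp only [hE₁, lorentz_add_left, lorentz_add_right, lorentz_smul_left, lorentz_smul_right,
      lorentz_sub_left, lorentz_sub_right, hf.vv, hf.nn, hf.mm, hf.vn, hf.vm, hf.nm, hf.nv, hf.mv,
      hf.mn]
    rw [heσ]
    unfold lorentz
    field_simp
    ring
  -- the points of the model cylinder in the coordinates of the frame
  have hpt : ∀ s y₁ y₂ : ℝ, c + r₀ • E₁ + M *ᵥ ![s + y₁, y₂, s] =
      c + y₂ • v + (2 * σ * s - e * (σ⁻¹ * (r₀ + y₁))) • n + (σ⁻¹ * (r₀ + y₁)) • m := by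
    intro s y₁ y₂
    rw [hMv, hE₁]
    simp only [Matrix.cons_val]
    module
  have hcoord : ∀ s y₁ y₂ : ℝ, coordX v c (c + r₀ • E₁ + M *ᵥ ![s + y₁, y₂, s]) = y₂ ∧
      coordQ n c (c + r₀ • E₁ + M *ᵥ ![s + y₁, y₂, s]) = σ⁻¹ * (r₀ + y₁) ∧
      ℓ (c + r₀ • E₁ + M *ᵥ ![s + y₁, y₂, s]) = ℓ c + 2 * σ * s := by
    intro s y₁ y₂
    rw [hpt]
    obtain ⟨h1, h2, h3⟩ := h.adapted.coord_add c y₂ (2 * σ * s - e * (σ⁻¹ * (r₀ + y₁)))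
      (σ⁻¹ * (r₀ + y₁))
    exact ⟨h1, h2, h3.trans (by ring)⟩
  have hconic : ∀ x q : ℝ, q = A * (x ^ 2 - e * q ^ 2) ↔ (σ * q - r₀) ^ 2 + x ^ 2 = ρ ^ 2 := by
    intro x q
    have e1 : 2 * A * σ * r₀ = 1 := by rw [hr₀]; field_simp
    rw [hρ, sq_abs, heσ]
    constructor
    · intro h1
      refine mul_left_cancel₀ hA0 ?_
      linear_combination -h1 - q * e1
    · intro h1
      linear_combination -A * h1 - q * e1
  have hback : ∀ z, X z = c + r₀ • E₁ + M *ᵥ ![(ℓ (X z) - ℓ c) / (2 * σ) +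
      (σ * coordQ n c (X z) - r₀), coordX v c (X z), (ℓ (X z) - ℓ c) / (2 * σ)] := by
    intro z
    have h1 := h.adapted.eq_add c (X z)
    rw [hpt, add_sub_cancel, inv_mul_cancel_left₀ hσ0.ne', mul_div_cancel₀ _ (by positivity)]
    exact h1
  have hcirc : ∀ z, (σ * coordQ n c (X z) - r₀) ^ 2 + coordX v c (X z) ^ 2 = ρ ^ 2 := by
    intro z
    rw [← hconic]
    have := h.conic z
    rwa [hA z] at this
  have hJz : ∀ z, ℓ c + 2 * σ * ((ℓ (X z) - ℓ c) / (2 * σ)) ∈ J := by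
    intro z
    rw [mul_div_cancel₀ _ (by positivity), add_sub_cancel]
    exact ⟨z, rfl⟩
  -- the leaves are full ellipses
  have hfull : ∀ s y₁ y₂ : ℝ, ℓ c + 2 * σ * s ∈ J → y₁ ^ 2 + y₂ ^ 2 = ρ ^ 2 →
      ∃ z, X z = c + r₀ • E₁ + M *ᵥ ![s + y₁, y₂, s] := by
    rintro s y₁ y₂ ⟨z₁, hz₁⟩ hy
    obtain ⟨h1, h2, h3⟩ := hcoord s y₁ y₂
    have hz₁ : ℓ (X z₁) = ℓ c + 2 * σ * s := hz₁
    have hu : ∀ P ∈ leaf X ℓ (ℓ (X z₁)), ℓ P = ℓ (X z₁) := by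
      rintro _ ⟨z, hz, rfl⟩; exact hz
    have hq : ∀ P ∈ leaf X ℓ (ℓ (X z₁)), coordQ n c P = A * coordN v n c e P := by
      rintro _ ⟨z, hz, rfl⟩
      rw [← hA z]; exact h.conic z
    rcases hs.leaves z₁ with hC | hC
    · obtain ⟨z, -, hz⟩ := (h.adapted.mem_circle hC hu hq).2 _ (h3.trans hz₁.symm) (by
        rw [coordN_eq, h1, h2, hconic, mul_inv_cancel_left₀ hσ0.ne', add_sub_cancel_left]
        exact hy) (Or.inl he)
      exact ⟨z, hz⟩
    · have hnn : ∀ P ∈ leaf X ℓ (ℓ (X z₁)), 0 ≤ A * coordQ n c P := by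
        rintro _ ⟨z, hz, rfl⟩
        rw [← hA z]; exact h.nonneg z
      exact absurd (h.adapted.line_eq hC hu hq hnn).1 hA0
  have hlight : ∀ z, LightlikeAt X z ↔ coordX v c (X z) = 0 := by
    intro z
    constructor
    · intro hz
      rcases h.lightlike_cases hs hk hz with h1 | h1
      · rw [h1]
        unfold coordX
        rw [add_sub_cancel_left, lorentz_smul_left, hf.nv, mul_zero]
      · exact h1.2.1
    · intro hx
      rw [h.lightlikeAt_iff hs.smooth (hs.inj z)]
      have h1 := h.conic z
      rw [hA z, coordN_eq, hx] at h1
      rw [coordN_eq, hx]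
      have hk' : k = -A ^ 2 := by linarith
      rw [hk']
      linear_combination (A ^ 2 * e * coordQ n c (X z) * (1 - A * e * coordQ n c (X z))) * h1
  refine ⟨M, c + r₀ • E₁, ρ, (fun s => ℓ c + 2 * σ * s) ⁻¹' J, hML, hρ0,
    h.isOpen.preimage (by fun_prop), ?_, ?_, ?_⟩
  · refine hpre.ordConnected.preimage_mono fun s s' hss => ?_
    change ℓ c + 2 * σ * s ≤ ℓ c + 2 * σ * s'
    have := mul_le_mul_of_nonneg_left hss hσ0.le
    linarith
  · ext P
    constructor
    · rintro ⟨z, rfl⟩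
      obtain ⟨θ, h1, h2⟩ := exists_cos_sin (x := (σ * coordQ n c (X z) - r₀) / ρ)
        (y := coordX v c (X z) / ρ) (by
          rw [div_pow, div_pow, ← add_div, hcirc z, div_self (by positivity)])
      refine ⟨(ℓ (X z) - ℓ c) / (2 * σ), hJz z, θ, ?_⟩
      rw [← h1, ← h2, mul_div_cancel₀ _ hρ0.ne', mul_div_cancel₀ _ hρ0.ne']
      exact hback z
    · rintro ⟨s, hsJ, θ, rfl⟩
      exact hfull s _ _ hsJ (by linear_combination ρ ^ 2 * Real.cos_sq_add_sin_sq θ)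
  · ext P
    constructor
    · rintro ⟨z, hz, rfl⟩
      have hx := (hlight z).1 hz
      refine ⟨(ℓ (X z) - ℓ c) / (2 * σ), hJz z, ?_⟩
      have h1 := hcirc z
      have h2 := hback z
      rw [hx] at h1 h2
      have h3 : (σ * coordQ n c (X z) - r₀) ^ 2 = ρ ^ 2 := by linarith
      rcases sq_eq_sq_iff_eq_or_eq_neg.1 h3 with h4 | h4
      · left; rw [h4] at h2; exact h2
      · right; rw [h4, ← sub_eq_add_neg] at h2; exact h2
    · have hlast : ∀ s y : ℝ, ℓ c + 2 * σ * s ∈ J → y ^ 2 = ρ ^ 2 →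
          c + r₀ • E₁ + M *ᵥ ![s + y, 0, s] ∈ lightlikePart X := by
        intro s y hsJ hy
        obtain ⟨z, hz⟩ := hfull s y 0 hsJ (by rw [hy]; ring)
        refine ⟨z, (hlight z).2 ?_, hz⟩
        rw [hz]; exact (hcoord s y 0).1
      rintro ⟨s, hsJ, rfl | rfl⟩
      · exact hlast s ρ hsJ rfl
      · rw [sub_eq_add_neg]
        exact hlast s (-ρ) hsJ (neg_sq ρ)

end HasConicLeaves

end

end LorentzMinkowski

open LorentzMinkowski in
theorem corollary4p4 {S : Type*} [TopologicalSpace S] [T2Space S] [SecondCountableTopology S]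
    [ConnectedSpace S] [ChartedSpace E2 S] [IsManifold (𝓡 2) ∞ S] (X : S → L3)
    (hX : IsZMCOfRiemannType X) (h2 : HasExactlyTwoCausalCharacters X) :
    (∃ C : Set L3, IsLine C ∧ lightlikePart X ⊆ C) ∨ IsLightlikeCylinder X := by
  obtain ⟨ℓ, ht, hl, hc⟩ := hX.foliated
  have hone : (∀ z, ¬ TimelikeAt X z) ∨ ∀ z, ¬ SpacelikeAt X z :=
    h2.imp (fun h => not_exists.1 h.2.2) fun h => not_exists.1 h.2.2
  have h : IsOneSidedFoliated X ℓ :=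
    ⟨hX.smooth, hX.immersion, hX.zeroMeanCurvature, ht, hl, hc, hone⟩
  obtain ⟨z₀, hz₀⟩ : ∃ z, LightlikeAt X z := h2.elim (fun h => h.2.1) fun h => h.2.1
  obtain ⟨z₁, hz₁⟩ : ∃ z, ¬ LightlikeAt X z :=
    h2.elim (fun h => h.1.imp fun _ hz => hz.not_lightlikeAt) fun h => h.1.imp fun _ hz => hz.1
  obtain ⟨v, n, m, e, ha, htan⟩ := h.exists_isAdapted hz₀
  obtain ⟨a, k, hcon⟩ := h.exists_hasConicLeaves ha htan
  have hk := hcon.k_ne_zero h.smooth (h.inj z₁) hz₁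
  by_cases hcyl : ∃ z, e < 0 ∧ a (ℓ (X z)) ≠ 0 ∧ a (ℓ (X z)) ^ 2 + k = 0
  · obtain ⟨z, he, hA0, hAk⟩ := hcyl
    exact Or.inr (hcon.isLightlikeCylinder h hk he hA0 hAk
      (hcon.coeff_const h.smooth.continuous hAk))
  · refine Or.inl ⟨lineThrough (X z₀) n, ⟨X z₀, n, ha.frame.n_ne, rfl⟩, ?_⟩
    rintro _ ⟨z, hz, rfl⟩
    rcases hcon.lightlike_cases h hk hz with h3 | ⟨he, -, h3⟩
    · exact ⟨_, h3⟩
    · exact absurd ⟨z, he, h3⟩ hcyl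
end
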